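/- Let $v\in\mathbb R$, $p\ge 1$, and let $q_1,\dots,q_p\in\mathbb R$ with $q_p\ne 0$; put $q_n=0$ for $n>p$. Put $\tilde v_n=v_n+q_n$ $(n\ge 1)$ with $v_{n}=v$ for odd $n$ and $v_n=-v$ for even $n$. For $N\ge 1$, $k\in\mathbb Z$, $b\in\mathbb R$ let $c_k=c_k(b)=\cos(b+\pi k/N)$, and let $J_k^b$ be the Jacobi operator on $\ell^2(\{1,2,\dots\})$, $$(J_k^by)_n=a_{n-1}y_{n-1}+a_ny_{n+1}+\tilde v_ny_n,\qquad y_0=0,\qquad a_{2n}=2|c_k|,\quad a_{2n+1}=1 .$$ The bound states of $J_k^b$ are its eigenvalues. For $c_k\neq0$ let $$\sigma_{ac}=\Big\{x\in\mathbb R:\ \sqrt{v^2+(2|c_k|-1)^2}\le|x|\le\sqrt{v^2+(2|c_k|+1)^2}\Big\}$$ and let $\Lambda$ be the two-sheeted surface obtained by joining two copies $\Lambda_+,\Lambda_-$ of $\mathbb C\setminus\sigma_{ac}$ crosswise along the cuts. A point of the second sheet $\Lambda_-$ is a resonance if, for some finitely supported $f,g$, the meromorphic continuation to $\Lambda_-$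 of $\lambda\mapsto\langle (J_k^b-\lambda)^{-1}f,g\rangle$, initially defined on the first sheet $\Lambda_+$, has a pole there; resonances are identified with their projections to $\mathbb C$. For $c_k=0$ the operator is the direct sum of the blocks $\begin{pmatrix}\tilde v_{2n-1}&1\\1&\tilde v_{2n}\end{pmatrix}$, $n\ge1$, with the real eigenvalues $$z_{n,\pm}=\frac{\tilde v_{2n-1}+\tilde v_{2n}}2\pm\sqrt{\Big(\frac{\tilde v_{2n-1}-\tilde v_{2n}}2\Big)^2+1},$$ and $z_{n,\pm}=\pm\sqrt{v^2+1}$ (the flat bands) for all $n$ with $2n-1>p$. Say that the index $n$ is off the flat bands if neither $z_{n,+}$ nor $z_{n,-}$ belongs to $\{\sqrt{v^2+1},-\sqrt{v^2+1}\}$. **Theorem 1.3.** Let $c_k(b)\to0+$, with $v,q,p,N,k$ fixed. Convergence of sets is convergence in the Hausdorff distance in $\mathbb C$; convergence to $\emptyset$ means being eventually empty. 1) Let $p$ be even. a) If every $n$ with $1\le n\le p/2$ is off the flat bands, then the set of bound states of $J_k^b$ converges to $\{z_{n,\pm}:1\le n\le p/2\}\subset\mathbb R$. b) If $n=p/2$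 is off the flat bands, then the set of resonances of $J_k^b$ converges to $\{z_{n,\pm}:1\le n\le (p-2)/2\}\cup\{\mu_{p-1}^0,\mu_p^0\}$, where $$\mu^0_{p-1,p}=v+\frac{q_{p-1}}2\pm\sqrt{\frac{q_{p-1}^2}4-\frac{q_{p-1}}{q_p}}\in\mathbb C$$ (only these two limit points can be non-real). 2) Let $p$ be odd. a) If every $n$ with $1\le n\le (p-1)/2$ is off the flat bands, then the set of bound states of $J_k^b$ converges to $\{z_{n,\pm}:1\le n\le (p+1)/2\}\subset\mathbb R$. b) The set of resonances of $J_k^b$ converges to the set of real numbers $\{z_{n,\pm}:1\le n\le (p-1)/2\}$. -/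

import Mathlib

open Filter Topology
open scoped ENNReal

namespace HalfNanotube

noncomputable section

/-- The coupling constant `c_k(b) = cos (b + π k / N)`. -/
def ck (N : ℕ) (k : ℤ) (b : ℝ) : ℝ := Real.cos (b + Real.pi * k / N)

/-- The off-diagonal coefficients: `a_{2n} = 2|c|` and `a_{2n+1} = 1`. -/
def hop (c : ℝ) (n : ℕ) : ℝ := if Even n then 2 * |c| else 1

/-- The diagonal coefficients `ṽ_n = v_n + q_n`, `n ≥ 1`, where the background has period two,
`v_{2n+1} = v`, `v_{2n} = -v`. -/
def pot (v : ℝ) (q : ℕ →₀ ℝ) (n : ℕ) : ℝ := (if Even n then -v else v) + q n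

/-- The Hilbert space `ℓ²({1, 2, 3, …})`. The sites `1, 2, 3, …` are stored at the indices
`0, 1, 2, …`; use `site` to read a vector at a site. -/
abbrev HSpace : Type := lp (fun _ : ℕ => ℂ) 2

/-- The value `y_n` at the site `n`, with the Dirichlet condition `y_0 = 0`. -/
def site (y : ℕ → ℂ) : ℕ → ℂ
  | 0 => 0
  | n + 1 => y n

/-- The Jacobi difference expression: its value at the site `n = i + 1` is
`a_{n-1} y_{n-1} + a_n y_{n+1} + ṽ_n y_n`. -/
def jacobiSeq (v : ℝ) (q : ℕ →₀ ℝ) (c : ℝ) (y : ℕ → ℂ) (i : ℕ) : ℂ :=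
  (hop c i : ℂ) * site y i + (hop c (i + 1) : ℂ) * site y (i + 2)
    + (pot v q (i + 1) : ℂ) * site y (i + 1)

theorem memlp_mul {w y : ℕ → ℂ} {C : ℝ} (hw : ∀ i, ‖w i‖ ≤ C) (hy : Memℓp y 2) :
    Memℓp (fun i => w i * y i) 2 := by
  have h2 : (0 : ℝ) < (2 : ℝ≥0∞).toReal := by norm_num
  have hC : 0 ≤ C := (norm_nonneg _).trans (hw 0)
  refine memℓp_gen ?_
  have hs := (memℓp_gen_iff h2).1 hy
  refine Summable.of_nonneg_of_le (fun i => by positivity) (fun i => ?_)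
    (hs.mul_left (C ^ (2 : ℝ≥0∞).toReal))
  rw [norm_mul, Real.mul_rpow (norm_nonneg _) (norm_nonneg _)]
  gcongr
  exact hw i

theorem memlp_succ {y : ℕ → ℂ} (hy : Memℓp y 2) : Memℓp (fun i => y (i + 1)) 2 := by
  have h2 : (0 : ℝ) < (2 : ℝ≥0∞).toReal := by norm_num
  refine memℓp_gen ?_
  exact (summable_nat_add_iff 1).2 ((memℓp_gen_iff h2).1 hy)

theorem memlp_site {y : ℕ → ℂ} (hy : Memℓp y 2) : Memℓp (site y) 2 := by
  have h2 : (0 : ℝ) < (2 : ℝ≥0∞).toReal := by norm_num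
  refine memℓp_gen ?_
  exact (summable_nat_add_iff 1).1 ((memℓp_gen_iff h2).1 hy)

theorem norm_hop_le (c : ℝ) (n : ℕ) : ‖(hop c n : ℂ)‖ ≤ 2 * |c| + 1 := by
  have := abs_nonneg c
  rw [Complex.norm_real, Real.norm_eq_abs, hop]
  split_ifs
  · rw [abs_of_nonneg (by positivity)]; linarith
  · rw [abs_one]; linarith

theorem norm_pot_le (v : ℝ) (q : ℕ →₀ ℝ) (n : ℕ) :
    ‖(pot v q n : ℂ)‖ ≤ |v| + ∑ m ∈ q.support, |q m| := by
  rw [Complex.norm_real, Real.norm_eq_abs, pot]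
  refine (abs_add_le _ _).trans (add_le_add ?_ ?_)
  · split_ifs <;> simp
  · by_cases h : n ∈ q.support
    · exact Finset.single_le_sum (f := fun m => |q m|) (fun m _ => abs_nonneg _) h
    · rw [Finsupp.notMem_support_iff.1 h, abs_zero]
      exact Finset.sum_nonneg fun m _ => abs_nonneg _

theorem memlp_jacobiSeq (v : ℝ) (q : ℕ →₀ ℝ) (c : ℝ) {y : ℕ → ℂ} (hy : Memℓp y 2) :
    Memℓp (jacobiSeq v q c y) 2 :=
  ((memlp_mul (fun i => norm_hop_le c i) (memlp_site hy)).add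
    (memlp_mul (fun i => norm_hop_le c (i + 1)) (memlp_succ hy))).add
    (memlp_mul (fun i => norm_pot_le v q (i + 1)) hy)

/-- The Jacobi operator as a linear map on `ℓ²`. -/
def jacobiLin (v : ℝ) (q : ℕ →₀ ℝ) (c : ℝ) : HSpace →ₗ[ℂ] HSpace where
  toFun y := ⟨jacobiSeq v q c y, memlp_jacobiSeq v q c (lp.memℓp y)⟩
  map_add' x y := by
    ext i
    change jacobiSeq v q c (fun j => x j + y j) i = jacobiSeq v q c x i + jacobiSeq v q c y i
    cases i <;> simp only [jacobiSeq, site] <;> ring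
  map_smul' r x := by
    ext i
    change jacobiSeq v q c (fun j => r * x j) i = r * jacobiSeq v q c x i
    cases i <;> simp only [jacobiSeq, site] <;> ring

theorem tendsto_coord {u : ℕ → HSpace} {x : HSpace} (h : Tendsto u atTop (𝓝 x)) (i : ℕ) :
    Tendsto (fun n => (u n : ℕ → ℂ) i) atTop (𝓝 ((x : ℕ → ℂ) i)) := by
  have h0 : Tendsto (fun n => ‖u n - x‖) atTop (𝓝 0) := tendsto_iff_norm_sub_tendsto_zero.1 h
  refine tendsto_iff_norm_sub_tendsto_zero.2
    (squeeze_zero (fun n => norm_nonneg _) (fun n => ?_) h0)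
  exact lp.norm_apply_le_norm (by norm_num) (u n - x) i

/-- The bounded Jacobi operator `J` on `ℓ²({1, 2, 3, …})` with off-diagonal coefficients
`1, 2|c|, 1, 2|c|, …` and diagonal coefficients `ṽ_1, ṽ_2, …`. -/
def jacobi (v : ℝ) (q : ℕ →₀ ℝ) (c : ℝ) : HSpace →L[ℂ] HSpace :=
  ContinuousLinearMap.ofSeqClosedGraph (g := jacobiLin v q c) (by
    intro u x y hu hy
    ext i
    have h1 := tendsto_coord hy i
    refine tendsto_nhds_unique h1 ?_
    have hs : ∀ n, Tendsto (fun m => site (u m) n) atTop (𝓝 (site x n)) := by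
      intro n
      cases n with
      | zero => exact tendsto_const_nhds
      | succ n => exact tendsto_coord hu n
    exact (((hs i).const_mul _).add ((hs (i + 2)).const_mul _)).add ((hs (i + 1)).const_mul _))

theorem jacobi_apply (v : ℝ) (q : ℕ →₀ ℝ) (c : ℝ) (y : HSpace) (i : ℕ) :
    (jacobi v q c y : ℕ → ℂ) i = jacobiSeq v q c y i := rfl

/-- The bound states of `J`: its eigenvalues on `ℓ²`. -/
def boundStates (v : ℝ) (q : ℕ →₀ ℝ) (c : ℝ) : Set ℂ :=
  {z | Module.End.HasEigenvalue (jacobi v q c : HSpace →ₗ[ℂ] HSpace) z}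

/-- The matrix element `⟨(J - z)⁻¹ f, g⟩` of the resolvent (linear in `f`, antilinear in `g`). -/
def resolventElem (v : ℝ) (q : ℕ →₀ ℝ) (c : ℝ) (f g : HSpace) (z : ℂ) : ℂ :=
  inner ℂ g (Ring.inverse (jacobi v q c - z • (1 : HSpace →L[ℂ] HSpace)) f)

/-- Vectors of finite support, `ℓ²_comp`. -/
def FinSupp (f : HSpace) : Prop := {i | (f : ℕ → ℂ) i ≠ 0}.Finite

/-- The absolutely continuous spectrum of `J` (equal to that of the unperturbed operator, `q = 0`):
the two bands
`[-√(v²+(2|c|+1)²), -√(v²+(2|c|-1)²)] ∪ [√(v²+(2|c|-1)²), √(v²+(2|c|+1)²)]`. -/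
def bands (v c : ℝ) : Set ℂ :=
  {z | z.im = 0 ∧ √(v ^ 2 + (2 * |c| - 1) ^ 2) ≤ |z.re| ∧ |z.re| ≤ √(v ^ 2 + (2 * |c| + 1) ^ 2)}

/-- `x` is an interior point of one of the two bands. -/
def InsideBand (v c x : ℝ) : Prop :=
  √(v ^ 2 + (2 * |c| - 1) ^ 2) < |x| ∧ |x| < √(v ^ 2 + (2 * |c| + 1) ^ 2)

/-- The surface `Λ` consists of two copies `Λ₊`, `Λ₋` of the plane cut along the bands, joined
crosswise along the cuts. If `F` is a function on the first sheet `Λ₊`, this says that the function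
`G` on the second sheet `Λ₋` is its meromorphic continuation: crossing a band from the upper or from
the lower side, `F` on the one side continues analytically to `G` on the other side. -/
structure IsContinuation (v c : ℝ) (F G : ℂ → ℂ) : Prop where
  meromorphic : MeromorphicOn G (bands v c)ᶜ
  downward : ∀ x : ℝ, InsideBand v c x → ∃ h : ℂ → ℂ, AnalyticAt ℂ h x ∧
    ∀ᶠ z in 𝓝 (x : ℂ), (0 < z.im → h z = F z) ∧ (z.im < 0 → h z = G z)
  upward : ∀ x : ℝ, InsideBand v c x → ∃ h : ℂ → ℂ, AnalyticAt ℂ h x ∧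
    ∀ᶠ z in 𝓝 (x : ℂ), (z.im < 0 → h z = F z) ∧ (0 < z.im → h z = G z)

/-- The (projections to `ℂ` of the) resonances of `J`: the points of the second sheet `Λ₋` at which
the continuation of `⟨(J - z)⁻¹ f, g⟩` has a pole for some finitely supported `f`, `g`. -/
def resonances (v : ℝ) (q : ℕ →₀ ℝ) (c : ℝ) : Set ℂ :=
  {z | z ∉ bands v c ∧ ∃ f g : HSpace, FinSupp f ∧ FinSupp g ∧ ∃ G : ℂ → ℂ,
    IsContinuation v c (resolventElem v q c f g) G ∧ meromorphicOrderAt G z < 0}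

/-- The `n`-th block `𝒥_n` (`n ≥ 1`) of the decoupled matrix `J|_{c = 0} = ⊕ 𝒥_n`. -/
def block (v : ℝ) (q : ℕ →₀ ℝ) (n : ℕ) : Matrix (Fin 2) (Fin 2) ℝ :=
  !![pot v q (2 * n - 1), 1; 1, pot v q (2 * n)]

/-- `z_{n,+} = v_n⁺ + √((v_n⁻)² + 1)` with `v_n^± = (ṽ_{2n-1} ± ṽ_{2n}) / 2`. -/
def zPlus (v : ℝ) (q : ℕ →₀ ℝ) (n : ℕ) : ℝ :=
  (pot v q (2 * n - 1) + pot v q (2 * n)) / 2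
    + √(((pot v q (2 * n - 1) - pot v q (2 * n)) / 2) ^ 2 + 1)

/-- `z_{n,-} = v_n⁺ - √((v_n⁻)² + 1)` with `v_n^± = (ṽ_{2n-1} ± ṽ_{2n}) / 2`. -/
def zMinus (v : ℝ) (q : ℕ →₀ ℝ) (n : ℕ) : ℝ :=
  (pot v q (2 * n - 1) + pot v q (2 * n)) / 2
    - √(((pot v q (2 * n - 1) - pot v q (2 * n)) / 2) ^ 2 + 1)

/-- The numbers `z_{n,±}` are the eigenvalues of the block `𝒥_n`. -/
theorem spectrum_block (v : ℝ) (q : ℕ →₀ ℝ) (n : ℕ) :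
    spectrum ℝ (block v q n) = {zPlus v q n, zMinus v q n} := by
  ext x
  have hs := Real.sq_sqrt
    (by positivity : 0 ≤ ((pot v q (2 * n - 1) - pot v q (2 * n)) / 2) ^ 2 + 1)
  rw [spectrum.mem_iff, Matrix.isUnit_iff_isUnit_det, isUnit_iff_ne_zero, not_not,
    Set.mem_insert_iff, Set.mem_singleton_iff, ← sub_eq_zero (a := x), ← sub_eq_zero (a := x),
    ← mul_eq_zero]
  have hd : (algebraMap ℝ (Matrix (Fin 2) (Fin 2) ℝ) x - block v q n).det
      = (x - zPlus v q n) * (x - zMinus v q n) := by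
    simp only [block, zPlus, zMinus, Matrix.det_fin_two, Matrix.sub_apply,
      Matrix.algebraMap_matrix_apply]
    simp
    linear_combination hs
  rw [hd]

/-- The set `{z_{n,±} : 1 ≤ n ≤ m}`, as a set of (real) points of the complex plane. -/
def zSet (v : ℝ) (q : ℕ →₀ ℝ) (m : ℕ) : Set ℂ :=
  {z | ∃ n, 1 ≤ n ∧ n ≤ m ∧ (z = (zPlus v q n : ℂ) ∨ z = (zMinus v q n : ℂ))}

/-- Neither of `z_{n,+}`, `z_{n,-}` is one of the two flat bands `±√(v²+1)` of `J|_{c = 0}`. -/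
def OffFlatBands (v : ℝ) (q : ℕ →₀ ℝ) (n : ℕ) : Prop :=
  |zPlus v q n| ≠ √(v ^ 2 + 1) ∧ |zMinus v q n| ≠ √(v ^ 2 + 1)

/-- `v + q_{p-1}/2 + √(q_{p-1}²/4 - q_{p-1}/q_p)`, with the complex square root. -/
def muPlus (v : ℝ) (q : ℕ →₀ ℝ) (p : ℕ) : ℂ :=
  v + q (p - 1) / 2 + Complex.sqrt ((q (p - 1) : ℂ) ^ 2 / 4 - q (p - 1) / q p)

/-- `v + q_{p-1}/2 - √(q_{p-1}²/4 - q_{p-1}/q_p)`, with the complex square root. -/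
def muMinus (v : ℝ) (q : ℕ →₀ ℝ) (p : ℕ) : ℂ :=
  v + q (p - 1) / 2 - Complex.sqrt ((q (p - 1) : ℂ) ^ 2 / 4 - q (p - 1) / q p)

/-- The filter "`c_k(b) → 0+`" on the values `b` of the magnetic field. -/
def ckToZero (N : ℕ) (k : ℤ) : Filter ℝ := comap (ck N k) (𝓝[>] 0)

/-- Convergence of a family of subsets of `ℂ` to a set, in the Hausdorff distance. The distance
between a nonempty set and the empty set is `⊤`; so converging to `∅` means being eventually
empty. -/
def SetsTendsto (S : ℝ → Set ℂ) (l : Filter ℝ) (T : Set ℂ) : Prop :=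
  Tendsto (fun b => Metric.hausdorffEDist (S b) T) l (𝓝 0)

end

end HalfNanotube

/-!
Write `a = 2c` and `E = z² - v² - 1`. Beyond the support of `q` the coefficients are periodic, and a
solution of `J y = z y` satisfies there `y_{n+4} - w y_{n+2} + y_n = 0` with `w = (E - a²) / a`. A
solution that is multiplied by `ξ` over each cell exists exactly for the two roots of `ξ + ξ⁻¹ = w`;
off the bands one of them lies in the open unit disc, and exchanging the roots is the same as
changing the sheet. Hence `z` is a bound state iff the solution `φ` with the Dirichlet condition at
the left end is proportional, beyond the support, to the solution that belongs to the small root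
(`mem_boundStates_iff`). The resolvent on finitely supported vectors is an explicit rational
expression in the values of `φ` and in `ξ` (`green`), which is continued to the second sheet by
using the large root in place of the small one (`isContinuation_green`); its poles are exactly the
zeros of the analogous condition (`mem_resonances_iff_defect`), since the continuation is unique and
numerator and denominator have no common zeros.

The solution `φ` is given by polynomials `A_m`, `B_m` in `z` and `a²` (`chain`). In terms of `s = a
ξ` with the small root `ξ` both conditions read `h(z, a, s) = 0`, where `h` is a polynomial
(`boundFn`, `resFn`), `|s| < a`, and `s² - (E - a²) s + a² = 0` (`boundStates_eq_sheetSet`,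
`resonances_eq_sheetSet`). As `a → 0` also `s → 0`, and `h(z, 0, 0)` is the product of the
characteristic polynomials of the blocks, respectively of those of the blocks before the last one
that `q` touches and of a polynomial `κ`, which has the roots `μ⁰_{p-1}`, `μ⁰_p` for even `p` and is
a nonzero constant for odd `p`. The zeros stay bounded, so they accumulate only at the zeros of the
limit; conversely, off the flat bands `s` is a holomorphic function of `z` and a zero of the limit
attracts zeros (`tendsto_hausdorffEDist_sheetSet`).

There remains a zero `x₀` of the limit on a flat band. For bound states, and at the zeros of `κ`,
the assumption on the flat bands excludes it (`offFlatBands_iff`), but for the resonances `x₀` may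
be an eigenvalue of an earlier block. The two bands shrink to the flat bands, and one has to see
that the zeros of `h` near `x₀` are not all on the first sheet or on the band
(`eventually_exists_mem_sheetSet_flat`). The product of the values of `h` over the two sheets is a
polynomial in `z` and `a` and has zeros near `x₀`. A zero that is not a resonance is real, being an
eigenvalue or a band edge. Near `x₀` the real points of the surface are parametrized by `s = ± τ`
with `a² / η ≤ τ ≤ η`, where `τ ↦ a² / τ` exchanges the sheets, and at both ends of this interval
`h` has the same sign. Without a resonance, `h` would keep its sign on the part of the interval with
`τ < a`; at the outermost zero with `τ ≥ a` this contradicts the monotonicity of `A_m / B_m`, a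
discrete form of the Christoffel–Darboux inequality (`chain_hasDerivAt`,
`exists_zero_on_second_sheet`).
-/

namespace HalfNanotube

noncomputable section

/-! ### Zeros of holomorphic functions and the inverse of the Joukowski map -/

/-- A holomorphic function that is smaller at the centre of a disc than on its boundary has a zero
in the disc: otherwise its reciprocal violates the maximum principle. -/
theorem exists_zero_of_norm_lt_sphere {f : ℂ → ℂ} {t : ℂ} {r m : ℝ} (hr : 0 < r)
    (hf : DifferentiableOn ℂ f (Metric.closedBall t r))
    (hs : ∀ z ∈ Metric.sphere t r, m ≤ ‖f z‖) (ht : ‖f t‖ < m) :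
    ∃ z ∈ Metric.closedBall t r, f z = 0 := by
  by_contra! h
  have hm : 0 < m := (norm_nonneg _).trans_lt ht
  have hd : DiffContOnCl ℂ (fun z => (f z)⁻¹) (Metric.ball t r) := by
    apply DifferentiableOn.diffContOnCl
    rw [closure_ball _ hr.ne']
    exact hf.inv h
  have key := Complex.norm_le_of_forall_mem_frontier_norm_le (C := m⁻¹) Metric.isBounded_ball hd
    (fun z hz => by
      rw [frontier_ball _ hr.ne'] at hz
      rw [norm_inv]
      exact inv_anti₀ hm (hs z hz)) (subset_closure (Metric.mem_ball_self hr))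
  rw [norm_inv] at key
  have h0 : 0 < ‖f t‖ := norm_pos_iff.2 (h t (Metric.mem_closedBall_self hr.le))
  exact absurd ((inv_le_inv₀ h0 hm).1 key) (not_le.2 ht)

theorem sqrt_sq_eq (u : ℂ) : Complex.sqrt u ^ 2 = u := by
  simp [Complex.sqrt]

theorem re_sqrt_pos {u : ℂ} (hu : u ∈ Complex.slitPlane) : 0 < (Complex.sqrt u).re := by
  rw [Complex.sqrt, Complex.cpow_inv_two_re]
  apply Real.sqrt_pos.2
  rcases Complex.mem_slitPlane_iff.1 hu with h | h
  · have := norm_nonneg u; linarith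
  · have := Complex.abs_re_lt_norm.2 h
    have := neg_abs_le u.re
    linarith

/-- The segment `[-2, 2]`, the image of the unit circle under `ξ ↦ ξ + ξ⁻¹`. -/
def OnSegment (w : ℂ) : Prop := w.im = 0 ∧ |w.re| ≤ 2

/-- The root of `ξ + ξ⁻¹ = w` in the open unit disc, for `w` off the segment `[-2, 2]`. The branch
cut of the square root corresponds to the segment, so that the root is holomorphic off it. -/
def discRoot (w : ℂ) : ℂ := w / 2 * (1 - Complex.sqrt (1 - 4 / w ^ 2))

theorem ne_zero_of_not_onSegment {w : ℂ} (hw : ¬ OnSegment w) : w ≠ 0 := by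
  rintro rfl; exact hw (by simp [OnSegment])

theorem mem_slitPlane_of_not_onSegment {w : ℂ} (hw : ¬ OnSegment w) :
    1 - 4 / w ^ 2 ∈ Complex.slitPlane := by
  have h0 := ne_zero_of_not_onSegment hw
  by_contra h
  rw [Complex.mem_slitPlane_iff, not_or, not_lt, not_not] at h
  obtain ⟨h1, h2⟩ := h
  set u := 1 - 4 / w ^ 2 with hu
  have e : (1 - u) * w ^ 2 = 4 := by rw [hu]; field_simp; ring
  have er := congrArg Complex.re e
  have ei := congrArg Complex.im e
  simp [pow_two, h2] at er ei
  apply hw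
  rcases ei with ei | ei
  · exact absurd ei (by linarith)
  have ei' : w.re * w.im = 0 := by linarith
  rcases mul_eq_zero.1 ei' with h | h
  · rw [h] at er; nlinarith [mul_self_nonneg w.im]
  · refine ⟨h, ?_⟩
    rw [h] at er
    apply abs_le_of_sq_le_sq _ (by norm_num)
    nlinarith [mul_self_nonneg w.re]

theorem differentiableAt_discRoot {w : ℂ} (hw : ¬ OnSegment w) :
    DifferentiableAt ℂ discRoot w := by
  have h0 : w ^ 2 ≠ 0 := pow_ne_zero 2 (ne_zero_of_not_onSegment hw)
  have h1 : DifferentiableAt ℂ (fun w : ℂ => 1 - 4 / w ^ 2) w := by fun_prop (disch := assumption)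
  have h2 : DifferentiableAt ℂ (fun w : ℂ => Complex.sqrt (1 - 4 / w ^ 2)) w :=
    DifferentiableAt.comp w
      (Complex.differentiableAt_sqrt (mem_slitPlane_of_not_onSegment hw)) h1
  unfold discRoot
  fun_prop

theorem discRoot_spec {w : ℂ} (hw : ¬ OnSegment w) :
    ‖discRoot w‖ < 1 ∧ discRoot w ≠ 0 ∧ discRoot w + (discRoot w)⁻¹ = w := by
  have h0 := ne_zero_of_not_onSegment hw
  set s := Complex.sqrt (1 - 4 / w ^ 2) with hs
  have hsq : s ^ 2 = 1 - 4 / w ^ 2 := sqrt_sq_eq _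
  have hre : 0 < s.re := re_sqrt_pos (mem_slitPlane_of_not_onSegment hw)
  have hx : discRoot w = w / 2 * (1 - s) := rfl
  have hp : discRoot w * (w / 2 * (1 + s)) = 1 := by
    rw [hx]
    have : w ^ 2 * s ^ 2 = w ^ 2 - 4 := by rw [hsq]; field_simp
    linear_combination (-1 / 4) * this
  have hne : discRoot w ≠ 0 := left_ne_zero_of_mul_eq_one hp
  have hinv : (discRoot w)⁻¹ = w / 2 * (1 + s) := inv_eq_of_mul_eq_one_right hp
  refine ⟨?_, hne, by rw [hinv, hx]; ring⟩
  have hlt : ‖discRoot w‖ < ‖(discRoot w)⁻¹‖ := by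
    rw [hinv, hx, norm_mul, norm_mul]
    refine mul_lt_mul_of_pos_left ?_ (norm_pos_iff.2 (by simpa using h0))
    rw [← sq_lt_sq₀ (norm_nonneg _) (norm_nonneg _), ← Complex.normSq_eq_norm_sq,
      ← Complex.normSq_eq_norm_sq, Complex.normSq_apply, Complex.normSq_apply]
    simp
    nlinarith
  rw [norm_inv] at hlt
  have hpos := norm_pos_iff.2 hne
  by_contra hge
  have := inv_le_one_of_one_le₀ (not_lt.1 hge)
  linarith

theorem not_onSegment_of_norm_lt_one {w ξ : ℂ} (h1 : ‖ξ‖ < 1) (h : ξ ^ 2 - w * ξ + 1 = 0) :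
    ¬ OnSegment w := by
  rintro ⟨hi, hr⟩
  have hn : ξ.re * ξ.re + ξ.im * ξ.im < 1 := by
    rw [← Complex.normSq_apply, Complex.normSq_eq_norm_sq]
    exact pow_lt_one₀ (norm_nonneg _) h1 two_ne_zero
  have er := congrArg Complex.re h
  have ei := congrArg Complex.im h
  simp [pow_two, hi] at er ei
  have : ξ.im * (2 * ξ.re - w.re) = 0 := by linarith
  rcases mul_eq_zero.1 this with h | h
  · rw [h] at er hn
    have h3 := abs_le.1 hr
    have h4 : ξ.re < 1 := by nlinarith
    have h5 : -1 < ξ.re := by nlinarith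
    rcases le_total 0 ξ.re with h6 | h6
    · nlinarith [mul_nonneg h6 (sub_nonneg.2 h3.2), mul_pos (sub_pos.2 h4) (sub_pos.2 h4)]
    · have h7 : 0 < ξ.re + 1 := by linarith
      nlinarith [mul_nonneg (neg_nonneg.2 h6) (sub_nonneg.2 h3.1), mul_pos h7 h7]
  · have : w.re = 2 * ξ.re := by linarith
    rw [this] at er; nlinarith

theorem eq_of_norm_lt_one {w ξ ξ' : ℂ} (h1 : ‖ξ‖ < 1) (h1' : ‖ξ'‖ < 1)
    (h : ξ ^ 2 - w * ξ + 1 = 0) (h' : ξ' ^ 2 - w * ξ' + 1 = 0) : ξ = ξ' := by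
  have hprod : ‖ξ * ξ'‖ < 1 := by
    rw [norm_mul]; nlinarith [norm_nonneg ξ, norm_nonneg ξ']
  have e : (ξ - ξ') * (ξ * ξ' - 1) = 0 := by linear_combination ξ' * h - ξ * h'
  rcases mul_eq_zero.1 e with h | h
  · exact sub_eq_zero.1 h
  · rw [sub_eq_zero.1 h] at hprod; simp at hprod

theorem eq_discRoot {w ξ : ℂ} (h1 : ‖ξ‖ < 1) (h : ξ ^ 2 - w * ξ + 1 = 0) : ξ = discRoot w := by
  obtain ⟨a, b, c⟩ := discRoot_spec (not_onSegment_of_norm_lt_one h1 h)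
  refine eq_of_norm_lt_one h1 a h ?_
  have : discRoot w * (discRoot w)⁻¹ = 1 := mul_inv_cancel₀ b
  linear_combination discRoot w * c - this

/-- A holomorphic solution of `ξ + ξ⁻¹ = w` near the open segment `(-2, 2)`. On the segment it is
the point of the unit circle above (for `τ = 1`) or below (for `τ = -1`) the real axis. -/
def arcRoot (τ : ℝ) (w : ℂ) : ℂ := w / 2 + τ * Complex.I * Complex.sqrt (1 - w ^ 2 / 4)

theorem arcRoot_eq (τ : ℝ) (hτ : τ ^ 2 = 1) (w : ℂ) :
    arcRoot τ w ^ 2 - w * arcRoot τ w + 1 = 0 := by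
  have h := sqrt_sq_eq (1 - w ^ 2 / 4)
  have hτ' : (τ : ℂ) ^ 2 = 1 := by exact_mod_cast hτ
  unfold arcRoot
  linear_combination (τ ^ 2 * Complex.I ^ 2 : ℂ) * h + (τ ^ 2 : ℂ) * (1 - w ^ 2 / 4) * Complex.I_sq
    - (1 - w ^ 2 / 4) * hτ'

theorem slitPlane_of_abs_lt_two {w : ℝ} (hw : |w| < 2) :
    1 - (w : ℂ) ^ 2 / 4 ∈ Complex.slitPlane := by
  left
  have : w ^ 2 < 4 := by nlinarith [abs_lt.1 hw, sq_abs w, abs_nonneg w]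
  have e : (1 - (w : ℂ) ^ 2 / 4) = ((1 - w ^ 2 / 4 : ℝ) : ℂ) := by push_cast; ring
  rw [e, Complex.ofReal_re]; linarith

theorem analyticAt_arcRoot (τ : ℝ) {w : ℝ} (hw : |w| < 2) : AnalyticAt ℂ (arcRoot τ) w := by
  have h1 : AnalyticAt ℂ Complex.sqrt (1 - (w : ℂ) ^ 2 / 4) := by
    refine DifferentiableOn.analyticAt (s := Complex.slitPlane)
      (fun z hz => (Complex.differentiableAt_sqrt hz).differentiableWithinAt) ?_
    exact Complex.isOpen_slitPlane.mem_nhds (slitPlane_of_abs_lt_two hw)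
  have h2 : AnalyticAt ℂ (fun w : ℂ => 1 - w ^ 2 / 4) w := by fun_prop
  have h3 : AnalyticAt ℂ (fun w : ℂ => Complex.sqrt (1 - w ^ 2 / 4)) w :=
    AnalyticAt.comp (g := Complex.sqrt) (f := fun w : ℂ => 1 - w ^ 2 / 4) h1 h2
  unfold arcRoot
  fun_prop

theorem im_arcRoot_pos (τ : ℝ) (hτ : τ ^ 2 = 1) {w : ℝ} (hw : |w| < 2) :
    0 < τ * (arcRoot τ w).im := by
  have h := re_sqrt_pos (slitPlane_of_abs_lt_two hw)
  have : (arcRoot τ w).im = τ * (Complex.sqrt (1 - (w : ℂ) ^ 2 / 4)).re := by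
    simp [arcRoot]
  rw [this, ← mul_assoc, ← pow_two, hτ, one_mul]; exact h

/-- `Im (ξ + ξ⁻¹)` has the sign of `Im ξ` or the opposite one, as `ξ` lies outside or inside the
unit circle. -/
theorem im_joukowski {w ξ : ℂ} (h : ξ ^ 2 - w * ξ + 1 = 0) :
    w.im * ‖ξ‖ ^ 2 = ξ.im * (‖ξ‖ ^ 2 - 1) := by
  have er := congrArg Complex.re h
  have ei := congrArg Complex.im h
  simp [pow_two] at er ei
  rw [← Complex.normSq_eq_norm_sq, Complex.normSq_apply]
  linear_combination ξ.im * er - ξ.re * ei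

/-- Two meromorphic continuations of the same function agree up to isolated points: they agree
below an interior point of a band, and the second sheet is connected. -/
theorem meromorphicOrderAt_eq_of_isContinuation {v c x : ℝ} {F G₁ G₂ : ℂ → ℂ}
    (hpc : IsPreconnected (bands v c)ᶜ) (hx : InsideBand v c x)
    (h₁ : IsContinuation v c F G₁) (h₂ : IsContinuation v c F G₂) {z : ℂ} (hz : z ∉ bands v c) :
    meromorphicOrderAt G₁ z = meromorphicOrderAt G₂ z := by
  obtain ⟨k₁, a₁, e₁⟩ := h₁.downward x hx
  obtain ⟨k₂, a₂, e₂⟩ := h₂.downward x hx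
  have hup : ∃ᶠ z in 𝓝[≠] (x : ℂ), k₁ z = k₂ z := by
    have hu : ∃ᶠ z in 𝓝[≠] (x : ℂ), 0 < z.im := by
      have ht : Tendsto (fun y : ℝ => (x : ℂ) + y * Complex.I) (𝓝[>] 0) (𝓝[≠] (x : ℂ)) := by
        refine tendsto_nhdsWithin_iff.2 ⟨?_, ?_⟩
        · have : Continuous (fun y : ℝ => (x : ℂ) + y * Complex.I) := by fun_prop
          have h := this.tendsto 0
          simp only [Complex.ofReal_zero, zero_mul, add_zero] at h
          exact h.mono_left nhdsWithin_le_nhds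
        · filter_upwards [self_mem_nhdsWithin] with y hy
          simpa using (ne_of_gt hy : y ≠ 0)
      refine ht.frequently (Eventually.frequently ?_)
      filter_upwards [self_mem_nhdsWithin] with y hy
      simpa using hy
    refine (hu.and_eventually ((e₁.and e₂).filter_mono nhdsWithin_le_nhds)).mono ?_
    rintro z ⟨hz, ⟨p, -⟩, ⟨r, -⟩⟩
    rw [p hz, r hz]
  have hk := (a₁.frequently_eq_iff_eventually_eq a₂).1 hup
  have hG : ∀ᶠ z in 𝓝 (x : ℂ), z.im < 0 → G₁ z = G₂ z := by
    filter_upwards [hk, e₁, e₂] with z hz p r hzi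
    rw [← p.2 hzi, ← r.2 hzi, hz]
  obtain ⟨ε, hε, hb⟩ := Metric.eventually_nhds_iff_ball.1 hG
  set z₀ : ℂ := x - (ε / 2 : ℝ) * Complex.I with hz₀
  have hz₀b : z₀ ∈ Metric.ball (x : ℂ) ε := by
    have : |ε| < 2 * ε := by rw [abs_of_pos hε]; linarith
    simpa [hz₀, dist_eq_norm, div_lt_iff₀, mul_comm] using this
  have hz₀i : z₀.im < 0 := by simp [hz₀, hε]
  have hz₀n : z₀ ∉ bands v c := fun h => hz₀i.ne h.1
  have hloc : G₁ =ᶠ[𝓝 z₀] G₂ := by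
    filter_upwards [Metric.isOpen_ball.mem_nhds hz₀b,
      (isOpen_Iio.preimage Complex.continuous_im).mem_nhds hz₀i] with z p r
    exact hb z p r
  have hm : MeromorphicOn (G₁ - G₂) (bands v c)ᶜ := h₁.meromorphic.sub h₂.meromorphic
  have htop₀ : meromorphicOrderAt (G₁ - G₂) z₀ = ⊤ := by
    rw [meromorphicOrderAt_eq_top_iff]
    refine Eventually.filter_mono nhdsWithin_le_nhds ?_
    filter_upwards [hloc] with z hz
    simp [hz]
  have htop : meromorphicOrderAt (G₁ - G₂) z = ⊤ := by
    by_contra hne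
    exact hm.meromorphicOrderAt_ne_top_of_isPreconnected hpc hz hz₀n hne htop₀
  apply meromorphicOrderAt_congr
  filter_upwards [meromorphicOrderAt_eq_top_iff.1 htop] with y hy
  exact sub_eq_zero.1 hy

/-! ### The Jacobi operator is self-adjoint -/

theorem tendsto_apply_zero (y : HSpace) : Tendsto (fun i => (y : ℕ → ℂ) i) atTop (𝓝 0) := by
  have h2 : (0 : ℝ) < (2 : ℝ≥0∞).toReal := by norm_num
  have hs := ((memℓp_gen_iff h2).1 (lp.memℓp y)).tendsto_atTop_zero
  have h := hs.rpow_const (p := 1 / 2) (Or.inr (by norm_num))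
  rw [Real.zero_rpow (by norm_num)] at h
  refine tendsto_zero_iff_norm_tendsto_zero.2 (h.congr fun i => ?_)
  rw [← Real.rpow_mul (norm_nonneg _)]
  norm_num

theorem tendsto_site_zero (y : HSpace) : Tendsto (site y) atTop (𝓝 0) :=
  (tendsto_add_atTop_iff_nat 1).1 (tendsto_apply_zero y)

theorem isSymmetric_jacobi (v : ℝ) (q : ℕ →₀ ℝ) (c : ℝ) :
    (jacobi v q c : HSpace →ₗ[ℂ] HSpace).IsSymmetric := by
  intro x y
  change inner ℂ (jacobi v q c x) y = inner ℂ x (jacobi v q c y)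
  set t : ℕ → ℂ := fun i => hop c i *
    (starRingEnd ℂ (site x i) * site y (i + 1) - starRingEnd ℂ (site x (i + 1)) * site y i) with ht
  have hs : HasSum (fun i => inner ℂ ((jacobi v q c x : ℕ → ℂ) i) ((y : ℕ → ℂ) i)
      - inner ℂ ((x : ℕ → ℂ) i) ((jacobi v q c y : ℕ → ℂ) i))
      (inner ℂ (jacobi v q c x) y - inner ℂ x (jacobi v q c y)) := by
    have h1 := lp.hasSum_inner (𝕜 := ℂ) (G := fun _ : ℕ => ℂ) (jacobi v q c x) y
    have h2 := lp.hasSum_inner (𝕜 := ℂ) (G := fun _ : ℕ => ℂ) x (jacobi v q c y)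
    exact h1.sub h2
  -- the summands telescope
  have htel : ∀ i, inner ℂ ((jacobi v q c x : ℕ → ℂ) i) ((y : ℕ → ℂ) i)
      - inner ℂ ((x : ℕ → ℂ) i) ((jacobi v q c y : ℕ → ℂ) i) = t i - t (i + 1) := by
    intro i
    rw [jacobi_apply, jacobi_apply]
    simp only [jacobiSeq, ht, RCLike.inner_apply, map_add, map_mul, Complex.conj_ofReal, site]
    ring
  have hsum := hs.tendsto_sum_nat
  simp only [htel, Finset.sum_range_sub'] at hsum
  have t0 : t 0 = 0 := by simp [ht, site]
  have hprod : ∀ u w : HSpace, Tendsto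
      (fun i => (hop c i : ℂ) * (starRingEnd ℂ (site u i) * site w (i + 1))) atTop (𝓝 0) ∧
      Tendsto (fun i => (hop c i : ℂ) * (starRingEnd ℂ (site u (i + 1)) * site w i))
        atTop (𝓝 0) := by
    intro u w
    have hu := tendsto_site_zero u
    have hw := tendsto_site_zero w
    have hu' := (tendsto_add_atTop_iff_nat 1).2 hu
    have hw' := (tendsto_add_atTop_iff_nat 1).2 hw
    have hbd : ∀ p : ℕ → ℂ, Tendsto p atTop (𝓝 0) →
        Tendsto (fun i => (hop c i : ℂ) * p i) atTop (𝓝 0) := by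
      intro p hp
      refine squeeze_zero_norm (fun i => ?_) (by
        simpa using (tendsto_norm_zero.comp hp).const_mul (2 * |c| + 1))
      rw [norm_mul]
      exact mul_le_mul_of_nonneg_right (norm_hop_le c i) (norm_nonneg _)
    constructor
    · apply hbd
      simpa using ((Complex.continuous_conj.tendsto 0).comp hu).mul hw'
    · apply hbd
      simpa using ((Complex.continuous_conj.tendsto 0).comp hu').mul hw
  have hlim : Tendsto t atTop (𝓝 0) := by
    have := (hprod x y).1.sub (hprod x y).2
    simpa [ht, mul_sub] using this
  have := tendsto_nhds_unique hsum (hlim.const_sub (t 0))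
  rw [t0, sub_zero] at this
  exact sub_eq_zero.1 this

theorem im_eq_zero_of_mem_boundStates {v : ℝ} {q : ℕ →₀ ℝ} {c : ℝ} {z : ℂ}
    (hz : z ∈ boundStates v q c) : z.im = 0 :=
  Complex.conj_eq_iff_im.1 ((isSymmetric_jacobi v q c).conj_eigenvalue_eq_self hz)

theorem isUnit_jacobi_sub {v : ℝ} {q : ℕ →₀ ℝ} {c : ℝ} {z : ℂ} (hz : z.im ≠ 0) :
    IsUnit (jacobi v q c - z • (1 : HSpace →L[ℂ] HSpace)) := by
  have hsa : IsSelfAdjoint (jacobi v q c) :=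
    ContinuousLinearMap.isSelfAdjoint_iff_isSymmetric.2 (isSymmetric_jacobi v q c)
  have h : z ∉ spectrum ℂ (jacobi v q c) := fun h => hz (hsa.im_eq_zero_of_mem_spectrum h)
  rw [spectrum.notMem_iff, Algebra.algebraMap_eq_smul_one] at h
  simpa using h.neg

/-! ### Solutions of the Jacobi equation -/

/-- `Y` solves the inhomogeneous Jacobi equation `(J - z) Y = f` at every site. The value `f n`
belongs to the site `n + 1`. -/
def Solves (v : ℝ) (q : ℕ →₀ ℝ) (c : ℝ) (z : ℂ) (f Y : ℕ → ℂ) : Prop :=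
  ∀ n, hop c n * Y n + hop c (n + 1) * Y (n + 2) + pot v q (n + 1) * Y (n + 1)
    = z * Y (n + 1) + f n

/-- The solution of `(J - z) Y = f` with `Y 0 = 0` and `Y 1 = κ`. -/
def sol (v : ℝ) (q : ℕ →₀ ℝ) (c : ℝ) (z κ : ℂ) (f : ℕ → ℂ) : ℕ → ℂ
  | 0 => 0
  | 1 => κ
  | n + 2 => (f n + (z - pot v q (n + 1)) * sol v q c z κ f (n + 1)
      - hop c n * sol v q c z κ f n) / hop c (n + 1)

theorem hop_even (c : ℝ) (m : ℕ) : hop c (2 * m) = 2 * |c| := by simp [hop]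

theorem hop_odd (c : ℝ) (m : ℕ) : hop c (2 * m + 1) = 1 := by simp [hop]

theorem hop_ne_zero {c : ℝ} (hc : 0 < c) (n : ℕ) : (hop c n : ℂ) ≠ 0 := by
  rw [Complex.ofReal_ne_zero, hop]; split_ifs
  · positivity
  · exact one_ne_zero

theorem solves_sol {v : ℝ} {q : ℕ →₀ ℝ} {c : ℝ} (hc : 0 < c) (z κ : ℂ) (f : ℕ → ℂ) :
    Solves v q c z f (sol v q c z κ f) := by
  intro n
  have := hop_ne_zero hc (n + 1)
  simp only [sol]
  field_simp
  ring

theorem Solves.eq_sol {v : ℝ} {q : ℕ →₀ ℝ} {c : ℝ} (hc : 0 < c) {z : ℂ} {f Y : ℕ → ℂ}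
    (h : Solves v q c z f Y) (h0 : Y 0 = 0) (n : ℕ) : Y n = sol v q c z (Y 1) f n := by
  induction n using Nat.strong_induction_on with
  | _ n ih =>
    match n with
    | 0 => simpa [sol] using h0
    | 1 => simp [sol]
    | n + 2 =>
      have := hop_ne_zero hc (n + 1)
      rw [sol, ← ih (n + 1) (by omega), ← ih n (by omega), eq_div_iff this]
      linear_combination h n

theorem Solves.add_mul {v : ℝ} {q : ℕ →₀ ℝ} {c : ℝ} {z : ℂ} {f X Y : ℕ → ℂ}
    (hX : Solves v q c z f X) (hY : Solves v q c z 0 Y) (κ : ℂ) :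
    Solves v q c z f (fun n => X n + κ * Y n) := by
  intro n
  have h2 := hY n
  simp only [Pi.zero_apply, add_zero] at h2
  linear_combination hX n + κ * h2

theorem sol_mul {v : ℝ} {q : ℕ →₀ ℝ} {c : ℝ} (hc : 0 < c) (z κ : ℂ) (n : ℕ) :
    sol v q c z κ 0 n = κ * sol v q c z 1 0 n := by
  have h := Solves.eq_sol hc
    (Solves.add_mul (f := 0) (X := fun _ => 0) (by intro n; simp)
      (solves_sol (q := q) (v := v) hc z 1 0) κ)
    (by simp [sol]) n
  simp only [zero_add] at h
  rw [h]; simp [sol]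

theorem solves_site_iff {v : ℝ} {q : ℕ →₀ ℝ} {c : ℝ} {z : ℂ} {f y : ℕ → ℂ} :
    Solves v q c z f (site y) ↔ ∀ i, jacobiSeq v q c y i = z * y i + f i := by
  simp only [Solves, jacobiSeq, site]

theorem differentiable_sol {v : ℝ} {q : ℕ →₀ ℝ} {c : ℝ} (κ : ℂ) (f : ℕ → ℂ) (n : ℕ) :
    Differentiable ℂ (fun z => sol v q c z κ f n) := by
  induction n using Nat.strong_induction_on with
  | _ n ih =>
    match n with
    | 0 => simp [sol]
    | 1 => simp [sol]
    | n + 2 =>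
      have h1 := ih (n + 1) (by omega)
      have h2 := ih n (by omega)
      simp only [sol]
      fun_prop

/-- The pair `(A_m, B_m)` of polynomials in `z` and `b = a²` that carries the Dirichlet solution `φ`
through the `m`-th cell: `φ_{2m+1} = A_m / a^m` and `φ_{2m+2} = B_{m+1} / a^m`. -/
def chain {R : Type*} [CommRing R] (V : ℕ → R) (b z : R) : ℕ → R × R
  | 0 => (1, 0)
  | m + 1 =>
    ((z - V (2 * m + 2)) * ((z - V (2 * m + 1)) * (chain V b z m).1 - b * (chain V b z m).2)
      - (chain V b z m).1,
      (z - V (2 * m + 1)) * (chain V b z m).1 - b * (chain V b z m).2)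

theorem chain_succ_fst {R : Type*} [CommRing R] (V : ℕ → R) (b z : R) (m : ℕ) :
    (chain V b z (m + 1)).1 = (z - V (2 * m + 2)) * (chain V b z (m + 1)).2 - (chain V b z m).1 :=
  rfl

theorem chain_succ_snd {R : Type*} [CommRing R] (V : ℕ → R) (b z : R) (m : ℕ) :
    (chain V b z (m + 1)).2 = (z - V (2 * m + 1)) * (chain V b z m).1 - b * (chain V b z m).2 :=
  rfl

theorem chain_ne_zero {R : Type*} [CommRing R] [IsDomain R] (V : ℕ → R) {b : R} (hb : b ≠ 0)
    (z : R) (m : ℕ) : ¬ ((chain V b z m).1 = 0 ∧ (chain V b z m).2 = 0) := by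
  induction m with
  | zero => simp [chain]
  | succ m ih =>
    rintro ⟨h1, h2⟩
    have hA : (chain V b z m).1 = 0 := by
      rw [chain_succ_fst, h2] at h1; simpa using h1
    rw [chain_succ_snd, hA] at h2
    exact ih ⟨hA, by simpa [hb] using h2⟩

theorem chain_ofReal (V : ℕ → ℝ) (b x : ℝ) (m : ℕ) :
    chain (fun n => (V n : ℂ)) b x m = (((chain V b x m).1 : ℂ), ((chain V b x m).2 : ℂ)) := by
  induction m with
  | zero => simp [chain]
  | succ m ih => simp [chain, ih]

/-- The potential with complex values, as used in the coefficients of the polynomials `chain`. -/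
abbrev cpot (v : ℝ) (q : ℕ →₀ ℝ) (n : ℕ) : ℂ := (pot v q n : ℂ)

theorem sol_eq_chain {v : ℝ} {q : ℕ →₀ ℝ} {c : ℝ} (hc : 0 < c) (z : ℂ) (m : ℕ) :
    sol v q c z 1 0 (2 * m + 1) = (chain (cpot v q) ((2 * c : ℝ) ^ 2 : ℂ) z m).1 / (2 * c : ℝ) ^ m ∧
    sol v q c z 1 0 (2 * m + 2)
      = (chain (cpot v q) ((2 * c : ℝ) ^ 2 : ℂ) z (m + 1)).2 / (2 * c : ℝ) ^ m := by
  have ha : ((2 * c : ℝ) : ℂ) ≠ 0 := by rw [Complex.ofReal_ne_zero]; positivity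
  have he : ∀ m, (hop c (2 * m) : ℂ) = (2 * c : ℝ) := fun m => by rw [hop_even, abs_of_pos hc]
  have ho : ∀ m, (hop c (2 * m + 1) : ℂ) = 1 := fun m => by rw [hop_odd]; simp
  generalize ((2 * c : ℝ) : ℂ) = a at *
  induction m with
  | zero =>
    refine ⟨by simp [sol, chain], ?_⟩
    have := ho 0
    simp only [mul_zero, zero_add] at this
    simp [sol, chain, this]
  | succ m ih =>
    have h3 : sol v q c z 1 0 (2 * (m + 1) + 1) = (chain (cpot v q) (a ^ 2) z (m + 1)).1
        / a ^ (m + 1) := by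
      rw [show 2 * (m + 1) + 1 = (2 * m + 1) + 2 by ring, sol, ih.1,
        show 2 * m + 1 + 1 = 2 * m + 2 by ring, ih.2, show 2 * m + 2 = 2 * (m + 1) by ring, he,
        ho, chain_succ_fst, cpot, show 2 * m + 2 = 2 * (m + 1) by ring]
      simp only [Pi.zero_apply]
      field_simp
      ring
    refine ⟨h3, ?_⟩
    rw [sol, h3, show sol v q c z 1 0 (2 * (m + 1)) = _ from ih.2, he, ho,
      chain_succ_snd _ _ _ (m + 1), cpot]
    simp only [Pi.zero_apply]
    field_simp
    ring

/-! ### Floquet theory beyond the support of the perturbation -/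

/-- The trace of the monodromy matrix of the periodic background, where `a` is the hopping between
cells. A Floquet multiplier `ξ` satisfies `ξ + ξ⁻¹ = floquet v a z`. -/
def floquet (v a : ℝ) (z : ℂ) : ℂ := (z ^ 2 - v ^ 2 - 1 - a ^ 2) / a

theorem floquet_root_iff {v a : ℝ} (ha : a ≠ 0) {z ξ : ℂ} :
    ξ ^ 2 - floquet v a z * ξ + 1 = 0 ↔
      (a : ℂ) * ξ ^ 2 - (z ^ 2 - v ^ 2 - 1 - a ^ 2) * ξ + a = 0 := by
  have ha' : (a : ℂ) ≠ 0 := by exact_mod_cast ha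
  rw [floquet, ← mul_right_inj' ha', mul_zero]
  have : (a : ℂ) * (ξ ^ 2 - (z ^ 2 - v ^ 2 - 1 - a ^ 2) / a * ξ + 1)
      = a * ξ ^ 2 - (z ^ 2 - v ^ 2 - 1 - a ^ 2) * ξ + a := by field_simp
  rw [this]

theorem hop_even' {c : ℝ} (hc : 0 < c) (m : ℕ) : (hop c (2 * m) : ℂ) = (2 * c : ℝ) := by
  rw [hop_even, abs_of_pos hc]

theorem hop_odd' (c : ℝ) (m : ℕ) : (hop c (2 * m + 1) : ℂ) = 1 := by
  rw [hop_odd]; simp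

theorem hop_add_two (c : ℝ) (n : ℕ) : hop c (n + 2) = hop c n := by
  have : Even (n + 2) ↔ Even n := by grind
  simp [hop, this]

theorem hop_mul {c : ℝ} (hc : 0 < c) (n : ℕ) :
    (hop c n : ℂ) * hop c (n + 1) = (2 * c : ℝ) := by
  rcases Nat.even_or_odd' n with ⟨m, rfl | rfl⟩
  · rw [hop_even' hc, hop_odd', mul_one]
  · rw [show 2 * m + 1 + 1 = 2 * (m + 1) by ring, hop_even' hc, hop_odd', one_mul]

theorem hop_sq_add {c : ℝ} (hc : 0 < c) (n : ℕ) :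
    (hop c n : ℂ) ^ 2 + hop c (n + 1) ^ 2 = 1 + (2 * c : ℝ) ^ 2 := by
  rcases Nat.even_or_odd' n with ⟨m, rfl | rfl⟩
  · rw [hop_even' hc, hop_odd']; ring
  · rw [show 2 * m + 1 + 1 = 2 * (m + 1) by ring, hop_even' hc, hop_odd']; ring

theorem pot_of_eq_zero (v : ℝ) {q : ℕ →₀ ℝ} {n : ℕ} (h : q n = 0) :
    pot v q n = if Even n then -v else v := by simp [pot, h]

section Tail

variable {v : ℝ} {q : ℕ →₀ ℝ} {c : ℝ} {z ξ : ℂ} {f Y : ℕ → ℂ} {L : ℕ}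

theorem Solves.floquet_recurrence (hc : 0 < c) (hq : ∀ n, 2 * L < n → q n = 0)
    (hf : ∀ n, 2 * L ≤ n → f n = 0) (h : Solves v q c z f Y) {n : ℕ} (hn : 2 * L ≤ n) :
    Y (n + 4) + Y n = floquet v (2 * c) z * Y (n + 2) := by
  have ha : ((2 * c : ℝ) : ℂ) ≠ 0 := by rw [Complex.ofReal_ne_zero]; positivity
  have e1 := h n
  have e2 := h (n + 1)
  have e3 := h (n + 2)
  rw [hf n hn] at e1
  rw [hf _ (by omega)] at e2 e3
  rw [show n + 2 + 1 = n + 1 + 2 by ring, hop_add_two] at e3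
  rw [show n + 1 + 1 = n + 2 by ring, hop_add_two] at e2
  rw [hop_add_two] at e3
  have p3 : pot v q (n + 1 + 2) = pot v q (n + 1) := by
    rw [pot_of_eq_zero v (hq _ (by omega)), pot_of_eq_zero v (hq _ (by omega))]
    have : Even (n + 1 + 2) ↔ Even (n + 1) := by grind
    simp [this]
  have p12 : ((pot v q (n + 1) : ℂ) - z) * (pot v q (n + 2) - z) = z ^ 2 - v ^ 2 := by
    rw [pot_of_eq_zero v (hq _ (by omega)), pot_of_eq_zero v (hq _ (by omega))]
    have : Even (n + 2) ↔ ¬ Even (n + 1) := by grind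
    by_cases h : Even (n + 1) <;> simp [this, h] <;> ring
  rw [p3] at e3
  have hm := hop_mul hc n
  have hs := hop_sq_add hc n
  rw [show n + 2 + 2 = n + 4 by ring, show n + 1 + 2 = n + 3 by ring] at *
  rw [floquet, div_mul_eq_mul_div, eq_div_iff ha]
  linear_combination (hop c (n + 1) : ℂ) * e1 + (hop c n : ℂ) * e3
    - ((pot v q (n + 1) : ℂ) - z) * e2 - (Y n + Y (n + 4)) * hm - Y (n + 2) * hs + Y (n + 2) * p12

/-- A solution that is multiplied by `ξ` over one cell is multiplied by `ξ` over every later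
cell. -/
theorem Solves.tail (hc : 0 < c) (hq : ∀ n, 2 * L < n → q n = 0)
    (hf : ∀ n, 2 * L ≤ n → f n = 0) (h : Solves v q c z f Y)
    (h0 : Y (2 * L + 2) = ξ * Y (2 * L)) (h1 : Y (2 * L + 3) = ξ * Y (2 * L + 1)) (k : ℕ) :
    Y (2 * L + k + 2) = ξ * Y (2 * L + k) := by
  induction k using Nat.strong_induction_on with
  | _ k ih =>
    match k with
    | 0 => exact h0
    | 1 => exact h1
    | k + 2 =>
      have i0 := ih k (by omega)
      have i1 := ih (k + 1) (by omega)
      have e0 := h (2 * L + k)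
      have e2 := h (2 * L + k + 2)
      rw [hf _ (by omega)] at e0 e2
      have p3 : pot v q (2 * L + k + 2 + 1) = pot v q (2 * L + k + 1) := by
        rw [pot_of_eq_zero v (hq _ (by omega)), pot_of_eq_zero v (hq _ (by omega))]
        have : Even (2 * L + k + 2 + 1) ↔ Even (2 * L + k + 1) := by grind
        simp [this]
      rw [p3, show 2 * L + k + 2 + 1 = 2 * L + k + 1 + 2 by ring, hop_add_two, hop_add_two] at e2
      have hh := hop_ne_zero hc (2 * L + k + 1)
      rw [show 2 * L + (k + 1) + 2 = 2 * L + k + 1 + 2 by ring,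
        show 2 * L + (k + 1) = 2 * L + k + 1 by ring] at i1
      rw [show 2 * L + (k + 2) + 2 = 2 * L + k + 2 + 2 by ring,
        show 2 * L + (k + 2) = 2 * L + k + 2 by ring]
      refine mul_left_cancel₀ hh ?_
      linear_combination e2 - ξ * e0 - (hop c (2 * L + k) : ℂ) * i0
        - ((pot v q (2 * L + k + 1) : ℂ) - z) * i1

theorem Solves.even_step (hc : 0 < c) (hq : ∀ n, 2 * L < n → q n = 0)
    (hf : ∀ n, 2 * L ≤ n → f n = 0) (h : Solves v q c z f Y) :
    Y (2 * L + 2) = (z - v) * Y (2 * L + 1) - (2 * c : ℝ) * Y (2 * L) := by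
  have e := h (2 * L)
  rw [hf _ le_rfl, hop_even' hc, hop_odd', pot_of_eq_zero v (hq _ (by omega)),
    if_neg (by simp)] at e
  linear_combination e

theorem Solves.odd_step (hc : 0 < c) (hq : ∀ n, 2 * L < n → q n = 0)
    (hf : ∀ n, 2 * L ≤ n → f n = 0) (h : Solves v q c z f Y) :
    (2 * c : ℝ) * Y (2 * L + 3) = (z + v) * Y (2 * L + 2) - Y (2 * L + 1) := by
  have e := h (2 * L + 1)
  rw [hf _ (by omega), hop_odd', show 2 * L + 1 + 1 = 2 * (L + 1) by ring, hop_even' hc,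
    pot_of_eq_zero v (hq _ (by omega)), if_pos (by simp)] at e
  rw [show 2 * (L + 1) = 2 * L + 2 by ring, show 2 * L + 1 + 2 = 2 * L + 3 by ring] at e
  push_cast at e ⊢
  linear_combination e

/-- The amount by which `Y` fails to be proportional, at the sites `2L` and `2L + 1`, to the Floquet
solution `ψ_{2m} = ξ^m (z - v)`, `ψ_{2m+1} = ξ^m (a + ξ)` of the background. -/
def defect (v a : ℝ) (z ξ : ℂ) (L : ℕ) (Y : ℕ → ℂ) : ℂ :=
  (a + ξ) * Y (2 * L) - (z - v) * Y (2 * L + 1)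

theorem Solves.tail_of_defect (hc : 0 < c) (hq : ∀ n, 2 * L < n → q n = 0)
    (hf : ∀ n, 2 * L ≤ n → f n = 0) (h : Solves v q c z f Y) (hzv : z ≠ v)
    (hξ : ξ ^ 2 - floquet v (2 * c) z * ξ + 1 = 0) (hd : defect v (2 * c) z ξ L Y = 0) (k : ℕ) :
    Y (2 * L + k + 2) = ξ * Y (2 * L + k) := by
  have hc' : (2 * c : ℝ) ≠ 0 := by positivity
  rw [floquet_root_iff hc'] at hξ
  have ha : ((2 * c : ℝ) : ℂ) ≠ 0 := Complex.ofReal_ne_zero.2 hc'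
  have e0 := h.even_step hc hq hf
  have e1 := h.odd_step hc hq hf
  unfold defect at hd
  generalize ((2 * c : ℝ) : ℂ) = a at *
  have h0 : Y (2 * L + 2) = ξ * Y (2 * L) := by linear_combination e0 - hd
  refine h.tail hc hq hf h0 ?_ k
  refine mul_left_cancel₀ ha (mul_left_cancel₀ (sub_ne_zero.2 hzv) ?_)
  rw [h0] at e1
  linear_combination (z - v) * e1 + (1 + a * ξ) * hd - Y (2 * L) * hξ

theorem Solves.defect_succ (hc : 0 < c) (hq : ∀ n, 2 * L < n → q n = 0)
    (hf : ∀ n, 2 * L ≤ n → f n = 0) (h : Solves v q c z f Y)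
    (hξ : ξ ^ 2 - floquet v (2 * c) z * ξ + 1 = 0) :
    ξ * defect v (2 * c) z ξ (L + 1) Y = defect v (2 * c) z ξ L Y := by
  have hc' : (2 * c : ℝ) ≠ 0 := by positivity
  rw [floquet_root_iff hc'] at hξ
  have ha : ((2 * c : ℝ) : ℂ) ≠ 0 := Complex.ofReal_ne_zero.2 hc'
  have e0 := h.even_step hc hq hf
  have e1 := h.odd_step hc hq hf
  unfold defect
  rw [show 2 * (L + 1) + 1 = 2 * L + 3 by ring, show 2 * (L + 1) = 2 * L + 2 by ring]
  generalize ((2 * c : ℝ) : ℂ) = a at *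
  refine mul_left_cancel₀ ha ?_
  rw [e0] at e1 ⊢
  linear_combination (-ξ * (z - v)) * e1 + ((z - v) * Y (2 * L + 1) - a * Y (2 * L)) * hξ

theorem Solves.defect_eq_zero_iff (hc : 0 < c) (hq : ∀ n, 2 * L < n → q n = 0)
    (hf : ∀ n, 2 * L ≤ n → f n = 0) (h : Solves v q c z f Y)
    (hξ : ξ ^ 2 - floquet v (2 * c) z * ξ + 1 = 0) (k : ℕ) :
    defect v (2 * c) z ξ (L + k) Y = 0 ↔ defect v (2 * c) z ξ L Y = 0 := by
  have hξ0 : ξ ≠ 0 := by rintro rfl; simp at hξ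
  induction k with
  | zero => rfl
  | succ k ih =>
    have := Solves.defect_succ (L := L + k) hc (fun n hn => hq n (by omega))
      (fun n hn => hf n (by omega)) h hξ
    rw [← this] at ih
    simpa [hξ0, add_assoc] using ih

theorem memlp_of_tail (hξ : ‖ξ‖ < 1) (N : ℕ) (h : ∀ k, Y (N + k + 2) = ξ * Y (N + k)) :
    Memℓp Y 2 := by
  refine memℓp_gen ?_
  have e2 : (2 : ℝ≥0∞).toReal = 2 := by norm_num
  simp only [e2, Real.rpow_two]
  rw [← summable_nat_add_iff N]
  have key : ∀ j k, ‖Y (N + (2 * k + j))‖ ^ 2 = ‖Y (N + j)‖ ^ 2 * (‖ξ‖ ^ 2) ^ k := by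
    intro j k
    induction k with
    | zero => simp
    | succ k ih =>
      rw [show N + (2 * (k + 1) + j) = N + (2 * k + j) + 2 by ring, h, norm_mul, mul_pow, ih]
      ring
  have hg : Summable fun k : ℕ => (‖ξ‖ ^ 2) ^ k :=
    summable_geometric_of_lt_one (by positivity) (pow_lt_one₀ (norm_nonneg _) hξ two_ne_zero)
  have hs : ∀ j, Summable fun k => ‖Y (2 * k + j + N)‖ ^ 2 := fun j =>
    (hg.mul_left (‖Y (N + j)‖ ^ 2)).congr fun k => by rw [add_comm _ N, key j k]
  exact (HasSum.even_add_odd (f := fun n => ‖Y (n + N)‖ ^ 2) (hs 0).hasSum (hs 1).hasSum).summable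

theorem site_succ_eq (h0 : Y 0 = 0) : site (fun i => Y (i + 1)) = Y := by
  funext n
  cases n with
  | zero => exact h0.symm
  | succ n => rfl

end Tail

/-! ### Bound states -/

section Bound

variable {v : ℝ} {q : ℕ →₀ ℝ} {c : ℝ} {z : ℂ} {M : ℕ}

theorem mem_boundStates_of_memlp (hc : 0 < c) (h : Memℓp (sol v q c z 1 0) 2) :
    z ∈ boundStates v q c := by
  set φ := sol v q c z 1 0 with hφ
  have hs : site (fun i => φ (i + 1)) = φ := site_succ_eq (by simp [hφ, sol])
  have hsol : Solves v q c z 0 φ := solves_sol hc z 1 0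
  rw [← hs, solves_site_iff] at hsol
  refine Module.End.hasEigenvalue_of_hasEigenvector (x := ⟨fun i => φ (i + 1), memlp_succ h⟩)
    ⟨?_, ?_⟩
  · rw [Module.End.mem_eigenspace_iff]
    ext i
    have := hsol i
    simp only [Pi.zero_apply, add_zero] at this
    exact this
  · intro h0
    have h1 := congrArg (fun y : HSpace => (y : ℕ → ℂ) 0) h0
    have : φ 1 = 0 := h1
    simp [hφ, sol] at this

/-- At an eigenvalue the Dirichlet solution tends to zero. -/
theorem tendsto_sol_of_mem_boundStates (hc : 0 < c) (h : z ∈ boundStates v q c) :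
    Tendsto (sol v q c z 1 0) atTop (𝓝 0) := by
  obtain ⟨y, hy, hy0⟩ := Module.End.HasEigenvalue.exists_hasEigenvector h
  rw [Module.End.mem_eigenspace_iff] at hy
  have hs : Solves v q c z 0 (site y) := by
    rw [solves_site_iff]
    intro i
    have := congrArg (fun y : HSpace => (y : ℕ → ℂ) i) hy
    simp only [Pi.zero_apply, add_zero]
    exact this
  have he : ∀ n, site y n = site y 1 * sol v q c z 1 0 n := fun n => by
    rw [← sol_mul hc]; exact hs.eq_sol hc rfl n
  have h1 : site y 1 ≠ 0 := by
    intro h1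
    apply hy0
    ext i
    have := he (i + 1)
    rw [h1, zero_mul] at this
    exact this
  have := (tendsto_site_zero y).const_mul (site y 1)⁻¹
  rw [mul_zero] at this
  refine this.congr fun n => ?_
  rw [he n, inv_mul_cancel_left₀ h1]

theorem exists_root_norm_le_one (w : ℂ) : ∃ ξ : ℂ, ‖ξ‖ ≤ 1 ∧ ξ ^ 2 - w * ξ + 1 = 0 := by
  set s := Complex.sqrt (w ^ 2 / 4 - 1) with hs
  have hsq : s ^ 2 = w ^ 2 / 4 - 1 := sqrt_sq_eq _
  have e1 : (w / 2 + s) ^ 2 - w * (w / 2 + s) + 1 = 0 := by linear_combination hsq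
  have e2 : (w / 2 - s) ^ 2 - w * (w / 2 - s) + 1 = 0 := by linear_combination hsq
  have hp : (w / 2 + s) * (w / 2 - s) = 1 := by linear_combination -hsq
  by_cases h : ‖w / 2 + s‖ ≤ 1
  · exact ⟨_, h, e1⟩
  · refine ⟨_, ?_, e2⟩
    have := congrArg norm hp
    rw [norm_mul, norm_one] at this
    nlinarith [norm_nonneg (w / 2 - s)]

theorem mem_boundStates_iff (hc : 0 < c) (hc1 : 2 * c < 1) (hM : 1 ≤ M)
    (hq : ∀ n, 2 * M < n → q n = 0) :
    z ∈ boundStates v q c ↔ ∃ ξ : ℂ, ‖ξ‖ < 1 ∧ ξ ^ 2 - floquet v (2 * c) z * ξ + 1 = 0 ∧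
      (1 + (2 * c : ℝ) * ξ) * (chain (cpot v q) ((2 * c : ℝ) ^ 2 : ℂ) z M).1
        = (2 * c : ℝ) * ξ * (z + v) * (chain (cpot v q) ((2 * c : ℝ) ^ 2 : ℂ) z M).2 := by
  obtain ⟨m, rfl⟩ : ∃ m, M = m + 1 := ⟨M - 1, by omega⟩
  have hc' : (2 * c : ℝ) ≠ 0 := by positivity
  have ha : ((2 * c : ℝ) : ℂ) ≠ 0 := Complex.ofReal_ne_zero.2 hc'
  have hB := (sol_eq_chain (v := v) (q := q) hc z m).2
  have hA := (sol_eq_chain (v := v) (q := q) hc z (m + 1)).1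
  have hsol : Solves v q c z 0 (sol v q c z 1 0) := solves_sol hc z 1 0
  have e0 := hsol.even_step hc hq (fun _ _ => rfl)
  have e1 := hsol.odd_step hc hq (fun _ _ => rfl)
  rw [show 2 * m + 2 = 2 * (m + 1) by ring] at hB
  constructor
  · intro hz
    have hlim := tendsto_sol_of_mem_boundStates hc hz
    obtain ⟨ξ, hξ1, hξ⟩ := exists_root_norm_le_one (floquet v (2 * c) z)
    have hξ0 : ξ ≠ 0 := by rintro rfl; simp at hξ
    set φ := sol v q c z 1 0 with hφ
    -- `φ_{n+2} - ξ φ_n` is divided by `ξ` over each cell, hence it can tend to zero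
    -- only if it is zero
    have hprop : ∀ n, 2 * (m + 1) ≤ n → φ (n + 2) = ξ * φ n := by
      intro n hn
      have hrec : ∀ k, ξ ^ k * (φ (n + 2 * k + 2) - ξ * φ (n + 2 * k)) = φ (n + 2) - ξ * φ n := by
        intro k
        induction k with
        | zero => simp
        | succ k ih =>
          have := hsol.floquet_recurrence (n := n + 2 * k) hc hq (fun _ _ => rfl) (by omega)
          rw [← ih, show n + 2 * (k + 1) + 2 = n + 2 * k + 4 by ring,
            show n + 2 * (k + 1) = n + 2 * k + 2 by ring]
          linear_combination ξ ^ (k + 1) * this - ξ ^ k * φ (n + 2 * k + 2) * hξ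
      have hdiff : Tendsto (fun k : ℕ => φ (n + 2 * k + 2) - ξ * φ (n + 2 * k)) atTop (𝓝 0) := by
        have t1 : Tendsto (fun k : ℕ => n + 2 * k) atTop atTop :=
          tendsto_atTop_mono (fun k => by simp only [id]; omega) tendsto_id
        have := ((tendsto_add_atTop_iff_nat 2).2 hlim).comp t1
        simpa using this.sub ((hlim.comp t1).const_mul ξ)
      have h0 : Tendsto (fun _ : ℕ => φ (n + 2) - ξ * φ n) atTop (𝓝 0) := by
        refine squeeze_zero_norm (fun k => ?_) (tendsto_norm_zero.comp hdiff)
        rw [← hrec k, norm_mul, norm_pow]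
        exact mul_le_of_le_one_left (norm_nonneg _) (pow_le_one₀ (norm_nonneg _) hξ1)
      exact sub_eq_zero.1 (tendsto_nhds_unique tendsto_const_nhds h0)
    have hnot : ¬ (φ (2 * (m + 1)) = 0 ∧ φ (2 * (m + 1) + 1) = 0) := by
      rintro ⟨h0, h1⟩
      rw [hB, div_eq_zero_iff] at h0
      rw [hA, div_eq_zero_iff] at h1
      exact chain_ne_zero (cpot v q) (pow_ne_zero 2 ha) z (m + 1)
        ⟨h1.resolve_right (pow_ne_zero _ ha), h0.resolve_right (pow_ne_zero _ ha)⟩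
    have hlt : ‖ξ‖ < 1 := by
      refine lt_of_le_of_ne hξ1 fun h1 => ?_
      have hz : ∀ n, 2 * (m + 1) ≤ n → φ n = 0 := by
        intro n hn
        have hk : ∀ k : ℕ, ‖φ (n + 2 * k)‖ = ‖φ n‖ := by
          intro k
          induction k with
          | zero => simp
          | succ k ih =>
            rw [show n + 2 * (k + 1) = n + 2 * k + 2 by ring, hprop _ (by omega), norm_mul, h1,
              one_mul, ih]
        have t1 : Tendsto (fun k : ℕ => n + 2 * k) atTop atTop :=
          tendsto_atTop_mono (fun k => by simp only [id]; omega) tendsto_id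
        have := tendsto_norm_zero.comp (hlim.comp t1)
        simp only [Function.comp_def, hk] at this
        exact norm_eq_zero.1 (tendsto_nhds_unique tendsto_const_nhds this)
      exact hnot ⟨hz _ le_rfl, hz _ (by omega)⟩
    refine ⟨ξ, hlt, hξ, ?_⟩
    have p0 := hprop _ le_rfl
    have p1 := hprop (2 * (m + 1) + 1) (by omega)
    rw [show 2 * (m + 1) + 1 + 2 = 2 * (m + 1) + 3 by ring] at p1
    rw [p1, p0] at e1
    rw [eq_div_iff (pow_ne_zero _ ha)] at hA hB
    rw [← hA, ← hB]
    linear_combination ((2 * c : ℝ) : ℂ) ^ (m + 1) * e1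
  · rintro ⟨ξ, hlt, hξ, h⟩
    rw [floquet_root_iff hc'] at hξ
    have h1a : 1 + ((2 * c : ℝ) : ℂ) * ξ ≠ 0 := by
      intro h0
      have : ‖((2 * c : ℝ) : ℂ) * ξ‖ = 1 := by
        rw [eq_neg_of_add_eq_zero_right h0]; simp
      rw [norm_mul, Complex.norm_real, Real.norm_eq_abs, abs_of_pos (by positivity)] at this
      nlinarith [norm_nonneg ξ]
    have hb : (1 + ((2 * c : ℝ) : ℂ) * ξ) * sol v q c z 1 0 (2 * (m + 1) + 1)
        = ξ * (z + v) * sol v q c z 1 0 (2 * (m + 1)) := by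
      rw [eq_div_iff (pow_ne_zero _ ha)] at hA hB
      rw [← hA, ← hB] at h
      refine mul_left_cancel₀ (pow_ne_zero (m + 1) ha) ?_
      linear_combination h
    have p0 : sol v q c z 1 0 (2 * (m + 1) + 2) = ξ * sol v q c z 1 0 (2 * (m + 1)) := by
      refine mul_left_cancel₀ h1a ?_
      linear_combination (1 + ((2 * c : ℝ) : ℂ) * ξ) * e0 + (z - v) * hb
        - sol v q c z 1 0 (2 * (m + 1)) * hξ
    have p1 : sol v q c z 1 0 (2 * (m + 1) + 3) = ξ * sol v q c z 1 0 (2 * (m + 1) + 1) := by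
      refine mul_left_cancel₀ ha ?_
      rw [p0] at e1
      linear_combination e1 - hb
    exact mem_boundStates_of_memlp hc
      (memlp_of_tail hlt _ (hsol.tail hc hq (fun _ _ => rfl) p0 p1))

end Bound

/-! ### The bands and the second sheet -/

theorem floquet_eq (v a : ℝ) (z : ℂ) :
    floquet v a z = (z * z - ((v ^ 2 + 1 + a ^ 2 : ℝ) : ℂ)) / (a : ℂ) := by
  rw [floquet]; push_cast; ring

theorem re_floquet (v a : ℝ) (z : ℂ) :
    (floquet v a z).re = (z.re ^ 2 - z.im ^ 2 - v ^ 2 - 1 - a ^ 2) / a := by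
  rw [floquet_eq, Complex.div_ofReal_re, Complex.sub_re, Complex.ofReal_re, Complex.mul_re]
  congr 1; ring

theorem im_floquet (v a : ℝ) (z : ℂ) : (floquet v a z).im = 2 * z.re * z.im / a := by
  rw [floquet_eq, Complex.div_ofReal_im, Complex.sub_im, Complex.ofReal_im, Complex.mul_im]
  congr 1; ring

theorem onSegment_floquet_iff {v c : ℝ} (hc : 0 < c) (hc1 : 2 * c < 1) {z : ℂ} :
    OnSegment (floquet v (2 * c) z) ↔ z ∈ bands v c := by
  have hc' : (0 : ℝ) < 2 * c := by positivity
  have habs : |c| = c := abs_of_pos hc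
  rw [OnSegment, re_floquet, im_floquet, bands, Set.mem_ofPred_eq, habs, Real.sqrt_le_iff]
  constructor
  · rintro ⟨h1, h2⟩
    rw [abs_le, le_div_iff₀ hc', div_le_iff₀ hc'] at h2
    have hi : z.im = 0 := by
      rw [div_eq_zero_iff] at h1
      have h1 := h1.resolve_right hc'.ne'
      rcases mul_eq_zero.1 h1 with h | h
      · have : z.re = 0 := by linarith
        rw [this] at h2
        nlinarith [sq_nonneg z.im, sq_nonneg v]
      · exact h
    rw [hi] at h2
    refine ⟨hi, ⟨abs_nonneg _, ?_⟩, ?_⟩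
    · rw [sq_abs]; linarith
    · apply Real.le_sqrt_of_sq_le
      rw [sq_abs]; linarith
  · rintro ⟨hi, ⟨-, h1⟩, h2⟩
    rw [Real.le_sqrt (abs_nonneg _) (by positivity), sq_abs] at h2
    rw [sq_abs] at h1
    rw [hi, abs_le, le_div_iff₀ hc', div_le_iff₀ hc']
    refine ⟨by simp, ?_, ?_⟩ <;> linarith

theorem isOpen_compl_bands (v c : ℝ) : IsOpen (bands v c)ᶜ := by
  have h1 : IsClosed {z : ℂ | z.im = 0} := isClosed_eq Complex.continuous_im continuous_const
  have h2 : IsClosed {z : ℂ | √(v ^ 2 + (2 * |c| - 1) ^ 2) ≤ |z.re|} :=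
    isClosed_le continuous_const Complex.continuous_re.abs
  have h3 : IsClosed {z : ℂ | |z.re| ≤ √(v ^ 2 + (2 * |c| + 1) ^ 2)} :=
    isClosed_le Complex.continuous_re.abs continuous_const
  exact (h1.inter (h2.inter h3)).isOpen_compl

theorem isPreconnected_compl_bands {v c : ℝ} (hc : 0 < c) (hc1 : 2 * c < 1) :
    IsPreconnected (bands v c)ᶜ := by
  have hU : Convex ℝ {z : ℂ | 0 < z.im} := convex_halfSpace_im_gt 0
  have hL : Convex ℝ {z : ℂ | z.im < 0} := convex_halfSpace_im_lt 0
  have hline : ∀ x : ℝ, Convex ℝ {z : ℂ | z.re = x} := fun x =>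
    convex_hyperplane (IsLinearMap.mk (fun a b => by simp) (fun a b => by simp)) x
  have hsubU : {z : ℂ | 0 < z.im} ⊆ (bands v c)ᶜ := fun z hz hb => hz.ne' hb.1
  have hsubL : {z : ℂ | z.im < 0} ⊆ (bands v c)ᶜ := fun z hz hb => hz.ne hb.1
  have hsubl : ∀ x : ℝ, (x : ℂ) ∉ bands v c → {z : ℂ | z.re = x} ⊆ (bands v c)ᶜ := by
    intro x hx z hz hb
    apply hx
    have hb1 : z.im = 0 := hb.1
    rwa [show (x : ℂ) = z from Complex.ext (by simpa using hz.symm) (by simp [hb1])]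
  have h0 : ((0 : ℝ) : ℂ) ∉ bands v c := by
    rintro ⟨-, h, -⟩
    rw [Complex.ofReal_re, abs_zero, abs_of_pos hc] at h
    have := Real.sqrt_eq_zero'.1 (le_antisymm h (Real.sqrt_nonneg _))
    nlinarith [sq_nonneg v, mul_pos (sub_pos.2 hc1) (sub_pos.2 hc1)]
  -- the two half planes and a vertical line through a point off the bands form a connected set
  have hT : ∀ x : ℝ, (x : ℂ) ∉ bands v c →
      IsPreconnected ({z : ℂ | 0 < z.im} ∪ {z : ℂ | z.re = x} ∪ {z : ℂ | z.im < 0}) := by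
    intro x hx
    refine IsPreconnected.union (⟨x, -1⟩ : ℂ) (Or.inr rfl) (by simp) ?_ hL.isPreconnected
    exact IsPreconnected.union (⟨x, 1⟩ : ℂ) (by simp) (by simp) hU.isPreconnected
      (hline x).isPreconnected
  refine isPreconnected_of_forall ((0 : ℝ) : ℂ) fun y hy => ?_
  have hy' : (y.re : ℂ) ∉ bands v c ∨ y.im ≠ 0 := by
    by_cases h : y.im = 0
    · left; rwa [show (y.re : ℂ) = y from Complex.ext (by simp) (by simp [h])]
    · exact Or.inr h
  have hsub : ∀ x : ℝ, (x : ℂ) ∉ bands v c →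
      {z : ℂ | 0 < z.im} ∪ {z : ℂ | z.re = x} ∪ {z : ℂ | z.im < 0} ⊆ (bands v c)ᶜ := fun x hx =>
    Set.union_subset (Set.union_subset hsubU (hsubl x hx)) hsubL
  rcases hy' with h | h
  · refine ⟨({z : ℂ | 0 < z.im} ∪ {z : ℂ | z.re = y.re} ∪ {z : ℂ | z.im < 0}) ∪
      ({z : ℂ | 0 < z.im} ∪ {z : ℂ | z.re = (0 : ℝ)} ∪ {z : ℂ | z.im < 0}),
      Set.union_subset (hsub _ h) (hsub _ h0), by simp, by simp,
      IsPreconnected.union Complex.I (by simp) (by simp) (hT _ h) (hT _ h0)⟩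
  · refine ⟨_, hsub 0 h0, by simp, ?_, hT 0 h0⟩
    rcases lt_or_gt_of_ne h with h | h
    · exact Or.inr h
    · exact Or.inl (Or.inl h)

theorem differentiable_floquet (v a : ℝ) : Differentiable ℂ (floquet v a) := by
  unfold floquet; fun_prop

theorem floquet_ofReal (v a x : ℝ) :
    floquet v a x = (((x ^ 2 - v ^ 2 - 1 - a ^ 2) / a : ℝ) : ℂ) := by
  simp [floquet]

/-- The Floquet multiplier on the second sheet: the solution of `ξ + ξ⁻¹ = floquet v a z` outside
the closed unit disc. On the first sheet the multiplier is its inverse. -/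
def outerRoot (v a : ℝ) (z : ℂ) : ℂ := (discRoot (floquet v a z))⁻¹

section Branches

variable {v c : ℝ}

theorem innerRoot_spec (hc : 0 < c) (hc1 : 2 * c < 1) {z : ℂ} (hz : z ∉ bands v c) :
    ‖discRoot (floquet v (2 * c) z)‖ < 1 ∧ discRoot (floquet v (2 * c) z) ≠ 0 ∧
      discRoot (floquet v (2 * c) z) ^ 2
        - floquet v (2 * c) z * discRoot (floquet v (2 * c) z) + 1 = 0 := by
  rw [← onSegment_floquet_iff hc hc1] at hz
  obtain ⟨h1, h2, h3⟩ := discRoot_spec hz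
  refine ⟨h1, h2, ?_⟩
  have := mul_inv_cancel₀ h2
  linear_combination discRoot (floquet v (2 * c) z) * h3 - this

theorem inv_root {w ξ : ℂ} (h : ξ ^ 2 - w * ξ + 1 = 0) : ξ⁻¹ ^ 2 - w * ξ⁻¹ + 1 = 0 := by
  have h0 : ξ ≠ 0 := by rintro rfl; simp at h
  field_simp
  linear_combination h

theorem outerRoot_spec (hc : 0 < c) (hc1 : 2 * c < 1) {z : ℂ} (hz : z ∉ bands v c) :
    outerRoot v (2 * c) z ≠ 0 ∧
      outerRoot v (2 * c) z ^ 2 - floquet v (2 * c) z * outerRoot v (2 * c) z + 1 = 0 := by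
  obtain ⟨-, h2, h3⟩ := innerRoot_spec hc hc1 hz
  exact ⟨inv_ne_zero h2, inv_root h3⟩

theorem differentiableOn_innerRoot (hc : 0 < c) (hc1 : 2 * c < 1) :
    DifferentiableOn ℂ (fun z => discRoot (floquet v (2 * c) z)) (bands v c)ᶜ := by
  intro z hz
  rw [Set.mem_compl_iff, ← onSegment_floquet_iff hc hc1] at hz
  exact (DifferentiableAt.comp z (differentiableAt_discRoot hz)
    (differentiable_floquet v (2 * c) z)).differentiableWithinAt

theorem analyticAt_outerRoot (hc : 0 < c) (hc1 : 2 * c < 1) {z : ℂ} (hz : z ∉ bands v c) :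
    AnalyticAt ℂ (outerRoot v (2 * c)) z :=
  ((differentiableOn_innerRoot hc hc1).inv fun _ hy => (innerRoot_spec hc hc1 hy).2.1).analyticAt
    ((isOpen_compl_bands v c).mem_nhds hz)

/-- Near an interior point of a band there is a holomorphic Floquet multiplier that lies inside the
unit disc on one side of the band (the upper one for `e = 1`, the lower one for `e = -1`) and
outside of it on the other side. -/
theorem exists_branch (hc : 0 < c) {x : ℝ} (hx : InsideBand v c x) {e : ℝ}
    (he : e ^ 2 = 1) : ∃ η : ℂ → ℂ, AnalyticAt ℂ η x ∧ (η x).im ≠ 0 ∧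
      ∀ᶠ z in 𝓝 (x : ℂ), η z ^ 2 - floquet v (2 * c) z * η z + 1 = 0 ∧
        (0 < e * z.im → ‖η z‖ < 1) ∧ (e * z.im < 0 → 1 < ‖η z‖) := by
  have hc' : (0 : ℝ) < 2 * c := by positivity
  obtain ⟨hx1, hx2⟩ := hx
  rw [abs_of_pos hc] at hx1 hx2
  rw [Real.sqrt_lt' (lt_of_le_of_lt (Real.sqrt_nonneg _) hx1), sq_abs] at hx1
  rw [Real.lt_sqrt (abs_nonneg _), sq_abs] at hx2
  have hx0 : x ≠ 0 := by rintro rfl; nlinarith [sq_nonneg v, sq_nonneg (2 * c - 1)]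
  set w : ℝ := (x ^ 2 - v ^ 2 - 1 - (2 * c) ^ 2) / (2 * c) with hw
  have hw2 : |w| < 2 := by
    rw [abs_lt, hw, lt_div_iff₀ hc', div_lt_iff₀ hc']
    constructor <;> linarith
  have hfx : floquet v (2 * c) x = (w : ℂ) := floquet_ofReal v (2 * c) x
  obtain ⟨σ, hσ, hσx⟩ : ∃ σ : ℝ, σ ^ 2 = 1 ∧ 0 < σ * x := by
    rcases lt_or_gt_of_ne hx0 with h | h
    · exact ⟨-1, by norm_num, by linarith⟩
    · exact ⟨1, by norm_num, by linarith⟩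
  set τ : ℝ := -(e * σ) with hτd
  have hτ : τ ^ 2 = 1 := by rw [hτd, neg_sq, mul_pow, he, hσ]; norm_num
  have hpos : 0 < τ * (arcRoot τ (floquet v (2 * c) x)).im := by
    rw [hfx]; exact im_arcRoot_pos τ hτ hw2
  have han : AnalyticAt ℂ (fun z => arcRoot τ (floquet v (2 * c) z)) x := by
    refine AnalyticAt.comp (g := arcRoot τ) ?_ ((differentiable_floquet v (2 * c)).analyticAt x)
    rw [hfx]; exact analyticAt_arcRoot τ hw2
  refine ⟨fun z => arcRoot τ (floquet v (2 * c) z), han, ?_, ?_⟩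
  · intro h; simp only [h, mul_zero, lt_irrefl] at hpos
  have hev1 : ∀ᶠ z in 𝓝 (x : ℂ), 0 < τ * (arcRoot τ (floquet v (2 * c) z)).im :=
    ((continuous_const.mul Complex.continuous_im).continuousAt.comp
      han.continuousAt).eventually (lt_mem_nhds hpos)
  have hev2 : ∀ᶠ z in 𝓝 (x : ℂ), 0 < σ * z.re :=
    (continuous_const.mul Complex.continuous_re).continuousAt.eventually
      (lt_mem_nhds (by simpa using hσx))
  filter_upwards [hev1, hev2] with z h1 h2
  have hroot := arcRoot_eq τ hτ (floquet v (2 * c) z)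
  refine ⟨hroot, ?_⟩
  have key := im_joukowski hroot
  rw [im_floquet] at key
  set η := arcRoot τ (floquet v (2 * c) z) with hη
  have hη0 : 0 < ‖η‖ := norm_pos_iff.2 (by intro h; rw [h] at h1; simp at h1)
  -- `(e Im z)(σ Re z) |η|²` is a positive multiple of `(τ Im η)(1 - |η|²)`
  have key2 : (e * z.im) * (σ * z.re) * ‖η‖ ^ 2 = c * ((τ * η.im) * (1 - ‖η‖ ^ 2)) := by
    have k3 : z.re * z.im * ‖η‖ ^ 2 = c * (η.im * (‖η‖ ^ 2 - 1)) := by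
      field_simp at key
      linarith
    rw [hτd]
    linear_combination e * σ * k3
  constructor
  · intro h
    have : 0 < c * ((τ * η.im) * (1 - ‖η‖ ^ 2)) := by rw [← key2]; positivity
    have := pos_of_mul_pos_right (pos_of_mul_pos_right this hc.le) h1.le
    nlinarith
  · intro h
    have h' : 0 < -(e * z.im) := by linarith
    have : 0 < c * ((τ * η.im) * (‖η‖ ^ 2 - 1)) := by
      have : 0 < -(e * z.im) * (σ * z.re) * ‖η‖ ^ 2 := by positivity
      linarith
    have := pos_of_mul_pos_right (pos_of_mul_pos_right this hc.le) h1.le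
    nlinarith

theorem notMem_bands_of_norm_lt_one (hc : 0 < c) (hc1 : 2 * c < 1) {z ξ : ℂ} (h1 : ‖ξ‖ < 1)
    (h : ξ ^ 2 - floquet v (2 * c) z * ξ + 1 = 0) : z ∉ bands v c := by
  rw [← onSegment_floquet_iff hc hc1]
  exact not_onSegment_of_norm_lt_one h1 h

theorem eq_outerRoot {z ξ : ℂ} (h1 : 1 < ‖ξ‖) (h : ξ ^ 2 - floquet v (2 * c) z * ξ + 1 = 0) :
    ξ = outerRoot v (2 * c) z := by
  rw [outerRoot, ← eq_discRoot (ξ := ξ⁻¹) _ (inv_root h), inv_inv]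
  rw [norm_inv]
  exact inv_lt_one_of_one_lt₀ h1

end Branches

/-! ### The resolvent and its continuation to the second sheet -/

/-- The matrix element `⟨(J - z)⁻¹ f, g⟩` in terms of the Floquet multiplier `ξ` that selects the
sheet. The solution with vanishing boundary values and source `f` is corrected by the multiple of
the Dirichlet solution that makes it a Floquet solution beyond the site `2L`; both `f` and `g` live
on the sites up to `2L`. -/
def green (v : ℝ) (q : ℕ →₀ ℝ) (c : ℝ) (L : ℕ) (f g : ℕ → ℂ) (z ξ : ℂ) : ℂ :=
  ∑ i ∈ Finset.range (2 * L), (sol v q c z 0 f (i + 1)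
    - defect v (2 * c) z ξ L (sol v q c z 0 f) / defect v (2 * c) z ξ L (sol v q c z 1 0)
      * sol v q c z 1 0 (i + 1)) * starRingEnd ℂ (g i)

section Resolvent

variable {v : ℝ} {q : ℕ →₀ ℝ} {c : ℝ}

theorem resolventElem_of_solves {L : ℕ} {f g : HSpace}
    (hg : ∀ n, 2 * L ≤ n → (g : ℕ → ℂ) n = 0) {z : ℂ} (hz : z.im ≠ 0) {u : ℕ → ℂ}
    (hu : Solves v q c z f u) (h0 : u 0 = 0) (hmem : Memℓp u 2) :
    resolventElem v q c f g z
      = ∑ i ∈ Finset.range (2 * L), u (i + 1) * starRingEnd ℂ ((g : ℕ → ℂ) i) := by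
  rw [← site_succ_eq h0, solves_site_iff] at hu
  set U : HSpace := ⟨fun i => u (i + 1), memlp_succ hmem⟩ with hU
  have hUi : ∀ i, (U : ℕ → ℂ) i = u (i + 1) := fun i => rfl
  have hJ' : jacobi v q c U = z • U + f := by
    ext i
    exact hu i
  have hJ : (jacobi v q c - z • (1 : HSpace →L[ℂ] HSpace)) U = f := by
    rw [sub_apply, smul_apply,
      one_apply_eq_self, hJ', add_sub_cancel_left]
  have hinv : Ring.inverse (jacobi v q c - z • (1 : HSpace →L[ℂ] HSpace)) f = U := by
    have := Ring.inverse_mul_cancel _ (isUnit_jacobi_sub (v := v) (q := q) (c := c) hz)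
    rw [← hJ, ← mul_apply_eq_comp, this, one_apply_eq_self]
  have hin : inner ℂ g U = ∑' i, inner ℂ ((g : ℕ → ℂ) i) ((U : ℕ → ℂ) i) :=
    lp.inner_eq_tsum (𝕜 := ℂ) (G := fun _ : ℕ => ℂ) g U
  rw [resolventElem, hinv, hin, tsum_eq_sum (s := Finset.range (2 * L))]
  · exact Finset.sum_congr rfl fun i _ => by rw [hUi, RCLike.inner_apply]
  · intro i hi
    rw [Finset.mem_range, not_lt] at hi
    rw [hg i hi, inner_zero_left]

theorem resolventElem_eq_green (hc : 0 < c) {L : ℕ} (hq : ∀ n, 2 * L < n → q n = 0)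
    {f g : HSpace} (hf : ∀ n, 2 * L ≤ n → (f : ℕ → ℂ) n = 0)
    (hg : ∀ n, 2 * L ≤ n → (g : ℕ → ℂ) n = 0) {z ξ : ℂ} (hz : z.im ≠ 0) (h1 : ‖ξ‖ < 1)
    (hξ : ξ ^ 2 - floquet v (2 * c) z * ξ + 1 = 0) :
    resolventElem v q c f g z = green v q c L f g z ξ := by
  have hzv : z ≠ v := by rintro rfl; simp at hz
  set φ := sol v q c z 1 0 with hφ
  set p := sol v q c z 0 (f : ℕ → ℂ) with hp
  have sφ : Solves v q c z 0 φ := solves_sol hc z 1 0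
  have sp : Solves v q c z f p := solves_sol hc z 0 f
  have hdφ : defect v (2 * c) z ξ L φ ≠ 0 := by
    intro h0
    exact hz (im_eq_zero_of_mem_boundStates (mem_boundStates_of_memlp hc
      (memlp_of_tail h1 _ (sφ.tail_of_defect hc hq (fun _ _ => rfl) hzv hξ h0))))
  set κ := -(defect v (2 * c) z ξ L p / defect v (2 * c) z ξ L φ) with hκ
  set u : ℕ → ℂ := fun n => p n + κ * φ n with hu
  have su : Solves v q c z f u := sp.add_mul sφ κ
  have hdu : defect v (2 * c) z ξ L u = 0 := by
    have : defect v (2 * c) z ξ L u = defect v (2 * c) z ξ L p + κ * defect v (2 * c) z ξ L φ := by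
      simp only [defect, hu]; ring
    rw [this, hκ]; field_simp; ring
  have hmem : Memℓp u 2 := memlp_of_tail h1 _ (su.tail_of_defect hc hq hf hzv hξ hdu)
  rw [resolventElem_of_solves hg hz su (by simp [hu, hp, hφ, sol]) hmem, green]
  refine Finset.sum_congr rfl fun i _ => ?_
  simp only [hu, hκ]; ring

theorem analyticAt_sol (κ : ℂ) (f : ℕ → ℂ) (n : ℕ) (z : ℂ) :
    AnalyticAt ℂ (fun z => sol v q c z κ f n) z :=
  (differentiable_sol κ f n).analyticAt z

theorem analyticAt_defect {η : ℂ → ℂ} {z : ℂ} (hη : AnalyticAt ℂ η z) (L : ℕ) (κ : ℂ)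
    (f : ℕ → ℂ) :
    AnalyticAt ℂ (fun z => defect v (2 * c) z (η z) L (sol v q c z κ f)) z := by
  unfold defect
  have h1 := analyticAt_sol (v := v) (q := q) (c := c) κ f (2 * L) z
  have h2 := analyticAt_sol (v := v) (q := q) (c := c) κ f (2 * L + 1) z
  fun_prop

theorem analyticAt_green {η : ℂ → ℂ} {z : ℂ} (hη : AnalyticAt ℂ η z) (L : ℕ) (f g : ℕ → ℂ)
    (h0 : defect v (2 * c) z (η z) L (sol v q c z 1 0) ≠ 0) :
    AnalyticAt ℂ (fun z => green v q c L f g z (η z)) z := by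
  unfold green
  refine Finset.analyticAt_fun_sum _ fun i _ => ?_
  exact ((analyticAt_sol _ _ _ z).sub (((analyticAt_defect hη L 0 f).div
    (analyticAt_defect hη L 1 0) h0).mul (analyticAt_sol _ _ _ z))).mul analyticAt_const

theorem meromorphicAt_green {η : ℂ → ℂ} {z : ℂ} (hη : AnalyticAt ℂ η z) (L : ℕ) (f g : ℕ → ℂ) :
    MeromorphicAt (fun z => green v q c L f g z (η z)) z := by
  unfold green
  refine MeromorphicAt.fun_sum fun i _ => ?_
  exact ((analyticAt_sol _ _ _ z).meromorphicAt.sub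
    (((analyticAt_defect hη L 0 f).meromorphicAt.div
    (analyticAt_defect hη L 1 0).meromorphicAt).mul (analyticAt_sol _ _ _ z).meromorphicAt)).mul
    (MeromorphicAt.const _ _)

theorem defect_sol_eq_zero_iff (hc : 0 < c) (z ξ : ℂ) (m : ℕ) :
    defect v (2 * c) z ξ (m + 1) (sol v q c z 1 0) = 0 ↔
      (z - v) * (chain (cpot v q) ((2 * c : ℝ) ^ 2 : ℂ) z (m + 1)).1
        = ((2 * c : ℝ) ^ 2 + (2 * c : ℝ) * ξ)
          * (chain (cpot v q) ((2 * c : ℝ) ^ 2 : ℂ) z (m + 1)).2 := by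
  have ha : ((2 * c : ℝ) : ℂ) ≠ 0 := by rw [Complex.ofReal_ne_zero]; positivity
  have hB := (sol_eq_chain (v := v) (q := q) hc z m).2
  have hA := (sol_eq_chain (v := v) (q := q) hc z (m + 1)).1
  rw [show 2 * m + 2 = 2 * (m + 1) by ring, eq_div_iff (pow_ne_zero _ ha)] at hB
  rw [eq_div_iff (pow_ne_zero _ ha)] at hA
  rw [← hA, ← hB, defect, ← mul_right_inj' (pow_ne_zero (m + 1) ha), mul_zero, ← sub_eq_zero,
    ← neg_eq_zero, sub_zero]
  rw [← sub_eq_zero (b := (((2 * c : ℝ) : ℂ) ^ 2 + _) * _)]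
  constructor <;> intro h <;> linear_combination h

/-- In the interior of a band the Jost function does not vanish: the Dirichlet solution is real
there, while the Floquet multiplier is not. -/
theorem defect_sol_ne_zero_of_im (hc : 0 < c) {x : ℝ} (hxv : x ≠ v) {ξ : ℂ} (hξ : ξ.im ≠ 0)
    {m : ℕ} : defect v (2 * c) x ξ (m + 1) (sol v q c x 1 0) ≠ 0 := by
  rw [Ne, defect_sol_eq_zero_iff hc]
  intro h
  have hcp : cpot v q = fun n => ((pot v q n : ℝ) : ℂ) := rfl
  rw [hcp, ← Complex.ofReal_pow, chain_ofReal] at h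
  have hnz := chain_ne_zero (pot v q) (b := (2 * c) ^ 2) (by positivity) x (m + 1)
  set A := (chain (pot v q) ((2 * c) ^ 2) x (m + 1)).1
  set B := (chain (pot v q) ((2 * c) ^ 2) x (m + 1)).2
  have hi := congrArg Complex.im h
  have hr := congrArg Complex.re h
  simp only [Complex.mul_re, Complex.mul_im, Complex.sub_re, Complex.sub_im, Complex.add_re,
    Complex.add_im, Complex.ofReal_re, Complex.ofReal_im] at hi hr
  have hB : B = 0 := by
    have : (2 * c) * (ξ.im * B) = 0 := by linear_combination -hi
    rcases mul_eq_zero.1 this with h | h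
    · linarith
    · exact (mul_eq_zero.1 h).resolve_left hξ
  have hA : A = 0 := by
    have : (x - v) * A = 0 := by rw [hB] at hr; linear_combination hr
    exact (mul_eq_zero.1 this).resolve_left (sub_ne_zero.2 hxv)
  exact hnz ⟨hA, hB⟩

theorem ne_of_insideBand {x : ℝ} (hx : InsideBand v c x) : x ≠ v := by
  rintro rfl
  have h := hx.1
  rw [← Real.sqrt_sq_eq_abs x] at h
  exact absurd h (not_lt.2 (Real.sqrt_le_sqrt (by nlinarith [sq_nonneg (2 * |c| - 1)])))

theorem isContinuation_green (hc : 0 < c) (hc1 : 2 * c < 1) {m : ℕ}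
    (hq : ∀ n, 2 * (m + 1) < n → q n = 0)
    {f g : HSpace} (hf : ∀ n, 2 * (m + 1) ≤ n → (f : ℕ → ℂ) n = 0)
    (hg : ∀ n, 2 * (m + 1) ≤ n → (g : ℕ → ℂ) n = 0) :
    IsContinuation v c (resolventElem v q c f g)
      (fun z => green v q c (m + 1) f g z (outerRoot v (2 * c) z)) := by
  have key : ∀ x : ℝ, InsideBand v c x → ∀ e : ℝ, e ^ 2 = 1 → ∃ h : ℂ → ℂ, AnalyticAt ℂ h x ∧
      ∀ᶠ z in 𝓝 (x : ℂ), (0 < e * z.im → h z = resolventElem v q c f g z) ∧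
        (e * z.im < 0 → h z = green v q c (m + 1) f g z (outerRoot v (2 * c) z)) := by
    intro x hx e he
    obtain ⟨η, hη, hηi, hev⟩ := exists_branch hc hx he
    refine ⟨fun z => green v q c (m + 1) f g z (η z), analyticAt_green hη _ _ _
      (defect_sol_ne_zero_of_im hc (ne_of_insideBand hx) hηi), ?_⟩
    filter_upwards [hev] with z hz
    refine ⟨fun h => ?_, fun h => ?_⟩
    · refine (resolventElem_eq_green hc hq hf hg ?_ (hz.2.1 h) hz.1).symm
      intro h0; simp [h0] at h
    · rw [eq_outerRoot (hz.2.2 h) hz.1]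
  refine ⟨fun z hz => meromorphicAt_green (analyticAt_outerRoot hc hc1 hz) _ _ _, ?_, ?_⟩
  · intro x hx
    obtain ⟨h, h1, h2⟩ := key x hx 1 (by norm_num)
    refine ⟨h, h1, h2.mono fun z hz => ?_⟩
    simpa using hz
  · intro x hx
    obtain ⟨h, h1, h2⟩ := key x hx (-1) (by norm_num)
    refine ⟨h, h1, h2.mono fun z hz => ?_⟩
    simpa using hz

theorem exists_insideBand (hc : 0 < c) : ∃ x : ℝ, InsideBand v c x := by
  refine ⟨√(v ^ 2 + 1 + (2 * c) ^ 2), ?_⟩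
  rw [InsideBand, abs_of_nonneg (Real.sqrt_nonneg _), abs_of_pos hc]
  constructor <;> apply Real.sqrt_lt_sqrt (by positivity) <;> nlinarith

/-- The resonances are the zeros of the Jost function on the second sheet. -/
theorem mem_resonances_iff_defect (hc : 0 < c) (hc1 : 2 * c < 1) {m : ℕ}
    (hq : ∀ n, 2 * (m + 1) < n → q n = 0) {z : ℂ} :
    z ∈ resonances v q c ↔ z ∉ bands v c ∧
      defect v (2 * c) z (outerRoot v (2 * c) z) (m + 1) (sol v q c z 1 0) = 0 := by
  obtain ⟨x, hx⟩ := exists_insideBand (v := v) hc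
  have hpc := isPreconnected_compl_bands (v := v) hc hc1
  constructor
  · rintro ⟨hz, f, g, hf, hg, G, hG, hord⟩
    refine ⟨hz, ?_⟩
    -- a common range of sites that contains the supports of `f`, `g` and `q`
    obtain ⟨K, hK⟩ : ∃ K, (∀ n, 2 * (m + 1 + K) ≤ n → (f : ℕ → ℂ) n = 0) ∧
        ∀ n, 2 * (m + 1 + K) ≤ n → (g : ℕ → ℂ) n = 0 := by
      obtain ⟨k1, h1⟩ := hf.bddAbove
      obtain ⟨k2, h2⟩ := hg.bddAbove
      refine ⟨k1 + k2, fun n hn => ?_, fun n hn => ?_⟩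
      · by_contra h
        have := h1 (show n ∈ {i | (f : ℕ → ℂ) i ≠ 0} from h)
        omega
      · by_contra h
        have := h2 (show n ∈ {i | (g : ℕ → ℂ) i ≠ 0} from h)
        omega
    rw [show m + 1 + K = (m + K) + 1 by ring] at hK
    have hcont := isContinuation_green (v := v) (m := m + K) hc hc1
      (fun n hn => hq n (by omega)) hK.1 hK.2
    rw [meromorphicOrderAt_eq_of_isContinuation hpc hx hG hcont hz] at hord
    by_contra h0
    have h0' : defect v (2 * c) z (outerRoot v (2 * c) z) (m + K + 1) (sol v q c z 1 0) ≠ 0 := by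
      intro h
      rw [show m + K + 1 = m + 1 + K by ring] at h
      exact h0 (((solves_sol hc z 1 0).defect_eq_zero_iff hc hq (fun _ _ => rfl)
        (outerRoot_spec hc hc1 hz).2 K).1 h)
    exact absurd hord (not_lt.2
      (analyticAt_green (analyticAt_outerRoot hc hc1 hz) _ _ _ h0').meromorphicOrderAt_nonneg)
  · rintro ⟨hz, h0⟩
    set f : HSpace := lp.single 2 0 1 with hf
    have hf0 : (f : ℕ → ℂ) 0 = 1 := by simp [hf]
    have hfn : ∀ n, 1 ≤ n → (f : ℕ → ℂ) n = 0 := fun n hn => by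
      rw [hf, lp.single_apply, Pi.single_eq_of_ne (by omega)]
    have hfs : FinSupp f := (Set.finite_singleton 0).subset fun n hn => by
      by_contra h
      exact hn (hfn n (Nat.one_le_iff_ne_zero.2 h))
    have hf' : ∀ n, 2 * (m + 1) ≤ n → (f : ℕ → ℂ) n = 0 := fun n hn => hfn n (by omega)
    refine ⟨hz, f, f, hfs, hfs, _, isContinuation_green hc hc1 hq hf' hf', ?_⟩
    have hη := analyticAt_outerRoot hc hc1 hz
    set d : ℂ → ℂ := fun z =>
      defect v (2 * c) z (outerRoot v (2 * c) z) (m + 1) (sol v q c z 1 0) with hd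
    set n : ℂ → ℂ := fun z =>
      defect v (2 * c) z (outerRoot v (2 * c) z) (m + 1) (sol v q c z 0 f) with hn
    have had : ∀ y ∉ bands v c, AnalyticAt ℂ d y := fun y hy =>
      analyticAt_defect (analyticAt_outerRoot hc hc1 hy) _ _ _
    have han : AnalyticAt ℂ n z := analyticAt_defect hη _ _ _
    have hgreen : (fun z => green v q c (m + 1) f f z (outerRoot v (2 * c) z)) = -n / d := by
      funext y
      rw [green, Finset.sum_eq_single 0]
      · simp [hf0, sol, hn, hd, neg_div]
      · intro i _ hi
        rw [hfn i (Nat.one_le_iff_ne_zero.2 hi)]; simp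
      · simp
    -- the numerator does not vanish, by the Wronskian of the two solutions
    have hn0 : n z ≠ 0 := by
      intro hn0
      have hW : ∀ k, (hop c (k + 1) : ℂ) * (sol v q c z 1 0 (k + 1) * sol v q c z 0 f (k + 2)
          - sol v q c z 0 f (k + 1) * sol v q c z 1 0 (k + 2)) = 1 := by
        intro k
        have hh := hop_ne_zero hc (k + 1)
        induction k with
        | zero =>
          have h2 : sol v q c z 0 f 2 = 1 / hop c 1 := by simp [sol, hf0]
          have h1 : sol v q c z 0 f 1 = 0 := by simp [sol]
          have h1' : sol v q c z 1 0 1 = 1 := by simp [sol]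
          rw [zero_add, zero_add, h2, h1, h1']
          rw [zero_add] at hh
          field_simp
          ring
        | succ k ih =>
          have ih := ih (hop_ne_zero hc (k + 1))
          have e1 := solves_sol (v := v) (q := q) hc z 1 0 (k + 1)
          have e2 := solves_sol (v := v) (q := q) hc z 0 f (k + 1)
          rw [hfn _ (by omega)] at e2
          simp only [Pi.zero_apply] at e1
          linear_combination ih + sol v q c z 1 0 (k + 2) * e2 - sol v q c z 0 f (k + 2) * e1
      have hw := hW (2 * m + 1)
      rw [show 2 * m + 1 + 1 = 2 * (m + 1) by ring, show 2 * m + 1 + 2 = 2 * (m + 1) + 1 by ring]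
        at hw
      have h0' : defect v (2 * c) z (outerRoot v (2 * c) z) (m + 1) (sol v q c z 1 0) = 0 := h0
      have hn0' : defect v (2 * c) z (outerRoot v (2 * c) z) (m + 1) (sol v q c z 0 f) = 0 := hn0
      unfold defect at h0' hn0'
      have hout : ((2 * c : ℝ) : ℂ) + outerRoot v (2 * c) z ≠ 0 := by
        intro h
        have h2 := congrArg norm (eq_neg_of_add_eq_zero_right h)
        rw [norm_neg, Complex.norm_real, Real.norm_eq_abs, abs_of_pos (by positivity), outerRoot,
          norm_inv] at h2
        have h3 := innerRoot_spec hc hc1 hz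
        have := (one_lt_inv₀ (norm_pos_iff.2 h3.2.1)).2 h3.1
        linarith
      have : ((2 * c : ℝ) : ℂ) + outerRoot v (2 * c) z = 0 := by
        linear_combination (-((2 * c : ℝ) + outerRoot v (2 * c) z)) * hw
          - hop c (2 * (m + 1)) * sol v q c z 1 0 (2 * (m + 1) + 1) * hn0'
          + hop c (2 * (m + 1)) * sol v q c z 0 f (2 * (m + 1) + 1) * h0'
      exact hout this
    -- the denominator does not vanish identically, since it does not vanish near the band
    obtain ⟨y, hy, hdy⟩ : ∃ y, y ∉ bands v c ∧ d y ≠ 0 := by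
      obtain ⟨η, hηa, hηi, hev⟩ := exists_branch (e := 1) hc hx (by norm_num)
      have hne := (analyticAt_defect (v := v) (q := q) (c := c) hηa (m + 1) 1 0).continuousAt
        |>.eventually_ne (defect_sol_ne_zero_of_im hc (ne_of_insideBand hx) hηi)
      obtain ⟨ε, hε, hb⟩ := Metric.eventually_nhds_iff_ball.1 (hev.and hne)
      set y : ℂ := x - (ε / 2 : ℝ) * Complex.I with hy
      have hyb : y ∈ Metric.ball (x : ℂ) ε := by
        have : |ε| < 2 * ε := by rw [abs_of_pos hε]; linarith
        simpa [hy, dist_eq_norm, div_lt_iff₀, mul_comm] using this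
      have hyi : y.im < 0 := by simp [hy, hε]
      obtain ⟨⟨h1, -, h2⟩, h3⟩ := hb y hyb
      refine ⟨y, fun h => hyi.ne h.1, ?_⟩
      rw [hd]
      simp only
      rw [← eq_outerRoot (h2 (by simpa using hyi)) h1]
      exact h3
    have hmd : MeromorphicOn d (bands v c)ᶜ := fun y hy => (had y hy).meromorphicAt
    have hdtop : meromorphicOrderAt d z ≠ ⊤ := by
      refine hmd.meromorphicOrderAt_ne_top_of_isPreconnected hpc (x := y) hy hz ?_
      have := (tendsto_ne_zero_iff_meromorphicOrderAt_eq_zero (had y hy).meromorphicAt).1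
        ⟨d y, hdy, (had y hy).continuousAt.tendsto.mono_left nhdsWithin_le_nhds⟩
      rw [this]; simp
    have hdpos : 0 < meromorphicOrderAt d z := by
      refine (tendsto_zero_iff_meromorphicOrderAt_pos (had z hz).meromorphicAt).1 ?_
      have := (had z hz).continuousAt.tendsto.mono_left (nhdsWithin_le_nhds (s := {z}ᶜ))
      rwa [show d z = 0 from h0] at this
    have hnzero : meromorphicOrderAt (-n) z = 0 := by
      refine (tendsto_ne_zero_iff_meromorphicOrderAt_eq_zero han.neg.meromorphicAt).1
        ⟨-n z, neg_ne_zero.2 hn0, han.neg.continuousAt.tendsto.mono_left nhdsWithin_le_nhds⟩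
    rw [hgreen, meromorphicOrderAt_div han.neg.meromorphicAt (had z hz).meromorphicAt, hnzero]
    lift meromorphicOrderAt d z to ℤ using hdtop with k hk
    norm_cast at hdpos ⊢
    simpa using hdpos

end Resolvent

/-! ### Convergence of the zeros on a sheet -/

/-- The equation of the Riemann surface in terms of `s = a ξ`, where `ξ` is the Floquet multiplier.
The two solutions for a given `z` have the product `a²`. -/
def OnSurface (v a : ℝ) (z s : ℂ) : Prop :=
  s ^ 2 - (z ^ 2 - v ^ 2 - 1 - a ^ 2) * s + a ^ 2 = 0

theorem onSurface_mul_iff {v a : ℝ} (ha : a ≠ 0) {z ξ : ℂ} :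
    OnSurface v a z (a * ξ) ↔ ξ ^ 2 - floquet v a z * ξ + 1 = 0 := by
  have ha' : (a : ℂ) ≠ 0 := by exact_mod_cast ha
  rw [floquet_root_iff ha, OnSurface]
  constructor <;> intro h
  · refine mul_left_cancel₀ ha' ?_; linear_combination h
  · linear_combination (a : ℂ) * h

/-- The zeros of a function of `z`, the hopping `a`, and the small solution `s` of the equation of
the Riemann surface. Since a point off the bands has exactly one such `s`, these are zeros on one
sheet. -/
def sheetSet (v : ℝ) (h : ℂ → ℝ → ℂ → ℂ) (a : ℝ) : Set ℂ :=
  {z | ∃ s : ℂ, ‖s‖ < a ∧ OnSurface v a z s ∧ h z a s = 0}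

theorem eventually_forall_norm_le {P : ℝ → ℂ → Prop}
    (h : ∀ᶠ p : ℝ × ℂ in 𝓝 (0, 0), P p.1 p.2) : ∀ᶠ a in 𝓝[>] (0 : ℝ), ∀ s, ‖s‖ ≤ a → P a s := by
  obtain ⟨δ, hδ, hb⟩ := Metric.eventually_nhds_iff_ball.1 h
  filter_upwards [Ioo_mem_nhdsGT hδ] with a ha s hs
  refine hb (a, s) ?_
  rw [Metric.mem_ball, Prod.dist_eq, max_lt_iff, dist_zero_right, dist_zero_right,
    Real.norm_eq_abs, abs_of_pos ha.1]
  exact ⟨ha.2, hs.trans_lt ha.2⟩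

theorem eventually_not_onSegment {v : ℝ} {K : Set ℂ} (hK : IsCompact K)
    (h : ∀ z ∈ K, z ^ 2 ≠ v ^ 2 + 1) :
    ∀ᶠ a in 𝓝[>] (0 : ℝ), ∀ z ∈ K, ¬ OnSegment (floquet v a z) := by
  have key : ∀ᶠ a : ℝ in 𝓝 0, ∀ z ∈ K, 2 * |a| < ‖z ^ 2 - (v : ℂ) ^ 2 - 1 - (a : ℂ) ^ 2‖ := by
    refine hK.eventually_forall_of_forall_eventually fun z hz => ?_
    have hc1 : ContinuousAt (fun p : ℝ × ℂ => 2 * |p.1|) (0, z) := by fun_prop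
    have hc2 : ContinuousAt
        (fun p : ℝ × ℂ => ‖p.2 ^ 2 - (v : ℂ) ^ 2 - 1 - (p.1 : ℂ) ^ 2‖) (0, z) := by
      fun_prop
    refine hc1.eventually_lt hc2 ?_
    simp only [abs_zero, mul_zero, norm_pos_iff, Complex.ofReal_zero, ne_eq, OfNat.ofNat_ne_zero,
      not_false_eq_true, zero_pow, sub_zero]
    rw [sub_sub]
    exact sub_ne_zero.2 (h z hz)
  filter_upwards [key.filter_mono nhdsWithin_le_nhds, self_mem_nhdsWithin] with a ha ha0 z hz hs
  have ha0' : 0 < a := ha0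
  have h1 := ha z hz
  have h2 : ‖floquet v a z‖ ≤ 2 := by
    rw [show floquet v a z = ((floquet v a z).re : ℂ) from Complex.ext (by simp) (by simp [hs.1]),
      Complex.norm_real]
    exact hs.2
  rw [floquet, norm_div, Complex.norm_real, Real.norm_eq_abs, abs_of_pos ha0',
    div_le_iff₀ ha0'] at h2
  rw [abs_of_pos ha0'] at h1
  linarith

/-- Near a zero of the limit that is not on a flat band, there are zeros on the sheet. -/
theorem eventually_exists_mem_sheetSet {v : ℝ} {h : ℂ → ℝ → ℂ → ℂ} {T : Set ℂ} (hT : T.Finite)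
    (hcont : Continuous fun p : ℂ × ℝ × ℂ => h p.1 p.2.1 p.2.2)
    (hdiff : ∀ a, Differentiable ℂ fun p : ℂ × ℂ => h p.1 a p.2)
    (hzero : ∀ z, h z 0 0 = 0 ↔ z ∈ T) {t : ℂ} (ht : t ∈ T) (hflat : t ^ 2 ≠ v ^ 2 + 1)
    {r : ℝ} (hr : 0 < r) : ∀ᶠ a in 𝓝[>] (0 : ℝ), ∃ z ∈ sheetSet v h a, dist z t ≤ r := by
  have hev : ∀ᶠ z in 𝓝 t, z ∉ T \ {t} ∧ z ^ 2 ≠ v ^ 2 + 1 := by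
    have h1 : ∀ᶠ z in 𝓝 t, z ∈ (T \ {t})ᶜ :=
      (hT.subset Set.sdiff_subset).isClosed.isOpen_compl.mem_nhds (by simp)
    exact h1.and ((continuous_pow 2).continuousAt.eventually_ne hflat)
  obtain ⟨ε, hε, hb⟩ := Metric.eventually_nhds_iff_ball.1 hev
  set ρ := min r (ε / 2) with hρ
  have hρ0 : 0 < ρ := lt_min hr (by positivity)
  have hsub : Metric.closedBall t ρ ⊆ Metric.ball t ε :=
    Metric.closedBall_subset_ball ((min_le_right _ _).trans_lt (by linarith))
  have hS : IsCompact (Metric.sphere t ρ) := isCompact_sphere t ρ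
  have hc0 : Continuous fun z => ‖h z 0 0‖ :=
    (hcont.comp (by fun_prop : Continuous fun z : ℂ => ((z, 0, 0) : ℂ × ℝ × ℂ))).norm
  obtain ⟨z₀, hz₀, hmin⟩ := hS.exists_isMinOn
    (NormedSpace.sphere_nonempty.2 hρ0.le) hc0.continuousOn
  have hm : 0 < ‖h z₀ 0 0‖ := by
    rw [norm_pos_iff]
    intro h0
    refine (hb z₀ (hsub (Metric.sphere_subset_closedBall hz₀))).1 ⟨(hzero z₀).1 h0, ?_⟩
    rintro rfl
    rw [mem_sphere_iff_norm, sub_self, norm_zero] at hz₀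
    exact hρ0.ne hz₀
  set m := ‖h z₀ 0 0‖ / 2 with hmdef
  have e1 : ∀ᶠ p : ℝ × ℂ in 𝓝 (0, 0), ∀ z ∈ Metric.sphere t ρ, m < ‖h z p.1 p.2‖ := by
    refine hS.eventually_forall_of_forall_eventually fun z hz => ?_
    have : ContinuousAt (fun w : (ℝ × ℂ) × ℂ => ‖h w.2 w.1.1 w.1.2‖) ((0, 0), z) :=
      (hcont.comp (by fun_prop : Continuous fun w : (ℝ × ℂ) × ℂ =>
        ((w.2, w.1.1, w.1.2) : ℂ × ℝ × ℂ))).norm.continuousAt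
    exact this.eventually (lt_mem_nhds (lt_of_lt_of_le (by simp only [hmdef]; linarith) (hmin hz)))
  have e2 : ∀ᶠ p : ℝ × ℂ in 𝓝 (0, 0), ‖h t p.1 p.2‖ < m := by
    have : ContinuousAt (fun w : ℝ × ℂ => ‖h t w.1 w.2‖) (0, 0) :=
      (hcont.comp (by fun_prop : Continuous fun w : ℝ × ℂ =>
        ((t, w.1, w.2) : ℂ × ℝ × ℂ))).norm.continuousAt
    refine this.eventually (gt_mem_nhds ?_)
    change ‖h t 0 0‖ < m
    rw [(hzero t).2 ht, norm_zero]; positivity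
  filter_upwards [eventually_forall_norm_le
      (P := fun a s => ∀ z ∈ Metric.sphere t ρ, m < ‖h z a s‖) e1,
    eventually_forall_norm_le (P := fun a s => ‖h t a s‖ < m) e2, self_mem_nhdsWithin,
    eventually_not_onSegment (isCompact_closedBall t ρ) (fun z hz => (hb z (hsub hz)).2)]
    with a h1 h2 ha0 hseg
  have ha : (0 : ℝ) < a := ha0
  have hnorm : ∀ z ∈ Metric.closedBall t ρ, ‖(a : ℂ) * discRoot (floquet v a z)‖ < a := by
    intro z hz
    rw [norm_mul, Complex.norm_real, Real.norm_eq_abs, abs_of_pos ha]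
    exact mul_lt_of_lt_one_right ha (discRoot_spec (hseg z hz)).1
  have hd : DifferentiableOn ℂ (fun z => h z a (a * discRoot (floquet v a z)))
      (Metric.closedBall t ρ) := by
    intro z hz
    have d1 : DifferentiableAt ℂ (fun z => discRoot (floquet v a z)) z :=
      DifferentiableAt.comp z (differentiableAt_discRoot (hseg z hz)) (differentiable_floquet v a z)
    have d2 : DifferentiableAt ℂ (fun z => (z, (a : ℂ) * discRoot (floquet v a z))) z :=
      differentiableAt_id.prodMk (d1.const_mul _)
    exact (DifferentiableAt.comp (g := fun p : ℂ × ℂ => h p.1 a p.2) z (hdiff a _)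
      d2).differentiableWithinAt
  obtain ⟨z, hz, hz0⟩ := exists_zero_of_norm_lt_sphere hρ0 hd
    (fun z hz => (h1 _ (hnorm z (Metric.sphere_subset_closedBall hz)).le z hz).le)
    (h2 _ (hnorm t (Metric.mem_closedBall_self hρ0.le)).le)
  refine ⟨z, ⟨_, hnorm z hz, ?_, hz0⟩, (Metric.mem_closedBall.1 hz).trans (min_le_left _ _)⟩
  rw [onSurface_mul_iff ha.ne']
  obtain ⟨-, k2, k3⟩ := discRoot_spec (hseg z hz)
  have := mul_inv_cancel₀ k2
  linear_combination discRoot (floquet v a z) * k3 - this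

/-- The zeros on a sheet converge to the zeros of the limit, provided that they stay bounded and
that the flat bands among the zeros of the limit are approached. -/
theorem tendsto_hausdorffEDist_sheetSet {v : ℝ} {h : ℂ → ℝ → ℂ → ℂ} {T : Set ℂ} (hT : T.Finite)
    (hcont : Continuous fun p : ℂ × ℝ × ℂ => h p.1 p.2.1 p.2.2)
    (hdiff : ∀ a, Differentiable ℂ fun p : ℂ × ℂ => h p.1 a p.2)
    (hzero : ∀ z, h z 0 0 = 0 ↔ z ∈ T)
    (hbdd : ∃ R, ∀ᶠ a in 𝓝[>] (0 : ℝ), ∀ z ∈ sheetSet v h a, ‖z‖ ≤ R)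
    (hflat : ∀ t ∈ T, t ^ 2 = v ^ 2 + 1 → ∀ r > 0, ∀ᶠ a in 𝓝[>] (0 : ℝ),
      ∃ z ∈ sheetSet v h a, dist z t ≤ r) :
    Tendsto (fun a => Metric.hausdorffEDist (sheetSet v h a) T) (𝓝[>] 0) (𝓝 0) := by
  rw [ENNReal.tendsto_nhds_zero]
  intro ε hε
  obtain ⟨r, hr0, hrε⟩ := ENNReal.lt_iff_exists_nnreal_btwn.1 hε
  have hr : (0 : ℝ) < r := by exact_mod_cast hr0
  obtain ⟨R, hR⟩ := hbdd
  have h2 : ∀ᶠ a in 𝓝[>] (0 : ℝ), ∀ t ∈ T, ∃ z ∈ sheetSet v h a, dist z t ≤ r := by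
    rw [Filter.eventually_all_finite hT]
    intro t ht
    by_cases hf : t ^ 2 = v ^ 2 + 1
    · exact hflat t ht hf r hr
    · exact eventually_exists_mem_sheetSet hT hcont hdiff hzero ht hf hr
  set K := Metric.closedBall (0 : ℂ) R \ ⋃ t ∈ T, Metric.ball t r with hK
  have hKc : IsCompact K := (isCompact_closedBall 0 R).diff
    (isOpen_biUnion fun _ _ => Metric.isOpen_ball)
  have h1 : ∀ᶠ p : ℝ × ℂ in 𝓝 (0, 0), ∀ z ∈ K, h z p.1 p.2 ≠ 0 := by
    refine hKc.eventually_forall_of_forall_eventually fun z hz => ?_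
    have : ContinuousAt (fun w : (ℝ × ℂ) × ℂ => h w.2 w.1.1 w.1.2) ((0, 0), z) :=
      (hcont.comp (by fun_prop : Continuous fun w : (ℝ × ℂ) × ℂ =>
        ((w.2, w.1.1, w.1.2) : ℂ × ℝ × ℂ))).continuousAt
    refine this.eventually_ne fun h0 => hz.2 ?_
    exact Set.mem_biUnion ((hzero z).1 h0) (Metric.mem_ball_self hr)
  filter_upwards [h2, hR, eventually_forall_norm_le (P := fun a s => ∀ z ∈ K, h z a s ≠ 0) h1]
    with a k1 k2 k3
  refine (Metric.hausdorffEDist_le_of_mem_edist (r := r) ?_ ?_).trans hrε.le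
  · intro z hz
    have hz2 := k2 z hz
    obtain ⟨s, hs, -, hs0⟩ := hz
    by_contra! hfar
    refine k3 s hs.le z ⟨by simpa using hz2, ?_⟩ hs0
    simp only [Set.mem_iUnion, not_exists]
    intro t ht hzt
    refine absurd (hfar t ht) (not_lt.2 ?_)
    rw [edist_nndist, ENNReal.coe_le_coe, ← NNReal.coe_le_coe, coe_nndist]
    exact (Metric.mem_ball.1 hzt).le
  · intro t ht
    obtain ⟨z, hz, hd⟩ := k1 t ht
    refine ⟨z, hz, ?_⟩
    rw [edist_comm, edist_nndist, ENNReal.coe_le_coe, ← NNReal.coe_le_coe, coe_nndist]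
    exact hd

/-! ### The equations for bound states and resonances -/

/-- The function whose zeros with small `s` are the bound states, for `q` supported in the first
`M` cells. -/
def boundFn (v : ℝ) (q : ℕ →₀ ℝ) (M : ℕ) (z : ℂ) (a : ℝ) (s : ℂ) : ℂ :=
  (1 + s) * (chain (cpot v q) (a ^ 2 : ℂ) z M).1
    - s * (z + v) * (chain (cpot v q) (a ^ 2 : ℂ) z M).2

/-- The function whose zeros with small `s` are the resonances, for `q` supported in the first
`M` cells. -/
def resFn (v : ℝ) (q : ℕ →₀ ℝ) (M : ℕ) (z : ℂ) (a : ℝ) (s : ℂ) : ℂ :=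
  (z - v) * (chain (cpot v q) (a ^ 2 : ℂ) z M).1
    - (z ^ 2 - v ^ 2 - 1 - s) * (chain (cpot v q) (a ^ 2 : ℂ) z M).2

section Equations

variable {v : ℝ} {q : ℕ →₀ ℝ} {c : ℝ} {m : ℕ}

theorem boundStates_eq_sheetSet (hc : 0 < c) (hc1 : 2 * c < 1)
    (hq : ∀ n, 2 * (m + 1) < n → q n = 0) :
    boundStates v q c = sheetSet v (boundFn v q (m + 1)) (2 * c) := by
  have ha : (0 : ℝ) < 2 * c := by positivity
  have ha' : ((2 * c : ℝ) : ℂ) ≠ 0 := by exact_mod_cast ha.ne'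
  ext z
  rw [mem_boundStates_iff hc hc1 (by omega) hq]
  constructor
  · rintro ⟨ξ, h1, h2, h3⟩
    refine ⟨(2 * c : ℝ) * ξ, ?_, (onSurface_mul_iff ha.ne').2 h2, ?_⟩
    · rw [norm_mul, Complex.norm_real, Real.norm_eq_abs, abs_of_pos ha]
      exact mul_lt_of_lt_one_right ha h1
    · rw [boundFn]; linear_combination h3
  · rintro ⟨s, h1, h2, h3⟩
    obtain ⟨ξ, rfl⟩ : ∃ ξ : ℂ, s = (2 * c : ℝ) * ξ := ⟨s / (2 * c : ℝ), by field_simp⟩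
    refine ⟨ξ, ?_, (onSurface_mul_iff ha.ne').1 h2, ?_⟩
    · rw [norm_mul, Complex.norm_real, Real.norm_eq_abs, abs_of_pos ha] at h1
      nlinarith
    · rw [boundFn] at h3; linear_combination h3

theorem resonances_eq_sheetSet (hc : 0 < c) (hc1 : 2 * c < 1)
    (hq : ∀ n, 2 * (m + 1) < n → q n = 0) :
    resonances v q c = sheetSet v (resFn v q (m + 1)) (2 * c) := by
  have ha : (0 : ℝ) < 2 * c := by positivity
  have ha' : ((2 * c : ℝ) : ℂ) ≠ 0 := by exact_mod_cast ha.ne'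
  -- the multiplier `ξ` outside the disc is related to the small solution by `a ξ + s = E - a²`
  have hrel : ∀ z ξ : ℂ, ξ ^ 2 - floquet v (2 * c) z * ξ + 1 = 0 →
      ((2 * c : ℝ) : ℂ) ^ 2 + (2 * c : ℝ) * ξ⁻¹ = z ^ 2 - v ^ 2 - 1 - (2 * c : ℝ) * ξ := by
    intro z ξ h
    have hξ0 : ξ ≠ 0 := by rintro rfl; simp at h
    rw [floquet_root_iff ha.ne'] at h
    field_simp
    linear_combination h
  ext z
  rw [mem_resonances_iff_defect hc hc1 hq, defect_sol_eq_zero_iff hc]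
  constructor
  · rintro ⟨hz, h3⟩
    obtain ⟨h1, -, h2⟩ := innerRoot_spec hc hc1 hz
    refine ⟨(2 * c : ℝ) * discRoot (floquet v (2 * c) z), ?_, (onSurface_mul_iff ha.ne').2 h2, ?_⟩
    · rw [norm_mul, Complex.norm_real, Real.norm_eq_abs, abs_of_pos ha]
      exact mul_lt_of_lt_one_right ha h1
    · rw [outerRoot, hrel z _ h2] at h3
      rw [resFn, h3, sub_self]
  · rintro ⟨s, h1, h2, h3⟩
    obtain ⟨ξ, rfl⟩ : ∃ ξ : ℂ, s = (2 * c : ℝ) * ξ := ⟨s / (2 * c : ℝ), by field_simp⟩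
    have hξ1 : ‖ξ‖ < 1 := by
      rw [norm_mul, Complex.norm_real, Real.norm_eq_abs, abs_of_pos ha] at h1
      nlinarith
    have hξ := (onSurface_mul_iff ha.ne').1 h2
    refine ⟨notMem_bands_of_norm_lt_one hc hc1 hξ1 hξ, ?_⟩
    rw [outerRoot, ← eq_discRoot hξ1 hξ, hrel z _ hξ]
    rw [resFn] at h3
    exact sub_eq_zero.1 h3

theorem continuous_chain {R : Type*} [CommRing R] [TopologicalSpace R] [IsTopologicalRing R]
    (V : ℕ → R) (m : ℕ) : Continuous fun p : R × R => chain V p.2 p.1 m := by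
  induction m with
  | zero => exact continuous_const
  | succ m ih => simp only [chain]; fun_prop

theorem differentiable_chain (V : ℕ → ℂ) (b : ℂ) (m : ℕ) :
    Differentiable ℂ (fun z => (chain V b z m).1) ∧
      Differentiable ℂ (fun z => (chain V b z m).2) := by
  induction m with
  | zero => simp [chain]
  | succ m ih =>
    obtain ⟨h1, h2⟩ := ih
    simp only [chain]
    exact ⟨by fun_prop, by fun_prop⟩

theorem continuous_chain_comp (V : ℕ → ℂ) (M : ℕ) :
    Continuous fun p : ℂ × ℝ × ℂ => chain V ((p.2.1 : ℂ) ^ 2) p.1 M :=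
  (continuous_chain V M).comp
    (by fun_prop : Continuous fun p : ℂ × ℝ × ℂ => ((p.1, (p.2.1 : ℂ) ^ 2) : ℂ × ℂ))

theorem continuous_boundFn (M : ℕ) :
    Continuous fun p : ℂ × ℝ × ℂ => boundFn v q M p.1 p.2.1 p.2.2 := by
  have := continuous_chain_comp (cpot v q) M
  unfold boundFn; fun_prop

theorem continuous_resFn (M : ℕ) :
    Continuous fun p : ℂ × ℝ × ℂ => resFn v q M p.1 p.2.1 p.2.2 := by
  have := continuous_chain_comp (cpot v q) M
  unfold resFn; fun_prop

theorem differentiable_boundFn (M : ℕ) (a : ℝ) :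
    Differentiable ℂ fun p : ℂ × ℂ => boundFn v q M p.1 a p.2 := by
  obtain ⟨h1, h2⟩ := differentiable_chain (cpot v q) (a ^ 2 : ℂ) M
  have h1' := h1.comp (differentiable_fst (𝕜 := ℂ) (E := ℂ) (F := ℂ))
  have h2' := h2.comp (differentiable_fst (𝕜 := ℂ) (E := ℂ) (F := ℂ))
  simp only [Function.comp_def] at h1' h2'
  unfold boundFn; fun_prop

theorem differentiable_resFn (M : ℕ) (a : ℝ) :
    Differentiable ℂ fun p : ℂ × ℂ => resFn v q M p.1 a p.2 := by
  obtain ⟨h1, h2⟩ := differentiable_chain (cpot v q) (a ^ 2 : ℂ) M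
  have h1' := h1.comp (differentiable_fst (𝕜 := ℂ) (E := ℂ) (F := ℂ))
  have h2' := h2.comp (differentiable_fst (𝕜 := ℂ) (E := ℂ) (F := ℂ))
  simp only [Function.comp_def] at h1' h2'
  unfold resFn; fun_prop

/-- The resonance function in terms of the polynomials of the cells before the last one that `q`
touches. -/
theorem resFn_succ (z : ℂ) (a : ℝ) (s : ℂ) :
    resFn v q (m + 1) z a s = (chain (cpot v q) (a ^ 2 : ℂ) z m).1
        * (-(q (2 * m + 1) + q (2 * m + 2) * (z - v) * (z - v - q (2 * m + 1)))
          + s * (z - v - q (2 * m + 1)))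
      - (chain (cpot v q) (a ^ 2 : ℂ) z m).2 * (a ^ 2 * (1 - q (2 * m + 2) * (z - v) + s)) := by
  have h1 : cpot v q (2 * m + 1) = v + q (2 * m + 1) := by simp [cpot, pot]
  have h2 : cpot v q (2 * m + 2) = -v + q (2 * m + 2) := by
    have : Even (2 * m + 2) := by grind
    simp [cpot, pot, this]
  rw [resFn, chain_succ_fst, chain_succ_snd, h1, h2]
  ring

theorem block_factor (z : ℂ) (n : ℕ) :
    (z - cpot v q (2 * n - 1)) * (z - cpot v q (2 * n)) - 1
      = (z - zPlus v q n) * (z - zMinus v q n) := by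
  have hs := Real.sq_sqrt
    (by positivity : 0 ≤ ((pot v q (2 * n - 1) - pot v q (2 * n)) / 2) ^ 2 + 1)
  have hs' : ((√(((pot v q (2 * n - 1) - pot v q (2 * n)) / 2) ^ 2 + 1) : ℝ) : ℂ) ^ 2
      = (((pot v q (2 * n - 1) : ℂ) - pot v q (2 * n)) / 2) ^ 2 + 1 := by
    rw [← Complex.ofReal_pow, hs]; push_cast; ring
  simp only [zPlus, zMinus, cpot, Complex.ofReal_add, Complex.ofReal_sub, Complex.ofReal_div,
    Complex.ofReal_ofNat]
  linear_combination hs'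

theorem chain_zero_succ (z : ℂ) (n : ℕ) : (chain (cpot v q) 0 z (n + 1)).1
    = (z - zPlus v q (n + 1)) * (z - zMinus v q (n + 1)) * (chain (cpot v q) 0 z n).1 := by
  rw [← block_factor, chain_succ_fst, chain_succ_snd, show 2 * (n + 1) - 1 = 2 * n + 1 by omega,
    show 2 * (n + 1) = 2 * n + 2 by ring]
  ring

theorem chain_zero_eq_zero_iff (z : ℂ) (M : ℕ) :
    (chain (cpot v q) 0 z M).1 = 0 ↔ z ∈ zSet v q M := by
  induction M with
  | zero =>
    simp only [chain, one_ne_zero, false_iff]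
    rintro ⟨n, h1, h2, -⟩; omega
  | succ M ih =>
    rw [chain_zero_succ, mul_eq_zero, mul_eq_zero, ih, sub_eq_zero, sub_eq_zero]
    constructor
    · rintro (h | ⟨n, h1, h2, h3⟩)
      · exact ⟨M + 1, by omega, le_rfl, h⟩
      · exact ⟨n, h1, by omega, h3⟩
    · rintro ⟨n, h1, h2, h3⟩
      rcases Nat.lt_or_ge M n with h | h
      · obtain rfl : n = M + 1 := by omega
        exact Or.inl h3
      · exact Or.inr ⟨n, h1, h, h3⟩

theorem finite_zSet (M : ℕ) : (zSet v q M).Finite := by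
  refine ((Set.finite_Icc 1 M).biUnion fun n _ =>
    (Set.toFinite {(zPlus v q n : ℂ), (zMinus v q n : ℂ)})).subset ?_
  rintro z ⟨n, h1, h2, h3⟩
  exact Set.mem_biUnion (show n ∈ Set.Icc 1 M from ⟨h1, h2⟩) h3

theorem boundFn_zero (M : ℕ) (z : ℂ) : boundFn v q M z 0 0 = (chain (cpot v q) 0 z M).1 := by
  simp [boundFn]

theorem resFn_zero (z : ℂ) : resFn v q (m + 1) z 0 0 = (chain (cpot v q) 0 z m).1
    * -(q (2 * m + 1) + q (2 * m + 2) * (z - v) * (z - v - q (2 * m + 1))) := by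
  rw [resFn_succ]; simp

/-- Far from the spectrum the polynomials `A_m` dominate. -/
theorem norm_chain_le (v : ℝ) (q : ℕ →₀ ℝ) : ∃ R : ℝ, ∀ b z : ℂ, ‖b‖ ≤ 1 → R ≤ ‖z‖ → ∀ m,
    ‖(chain (cpot v q) b z m).2‖ ≤ ‖(chain (cpot v q) b z m).1‖ ∧
      0 < ‖(chain (cpot v q) b z m).1‖ := by
  set C := |v| + ∑ m ∈ q.support, |q m| with hC
  refine ⟨C + 2, fun b z hb hz m => ?_⟩
  have hV : ∀ n, 2 ≤ ‖z - cpot v q n‖ := fun n => by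
    have h1 : ‖cpot v q n‖ ≤ C := norm_pot_le v q n
    have h2 := norm_sub_norm_le z (cpot v q n)
    linarith
  induction m with
  | zero => simp [chain]
  | succ m ih =>
    obtain ⟨h1, h2⟩ := ih
    have hB : ‖(chain (cpot v q) b z m).1‖ ≤ ‖(chain (cpot v q) b z (m + 1)).2‖ := by
      rw [chain_succ_snd]
      have := norm_sub_norm_le ((z - cpot v q (2 * m + 1)) * (chain (cpot v q) b z m).1)
        (b * (chain (cpot v q) b z m).2)
      rw [norm_mul, norm_mul] at this
      nlinarith [hV (2 * m + 1), norm_nonneg (chain (cpot v q) b z m).2, norm_nonneg b]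
    have hA : ‖(chain (cpot v q) b z (m + 1)).2‖ ≤ ‖(chain (cpot v q) b z (m + 1)).1‖ := by
      rw [chain_succ_fst]
      have := norm_sub_norm_le ((z - cpot v q (2 * m + 2)) * (chain (cpot v q) b z (m + 1)).2)
        (chain (cpot v q) b z m).1
      rw [norm_mul] at this
      nlinarith [hV (2 * m + 2)]
    exact ⟨hA, by linarith⟩

/-- Far from the spectrum the small solution of the equation of the surface decays. -/
theorem norm_mul_le_of_onSurface {a K : ℝ} (ha : 0 < a) (ha1 : a < 1) {z s : ℂ} (hs : ‖s‖ < a)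
    (h : OnSurface v a z s) (hz2 : 2 ≤ ‖z‖) (hz : v ^ 2 + 3 + K ≤ ‖z‖) :
    ‖s‖ * (‖z‖ + K) ≤ a ^ 2 := by
  have e : (a : ℂ) ^ 2 = s * (z ^ 2 - ((v : ℂ) ^ 2 + 1 + a ^ 2 + s)) := by
    rw [OnSurface] at h; linear_combination h
  have e2 : a ^ 2 = ‖s‖ * ‖z ^ 2 - ((v : ℂ) ^ 2 + 1 + a ^ 2 + s)‖ := by
    rw [← norm_mul, ← e, norm_pow, Complex.norm_real, Real.norm_eq_abs, sq_abs]
  have h1 : ‖(v : ℂ) ^ 2 + 1 + a ^ 2 + s‖ ≤ v ^ 2 + 3 := by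
    refine (norm_add_le _ _).trans ?_
    have : ‖(v : ℂ) ^ 2 + 1 + a ^ 2‖ = v ^ 2 + 1 + a ^ 2 := by
      rw [show (v : ℂ) ^ 2 + 1 + a ^ 2 = ((v ^ 2 + 1 + a ^ 2 : ℝ) : ℂ) by push_cast; ring,
        Complex.norm_real, Real.norm_eq_abs, abs_of_nonneg (by positivity)]
    nlinarith
  have h2 := norm_sub_norm_le (z ^ 2) ((v : ℂ) ^ 2 + 1 + a ^ 2 + s)
  rw [norm_pow] at h2
  rw [e2]
  exact mul_le_mul_of_nonneg_left (by nlinarith) (norm_nonneg _)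

theorem bounded_sheetSet_boundFn (v : ℝ) (q : ℕ →₀ ℝ) (M : ℕ) :
    ∃ R, ∀ᶠ a in 𝓝[>] (0 : ℝ), ∀ z ∈ sheetSet v (boundFn v q M) a, ‖z‖ ≤ R := by
  obtain ⟨R, hR⟩ := norm_chain_le v q
  refine ⟨max (max R 2) (v ^ 2 + 3 + |v|), ?_⟩
  filter_upwards [Ioo_mem_nhdsGT (show (0 : ℝ) < 1 / 2 by norm_num)] with a ha z hz
  obtain ⟨s, hs, hsur, h0⟩ := hz
  by_contra! hlt
  rw [max_lt_iff, max_lt_iff] at hlt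
  have hb : ‖(a : ℂ) ^ 2‖ ≤ 1 := by
    rw [norm_pow, Complex.norm_real, Real.norm_eq_abs, abs_of_pos ha.1]; nlinarith [ha.1, ha.2]
  obtain ⟨hBA, hA⟩ := hR _ z hb hlt.1.1.le M
  have hsz := norm_mul_le_of_onSurface ha.1 (by linarith [ha.2]) hs hsur hlt.1.2.le hlt.2.le
  have e := congrArg norm (sub_eq_zero.1 h0)
  rw [norm_mul, norm_mul, norm_mul] at e
  have h1 : 1 / 2 ≤ ‖1 + s‖ := by
    have := norm_sub_norm_le 1 (-s)
    rw [norm_neg, norm_one, sub_neg_eq_add] at this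
    linarith [ha.2]
  have h2 : ‖s‖ * ‖z + v‖ ≤ 1 / 4 := by
    have : ‖z + v‖ ≤ ‖z‖ + |v| := by
      simpa using norm_add_le z (v : ℂ)
    have := mul_le_mul_of_nonneg_left this (norm_nonneg s)
    nlinarith [ha.1, ha.2]
  have h3 : ‖s‖ * ‖z + v‖ * ‖(chain (cpot v q) (a ^ 2 : ℂ) z M).2‖
      ≤ 1 / 4 * ‖(chain (cpot v q) (a ^ 2 : ℂ) z M).1‖ :=
    mul_le_mul h2 hBA (norm_nonneg _) (by norm_num)
  nlinarith

theorem bounded_sheetSet_resFn (v : ℝ) (q : ℕ →₀ ℝ) (m : ℕ)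
    (hαβ : q (2 * m + 1) ≠ 0 ∨ q (2 * m + 2) ≠ 0) :
    ∃ R, ∀ᶠ a in 𝓝[>] (0 : ℝ), ∀ z ∈ sheetSet v (resFn v q (m + 1)) a, ‖z‖ ≤ R := by
  obtain ⟨R, hR⟩ := norm_chain_le v q
  set α := q (2 * m + 1) with hα
  set β := q (2 * m + 2) with hβ
  -- the limit equation dominates for large `z`
  obtain ⟨η, R', hη, hR'⟩ : ∃ η R' : ℝ, 0 < η ∧ ∀ z : ℂ, R' ≤ ‖z‖ →
      η * (3 + |β| * ‖z - v‖) ≤ ‖(α : ℂ) + β * (z - v) * (z - v - α)‖ := by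
    by_cases hβ0 : β = 0
    · have hα0 : α ≠ 0 := hαβ.resolve_right (not_not.2 hβ0)
      refine ⟨|α| / 3, 0, by positivity, fun z _ => ?_⟩
      simp [hβ0]
    · have hβp : 0 < |β| := abs_pos.2 hβ0
      refine ⟨1, |v| + (|α| + 2 + (3 + |α|) / |β|), one_pos, fun z hz => ?_⟩
      have h1 : |α| + 2 + (3 + |α|) / |β| ≤ ‖z - v‖ := by
        have := norm_sub_norm_le z (v : ℂ)
        rw [Complex.norm_real, Real.norm_eq_abs] at this
        linarith
      have h2 : ‖z - v‖ - |α| ≤ ‖z - v - α‖ := by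
        have := norm_sub_norm_le (z - v) (α : ℂ)
        rwa [Complex.norm_real, Real.norm_eq_abs] at this
      have h3 : |β| * ‖z - v‖ * ‖z - v - α‖ - |α| ≤ ‖(α : ℂ) + β * (z - v) * (z - v - α)‖ := by
        have := norm_sub_norm_le ((β : ℂ) * (z - v) * (z - v - α)) (-α : ℂ)
        rw [norm_neg, norm_mul, norm_mul, Complex.norm_real, Complex.norm_real, Real.norm_eq_abs,
          Real.norm_eq_abs] at this
        rwa [sub_neg_eq_add, add_comm _ (α : ℂ)] at this
      have h4 : 3 + |α| ≤ |β| * ‖z - v‖ := by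
        rw [← div_le_iff₀' hβp]
        have := abs_nonneg α
        linarith
      have h5 : 2 ≤ ‖z - v - α‖ := by
        have : 0 ≤ (3 + |α|) / |β| := by positivity
        linarith
      nlinarith [mul_le_mul_of_nonneg_left h5 (by positivity : 0 ≤ |β| * ‖z - v‖)]
  refine ⟨max (max R 2) (max R' (v ^ 2 + 3 + (|v| + |α|))), ?_⟩
  have hsq : ∀ᶠ a in 𝓝[>] (0 : ℝ), a ^ 2 < η := by
    have : ContinuousAt (fun a : ℝ => a ^ 2) 0 := by fun_prop
    exact (this.eventually (gt_mem_nhds (by simpa using hη))).filter_mono nhdsWithin_le_nhds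
  filter_upwards [Ioo_mem_nhdsGT one_pos, hsq] with a ha haη z hz
  obtain ⟨s, hs, hsur, h0⟩ := hz
  by_contra! hlt
  rw [max_lt_iff, max_lt_iff, max_lt_iff] at hlt
  have hn : ‖(a : ℂ) ^ 2‖ = a ^ 2 := by rw [norm_pow, Complex.norm_real, Real.norm_eq_abs, sq_abs]
  obtain ⟨hBA, hA⟩ := hR _ z (by rw [hn]; nlinarith [ha.1, ha.2]) hlt.1.1.le m
  have hsz := norm_mul_le_of_onSurface ha.1 ha.2 hs hsur hlt.1.2.le hlt.2.2.le
  have hκ := hR' z hlt.2.1.le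
  rw [resFn_succ, ← hα, ← hβ] at h0
  have e := congrArg norm (sub_eq_zero.1 h0)
  rw [norm_mul, norm_mul, norm_mul, hn] at e
  have h1 : ‖s * (z - v - α)‖ ≤ a ^ 2 := by
    rw [norm_mul]
    refine (mul_le_mul_of_nonneg_left ?_ (norm_nonneg s)).trans hsz
    have h1 := norm_sub_le (z - v) (α : ℂ)
    have h2 := norm_sub_le z (v : ℂ)
    rw [Complex.norm_real, Real.norm_eq_abs] at h1 h2
    linarith
  have h2 : ‖1 - (β : ℂ) * (z - v) + s‖ ≤ 2 + |β| * ‖z - v‖ := by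
    have h1 := norm_add_le (1 - (β : ℂ) * (z - v)) s
    have h2 := norm_sub_le 1 ((β : ℂ) * (z - v))
    rw [norm_mul, Complex.norm_real, Real.norm_eq_abs, norm_one] at h2
    linarith [ha.2]
  set κ : ℂ := (α : ℂ) + β * (z - v) * (z - v - α) with hκd
  have h3 : ‖κ‖ - a ^ 2 ≤ ‖-κ + s * (z - v - α)‖ := by
    have := norm_sub_norm_le (-κ) (-(s * (z - v - α)))
    rw [norm_neg, norm_neg, sub_neg_eq_add] at this
    linarith
  have h4 : a ^ 2 * (3 + |β| * ‖z - v‖) < ‖κ‖ :=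
    lt_of_lt_of_le (mul_lt_mul_of_pos_right haη (by positivity)) hκ
  have h5 : a ^ 2 * ‖1 - (β : ℂ) * (z - v) + s‖ < ‖-κ + s * (z - v - α)‖ := by
    have := mul_le_mul_of_nonneg_left h2 (sq_nonneg a)
    linarith
  have h6 : ‖(chain (cpot v q) (a ^ 2 : ℂ) z m).2‖ * (a ^ 2 * ‖1 - (β : ℂ) * (z - v) + s‖)
      ≤ ‖(chain (cpot v q) (a ^ 2 : ℂ) z m).1‖ * (a ^ 2 * ‖1 - (β : ℂ) * (z - v) + s‖) :=
    mul_le_mul_of_nonneg_right hBA (by positivity)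
  have h7 := mul_lt_mul_of_pos_left h5 hA
  linarith

end Equations

/-! ### Real zeros near a flat band -/

/-- A discrete Christoffel–Darboux inequality: the quotient `A_m / B_m` increases with slope at
least one. -/
theorem chain_hasDerivAt (V : ℕ → ℝ) {b : ℝ} (hb : 0 ≤ b) (x : ℝ) (m : ℕ) :
    ∃ A' B' : ℝ, HasDerivAt (fun x => (chain V b x m).1) A' x ∧
      HasDerivAt (fun x => (chain V b x m).2) B' x ∧
      (chain V b x m).2 ^ 2 ≤ A' * (chain V b x m).2 - (chain V b x m).1 * B' := by
  induction m with
  | zero => exact ⟨0, 0, hasDerivAt_const _ _, hasDerivAt_const _ _, by simp [chain]⟩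
  | succ m ih =>
    obtain ⟨A', B', hA, hB, h⟩ := ih
    have hx : ∀ w : ℝ, HasDerivAt (fun x => x - w) 1 x := fun w => (hasDerivAt_id x).sub_const w
    have hB1 := ((hx (V (2 * m + 1))).mul hA).sub (hB.const_mul b)
    have hA1 := ((hx (V (2 * m + 2))).mul hB1).sub hA
    refine ⟨_, _, hA1, hB1, ?_⟩
    simp only [chain]
    set A := (chain V b x m).1
    set B := (chain V b x m).2
    have h2 : 0 ≤ b * (A' * B - A * B') := mul_nonneg hb ((sq_nonneg _).trans h)
    simp only [Pi.sub_apply, Pi.mul_apply]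
    nlinarith [sq_nonneg A]

/-- The coefficient of `A_m` in the resonance function. -/
def resY (v α β x s : ℝ) : ℝ := -(α + β * (x - v) * (x - v - α)) + s * (x - v - α)

/-- The coefficient of `-B_m` in the resonance function. -/
def resX (v β a x s : ℝ) : ℝ := a ^ 2 * (1 - β * (x - v) + s)

/-- The real parametrization of the Riemann surface near a flat band: `σ` is the sign of the flat
band and `ε τ` is the coordinate `s`, so that `τ < a` on one sheet and `τ > a` on the other. -/
def surfaceParam (v a σ ε τ : ℝ) : ℝ := σ * √(v ^ 2 + 1 + a ^ 2 + ε * (τ + a ^ 2 / τ))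

theorem nonneg_of_hasDerivAt {F : ℝ → ℝ} {d t u : ℝ} (hF : HasDerivAt F d t) (h0 : F t = 0)
    (htu : t < u) (h : ∀ x ∈ Set.Ioo t u, 0 ≤ F x) : 0 ≤ d := by
  have h1 := (hasDerivAt_iff_tendsto_slope.1 hF).mono_left
    (nhdsWithin_mono t (s := Set.Ioi t) fun x hx => ne_of_gt hx)
  refine ge_of_tendsto h1 ?_
  filter_upwards [Ioo_mem_nhdsGT htu] with x hx
  rw [slope_def_field, h0, sub_zero]
  exact div_nonneg (h x hx) (sub_nonneg.2 hx.1.le)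

theorem hasDerivAt_surfaceParam {v a σ ε τ : ℝ} (hσ : σ ^ 2 = 1) (h0 : 0 < τ)
    (hp : 0 < v ^ 2 + 1 + a ^ 2 + ε * (τ + a ^ 2 / τ)) :
    HasDerivAt (surfaceParam v a σ ε)
      (ε * (1 - a ^ 2 / τ ^ 2) / (2 * surfaceParam v a σ ε τ)) τ := by
  have h1 : HasDerivAt (fun τ : ℝ => v ^ 2 + 1 + a ^ 2 + ε * (τ + a ^ 2 / τ))
      (ε * (1 - a ^ 2 / τ ^ 2)) τ := by
    have h2 := (((hasDerivAt_id τ).add ((hasDerivAt_inv h0.ne').const_mul (a ^ 2))).const_mul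
      ε).const_add (v ^ 2 + 1 + a ^ 2)
    refine h2.congr_deriv ?_
    ring
  refine ((h1.sqrt hp.ne').const_mul σ).congr_deriv ?_
  have hs : √(v ^ 2 + 1 + a ^ 2 + ε * (τ + a ^ 2 / τ)) ≠ 0 := (Real.sqrt_pos.2 hp).ne'
  have hσ0 : σ ≠ 0 := by rintro rfl; norm_num at hσ
  rw [surfaceParam]
  field_simp
  rw [hσ]; ring

/-- The derivative of the resonance function along the real parametrization. -/
theorem hasDerivAt_along_surface {v α β a σ ε τ A' B' : ℝ} {A B : ℝ → ℝ} (hσ : σ ^ 2 = 1)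
    (h0 : 0 < τ) (hp : 0 < v ^ 2 + 1 + a ^ 2 + ε * (τ + a ^ 2 / τ))
    (hA : HasDerivAt A A' (surfaceParam v a σ ε τ))
    (hB : HasDerivAt B B' (surfaceParam v a σ ε τ)) :
    HasDerivAt (fun τ => A (surfaceParam v a σ ε τ) * resY v α β (surfaceParam v a σ ε τ) (ε * τ)
        - B (surfaceParam v a σ ε τ) * resX v β a (surfaceParam v a σ ε τ) (ε * τ))
      ((A' * resY v α β (surfaceParam v a σ ε τ) (ε * τ)
        + A (surfaceParam v a σ ε τ) * (-(β * (2 * (surfaceParam v a σ ε τ - v) - α)) + ε * τ)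
        - B' * resX v β a (surfaceParam v a σ ε τ) (ε * τ)
        - B (surfaceParam v a σ ε τ) * -(a ^ 2 * β))
          * (ε * (1 - a ^ 2 / τ ^ 2) / (2 * surfaceParam v a σ ε τ))
        + ε * (A (surfaceParam v a σ ε τ) * (surfaceParam v a σ ε τ - v - α)
          - a ^ 2 * B (surfaceParam v a σ ε τ))) τ := by
  have hsp := hasDerivAt_surfaceParam hσ h0 hp
  have hs : HasDerivAt (fun τ => ε * τ) ε τ := by simpa using (hasDerivAt_id τ).const_mul ε
  have hxv' := hsp.sub_const v
  have hY := (((hxv'.const_mul β).mul (hxv'.sub_const α)).const_add α).neg.add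
    (hs.mul (hxv'.sub_const α))
  have hX := (((hxv'.const_mul β).const_sub 1).add hs).const_mul (a ^ 2)
  refine (((hA.comp τ hsp).mul hY).sub ((hB.comp τ hsp).mul hX)).congr_deriv ?_
  simp only [Function.comp_apply, resY, resX, Pi.add_apply, Pi.mul_apply, Pi.neg_apply]
  ring

/-- At a real zero of the resonance function `A y - B X`, its partial derivatives in `s` and `x`
have a product with the sign of `x`. -/
theorem partial_derivatives_sign {v α β a x s A A' B B' : ℝ} (ha : 0 < a)
    (hy : resY v α β x s ≠ 0)
    (hyx : 0 < resY v α β x s ^ 2 - (-(a ^ 2 * β) * resY v α β x s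
      - resX v β a x s * (-(β * (2 * (x - v) - α)) + s)))
    (hxv : 0 < x * (x - v)) (hineq : B ^ 2 ≤ A' * B - A * B') (hne : ¬ (A = 0 ∧ B = 0))
    (h0 : A * resY v α β x s - B * resX v β a x s = 0) :
    0 < (A * (x - v - α) - a ^ 2 * B) * (A' * resY v α β x s
      + A * (-(β * (2 * (x - v) - α)) + s) - B' * resX v β a x s - B * -(a ^ 2 * β)) * x := by
  -- the determinant identity of the two coefficients
  have hdet : (1 - β * (x - v) + s) * (x - v - α) - resY v α β x s = x - v := by
    rw [resY]; ring
  have hxd : resX v β a x s = a ^ 2 * (1 - β * (x - v) + s) := rfl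
  have hB0 : B ≠ 0 := by
    intro h
    rw [h, zero_mul, sub_zero] at h0
    exact hne ⟨(mul_eq_zero.1 h0).resolve_right hy, h⟩
  generalize resY v α β x s = y at *
  have hVy : (A * (x - v - α) - a ^ 2 * B) * y = a ^ 2 * B * (x - v) := by
    rw [hxd] at h0
    linear_combination (x - v - α) * h0 + a ^ 2 * B * hdet
  generalize resX v β a x s = X at *
  set W := A * (x - v - α) - a ^ 2 * B with hW
  set g := A' * y + A * (-(β * (2 * (x - v) - α)) + s) - B' * X - B * -(a ^ 2 * β) with hg
  have h2 : 0 < B ^ 2 := by positivity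
  have hBg : 0 < B * y * g := by
    have e : B * y * g = y ^ 2 * (A' * B - A * B') - B ^ 2 * (-(a ^ 2 * β) * y
        - X * (-(β * (2 * (x - v) - α)) + s)) := by
      rw [hg]
      linear_combination (B * (-(β * (2 * (x - v) - α)) + s) + y * B') * h0
    rw [e]
    nlinarith [mul_pos h2 hyx, mul_le_mul_of_nonneg_left hineq (sq_nonneg y)]
  have h3 : 0 < (W * y) * (B * y * g) * (x * B) := by
    rw [hVy, show a ^ 2 * B * (x - v) * (B * y * g) * (x * B)
        = a ^ 2 * B ^ 2 * (B * y * g) * (x * (x - v)) by ring]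
    positivity
  rw [show (W * y) * (B * y * g) * (x * B) = (W * g * x) * (y * B) ^ 2 by ring] at h3
  exact pos_of_mul_pos_left h3 (sq_nonneg _)

/-- The sign conflict at the outermost zero `t > a` on the first sheet: `W` is the derivative of the
Jost function in `s` and `g` the one in `x`. -/
theorem false_of_signs {ς ε W g x a t : ℝ} (ha : 0 < a) (hlt : a < t) (hprod : 0 < W * g * x)
    (hF : 0 < ς * (ε * (a ^ 2 / t - t) * W))
    (hd : 0 ≤ ς * (g * (ε * (1 - a ^ 2 / t ^ 2) / (2 * x)) + ε * W)) : False := by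
  have ht : 0 < t := ha.trans hlt
  have hx0 : x ≠ 0 := right_ne_zero_of_mul hprod.ne'
  have hs1 : ς * ε * W < 0 := by
    have h9 : a ^ 2 / t - t ≤ 0 := by
      rw [sub_nonpos, div_le_iff₀ ht]; nlinarith
    rw [show ς * (ε * (a ^ 2 / t - t) * W) = (ς * ε * W) * (a ^ 2 / t - t) by ring] at hF
    by_contra! h
    exact absurd hF (not_lt.2 (mul_nonpos_of_nonneg_of_nonpos h h9))
  have hratio : 0 < 1 - a ^ 2 / t ^ 2 := by
    rw [sub_pos, div_lt_one (by positivity)]; nlinarith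
  have hs2 : 0 < ς * ε * g * x := by
    have h5 : ς * (g * (ε * (1 - a ^ 2 / t ^ 2) / (2 * x)) + ε * W)
        = (ς * ε * g * x) * ((1 - a ^ 2 / t ^ 2) / (2 * x ^ 2)) + ς * ε * W := by
      field_simp
    rw [h5] at hd
    have h8 : 0 < (ς * ε * g * x) * ((1 - a ^ 2 / t ^ 2) / (2 * x ^ 2)) := by linarith
    exact pos_of_mul_pos_left h8 (by positivity)
  have h6 := mul_neg_of_neg_of_pos hs1 hs2
  rw [show ς * ε * W * (ς * ε * g * x) = (ς * ε) ^ 2 * (W * g * x) by ring] at h6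
  exact absurd h6 (not_lt.2 (mul_nonneg (sq_nonneg (ς * ε)) hprod.le))

/-- A bound state or a zero at a band edge is accompanied by a resonance further away from the
band. Beyond the outermost bound state the values of the Jost function on the two sheets would
otherwise have the same sign, which contradicts the monotonicity of `A / B`. -/
theorem exists_zero_on_second_sheet {v α β a η σ ε : ℝ} {A B : ℝ → ℝ} (ha : 0 < a) (haη : a < η)
    (hσ : σ ^ 2 = 1) (hε : ε ^ 2 = 1)
    (hAB : ∀ x, ∃ A' B', HasDerivAt A A' x ∧ HasDerivAt B B' x ∧ B x ^ 2 ≤ A' * B x - A x * B')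
    (hne : ∀ x, ¬ (A x = 0 ∧ B x = 0))
    (hpos : ∀ τ ∈ Set.Icc (a ^ 2 / η) η, 0 < v ^ 2 + 1 + a ^ 2 + ε * (τ + a ^ 2 / τ))
    (hy : ∀ τ ∈ Set.Icc (a ^ 2 / η) η, resY v α β (surfaceParam v a σ ε τ) (ε * τ) ≠ 0)
    (hyx : ∀ τ ∈ Set.Icc (a ^ 2 / η) η, 0 < resY v α β (surfaceParam v a σ ε τ) (ε * τ) ^ 2
      - (-(a ^ 2 * β) * resY v α β (surfaceParam v a σ ε τ) (ε * τ)
        - resX v β a (surfaceParam v a σ ε τ) (ε * τ)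
          * (-(β * (2 * (surfaceParam v a σ ε τ - v) - α)) + ε * τ)))
    (hxv : ∀ τ ∈ Set.Icc (a ^ 2 / η) η,
      0 < surfaceParam v a σ ε τ * (surfaceParam v a σ ε τ - v))
    {f : ℝ → ℝ} (hf : ∀ τ, f τ = A (surfaceParam v a σ ε τ)
        * resY v α β (surfaceParam v a σ ε τ) (ε * τ)
      - B (surfaceParam v a σ ε τ) * resX v β a (surfaceParam v a σ ε τ) (ε * τ))
    (hend : 0 < f η * f (a ^ 2 / η)) (hzero : ∃ τ ∈ Set.Ico a η, f τ = 0) :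
    ∃ τ ∈ Set.Ioo (a ^ 2 / η) a, f τ = 0 := by
  by_contra! hno
  have hη : 0 < η := ha.trans haη
  have hlow : a ^ 2 / η < a := by rw [div_lt_iff₀ hη]; nlinarith
  have hlow0 : 0 < a ^ 2 / η := by positivity
  have hτ0 : ∀ τ ∈ Set.Icc (a ^ 2 / η) η, 0 < τ := fun τ h => hlow0.trans_le h.1
  -- the derivative of `f`
  have hder : ∀ τ ∈ Set.Icc (a ^ 2 / η) η, ∃ A' B', B (surfaceParam v a σ ε τ) ^ 2
      ≤ A' * B (surfaceParam v a σ ε τ) - A (surfaceParam v a σ ε τ) * B' ∧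
      HasDerivAt f ((A' * resY v α β (surfaceParam v a σ ε τ) (ε * τ)
        + A (surfaceParam v a σ ε τ) * (-(β * (2 * (surfaceParam v a σ ε τ - v) - α)) + ε * τ)
        - B' * resX v β a (surfaceParam v a σ ε τ) (ε * τ)
        - B (surfaceParam v a σ ε τ) * -(a ^ 2 * β))
          * (ε * (1 - a ^ 2 / τ ^ 2) / (2 * surfaceParam v a σ ε τ))
        + ε * (A (surfaceParam v a σ ε τ) * (surfaceParam v a σ ε τ - v - α)
          - a ^ 2 * B (surfaceParam v a σ ε τ))) τ := by
    intro τ hτ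
    obtain ⟨A', B', hA, hB, hineq⟩ := hAB (surfaceParam v a σ ε τ)
    refine ⟨A', B', hineq, ?_⟩
    rw [show f = _ from funext hf]
    exact hasDerivAt_along_surface hσ (hτ0 τ hτ) (hpos τ hτ) hA hB
  have hcont : ContinuousOn f (Set.Icc (a ^ 2 / η) η) := fun τ hτ => by
    obtain ⟨A', B', -, h⟩ := hder τ hτ
    exact h.continuousAt.continuousWithinAt
  -- normalize the sign
  obtain ⟨ς, hς, hς1, hς2⟩ : ∃ ς : ℝ, ς ≠ 0 ∧ 0 < ς * f η ∧ 0 < ς * f (a ^ 2 / η) := by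
    refine ⟨f η, left_ne_zero_of_mul hend.ne', ?_, hend⟩
    exact mul_self_pos.2 (left_ne_zero_of_mul hend.ne')
  have hFcont : ContinuousOn (fun τ => ς * f τ) (Set.Icc (a ^ 2 / η) η) :=
    continuousOn_const.mul hcont
  have hleft : ∀ τ ∈ Set.Ico (a ^ 2 / η) a, 0 < ς * f τ := by
    intro τ hτ
    by_contra! h
    obtain ⟨u, hu, hu0⟩ := intermediate_value_Icc' hτ.1
      (hFcont.mono (Set.Icc_subset_Icc_right (hτ.2.le.trans haη.le))) ⟨h, hς2.le⟩
    have hu0' : f u = 0 := (mul_eq_zero.1 hu0).resolve_left hς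
    rcases eq_or_lt_of_le hu.1 with h1 | h1
    · rw [← h1] at hu0'; rw [hu0', mul_zero] at hς2; exact hς2.false
    · exact hno u ⟨h1, hu.2.trans_lt hτ.2⟩ hu0'
  have hsub : Set.Icc a η ⊆ Set.Icc (a ^ 2 / η) η := Set.Icc_subset_Icc_left hlow.le
  obtain ⟨τ₁, ⟨⟨h1a, h1η⟩, h10⟩, hmax⟩ : ∃ x, IsGreatest {τ | τ ∈ Set.Icc a η ∧ f τ = 0} x := by
    refine IsCompact.exists_isGreatest ?_ ?_
    · exact isCompact_Icc.of_isClosed_subset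
        ((hcont.mono hsub).preimage_isClosed_of_isClosed isClosed_Icc isClosed_singleton)
        (fun x hx => hx.1)
    · obtain ⟨τ, hτ, h⟩ := hzero
      exact ⟨τ, ⟨hτ.1, hτ.2.le⟩, h⟩
  have h1η' : τ₁ < η := by
    refine lt_of_le_of_ne h1η ?_
    rintro rfl
    rw [h10, mul_zero] at hς1; exact hς1.false
  have hright : ∀ τ ∈ Set.Ioo τ₁ η, 0 ≤ ς * f τ := by
    intro τ hτ
    by_contra! h
    obtain ⟨u, hu, hu0⟩ := intermediate_value_Icc hτ.2.le
      (hFcont.mono (Set.Icc_subset_Icc_left ((hlow.le.trans h1a).trans hτ.1.le))) ⟨h.le, hς1.le⟩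
    have hu0' : f u = 0 := (mul_eq_zero.1 hu0).resolve_left hς
    have := hmax ⟨⟨(h1a.trans hτ.1.le).trans hu.1, hu.2⟩, hu0'⟩
    linarith [hτ.1, hu.1]
  have hmem : τ₁ ∈ Set.Icc (a ^ 2 / η) η := hsub ⟨h1a, h1η⟩
  have hτ₁ := hτ0 τ₁ hmem
  obtain ⟨A', B', hineq, hd⟩ := hder τ₁ hmem
  have hyτ := hy τ₁ hmem
  have hyxτ := hyx τ₁ hmem
  have hxvτ := hxv τ₁ hmem
  have h10' := h10
  rw [hf] at h10'
  have hFd := hd.const_mul ς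
  have hd0 := nonneg_of_hasDerivAt hFd (by rw [h10, mul_zero]) h1η' hright
  have hsym : surfaceParam v a σ ε (a ^ 2 / τ₁) = surfaceParam v a σ ε τ₁ := by
    rw [surfaceParam, surfaceParam]
    congr 4
    field_simp
    ring
  have hft : f (a ^ 2 / τ₁) = A (surfaceParam v a σ ε τ₁)
        * resY v α β (surfaceParam v a σ ε τ₁) (ε * (a ^ 2 / τ₁))
      - B (surfaceParam v a σ ε τ₁) * resX v β a (surfaceParam v a σ ε τ₁) (ε * (a ^ 2 / τ₁)) := by
    rw [hf, hsym]
  have hne' := hne (surfaceParam v a σ ε τ₁)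
  have hprod := partial_derivatives_sign ha hyτ hyxτ hxvτ hineq hne' h10'
  set x := surfaceParam v a σ ε τ₁ with hx
  set W := A x * (x - v - α) - a ^ 2 * B x with hW
  have hW0 : W ≠ 0 := left_ne_zero_of_mul (left_ne_zero_of_mul hprod.ne')
  have hx0 : x ≠ 0 := left_ne_zero_of_mul hxvτ.ne'
  have hε0 : ε ≠ 0 := by rintro rfl; norm_num at hε
  rcases eq_or_lt_of_le h1a with hea | hlt
  · -- at a band edge the parametrization is stationary, so that `f` changes sign there
    have hmin : IsLocalMin (fun τ => ς * f τ) τ₁ := by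
      have : Set.Ioo (a ^ 2 / η) η ∈ 𝓝 τ₁ := Ioo_mem_nhds (by linarith) h1η'
      filter_upwards [this] with τ hτ
      rw [h10, mul_zero]
      rcases lt_trichotomy τ τ₁ with h | h | h
      · exact (hleft τ ⟨hτ.1.le, by linarith⟩).le
      · rw [h, h10, mul_zero]
      · exact hright τ ⟨h, hτ.2⟩
    have hz := hmin.hasDerivAt_eq_zero hFd
    rw [← hea, div_self (by positivity), sub_self, mul_zero, zero_div, mul_zero, zero_add] at hz
    exact mul_ne_zero hς (mul_ne_zero hε0 hW0) hz
  · set g := A' * resY v α β x (ε * τ₁) + A x * (-(β * (2 * (x - v) - α)) + ε * τ₁)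
        - B' * resX v β a x (ε * τ₁) - B x * -(a ^ 2 * β) with hg
    have hlow1 : a ^ 2 / τ₁ < a := by rw [div_lt_iff₀ hτ₁]; nlinarith
    have hFs := hleft (a ^ 2 / τ₁) ⟨div_le_div_of_nonneg_left (by positivity) hτ₁ h1η, hlow1⟩
    have hlin : f (a ^ 2 / τ₁) = ε * (a ^ 2 / τ₁ - τ₁) * W := by
      rw [hft, hW]
      simp only [resY, resX] at h10' ⊢
      linear_combination h10'
    rw [hlin] at hFs
    exact false_of_signs ha hlt hprod hFs hd0

/-! ### Resonances near a flat band -/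

/-- The persistence of an isolated zero of a holomorphic function under a perturbation. -/
theorem eventually_exists_zero {X : Type*} [TopologicalSpace X] {x₀ : X} {F : X → ℂ → ℂ}
    (hc : Continuous fun p : X × ℂ => F p.1 p.2) (hd : ∀ x, Differentiable ℂ (F x)) {t : ℂ}
    (h0 : F x₀ t = 0) (hiso : ∀ᶠ z in 𝓝[≠] t, F x₀ z ≠ 0) {r : ℝ} (hr : 0 < r) :
    ∀ᶠ x in 𝓝 x₀, ∃ z, dist z t ≤ r ∧ F x z = 0 := by
  obtain ⟨ε, hε, hb⟩ := Metric.eventually_nhds_iff_ball.1 (eventually_nhdsWithin_iff.1 hiso)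
  set ρ := min r (ε / 2) with hρ
  have hρ0 : 0 < ρ := lt_min hr (by positivity)
  have hS : IsCompact (Metric.sphere t ρ) := isCompact_sphere t ρ
  have hc0 : Continuous fun z => ‖F x₀ z‖ :=
    (hc.comp (by fun_prop : Continuous fun z : ℂ => (x₀, z))).norm
  obtain ⟨z₀, hz₀, hmin⟩ := hS.exists_isMinOn
    (NormedSpace.sphere_nonempty.2 hρ0.le) hc0.continuousOn
  have hm : 0 < ‖F x₀ z₀‖ := by
    rw [norm_pos_iff]
    refine hb z₀ ?_ ?_
    · rw [Metric.mem_ball, Metric.mem_sphere.1 hz₀]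
      exact (min_le_right _ _).trans_lt (by linarith)
    · rintro rfl
      rw [mem_sphere_iff_norm, sub_self, norm_zero] at hz₀
      exact hρ0.ne hz₀
  have e1 : ∀ᶠ x in 𝓝 x₀, ∀ z ∈ Metric.sphere t ρ, ‖F x₀ z₀‖ / 2 < ‖F x z‖ := by
    refine hS.eventually_forall_of_forall_eventually fun z hz => ?_
    have := hc.norm.continuousAt (x := (x₀, z))
    exact this.eventually (lt_mem_nhds (lt_of_lt_of_le (half_lt_self hm) (hmin hz)))
  have e2 : ∀ᶠ x in 𝓝 x₀, ‖F x t‖ < ‖F x₀ z₀‖ / 2 := by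
    have : ContinuousAt (fun x => ‖F x t‖) x₀ :=
      (hc.comp (by fun_prop : Continuous fun x : X => (x, t))).norm.continuousAt
    refine this.eventually (gt_mem_nhds ?_)
    change ‖F x₀ t‖ < _
    rw [h0, norm_zero]; positivity
  filter_upwards [e1, e2] with x h1 h2
  obtain ⟨z, hz, hz0⟩ := exists_zero_of_norm_lt_sphere hρ0 (hd x).differentiableOn
    (fun z hz => (h1 z hz).le) h2
  exact ⟨z, (Metric.mem_closedBall.1 hz).trans (min_le_left _ _), hz0⟩

/-- The product of the values of the resonance function on the two sheets, a polynomial in `z`. -/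
def resNorm (v : ℝ) (q : ℕ →₀ ℝ) (M : ℕ) (a : ℝ) (z : ℂ) : ℂ :=
  resFn v q M z a 0 ^ 2
    + resFn v q M z a 0 * (chain (cpot v q) (a ^ 2 : ℂ) z M).2 * (z ^ 2 - v ^ 2 - 1 - a ^ 2)
    + (chain (cpot v q) (a ^ 2 : ℂ) z M).2 ^ 2 * a ^ 2

section Flat

variable {v : ℝ} {q : ℕ →₀ ℝ} {m : ℕ}

theorem exists_onSurface_of_resNorm_eq_zero {M : ℕ} {a : ℝ} {z : ℂ}
    (h : resNorm v q M a z = 0) : ∃ s, OnSurface v a z s ∧ resFn v q M z a s = 0 := by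
  set t : ℂ := z ^ 2 - v ^ 2 - 1 - a ^ 2 with ht
  set d := Complex.sqrt (t ^ 2 / 4 - a ^ 2) with hd
  have hsq : d ^ 2 = t ^ 2 / 4 - a ^ 2 := sqrt_sq_eq _
  have e1 : OnSurface v a z (t / 2 + d) := by
    rw [OnSurface, ← ht]; linear_combination hsq
  have e2 : OnSurface v a z (t / 2 - d) := by
    rw [OnSurface, ← ht]; linear_combination hsq
  have hprod : resFn v q M z a (t / 2 + d) * resFn v q M z a (t / 2 - d) = 0 := by
    rw [← h, resNorm, ← ht]
    simp only [resFn]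
    linear_combination (-(chain (cpot v q) (a ^ 2 : ℂ) z M).2 ^ 2) * hsq
  rcases mul_eq_zero.1 hprod with h | h
  · exact ⟨_, e1, h⟩
  · exact ⟨_, e2, h⟩

theorem resFn_ofReal (x a s : ℝ) : resFn v q (m + 1) x a s
    = (((chain (pot v q) (a ^ 2) x m).1 * resY v (q (2 * m + 1)) (q (2 * m + 2)) x s
      - (chain (pot v q) (a ^ 2) x m).2 * resX v (q (2 * m + 2)) a x s : ℝ) : ℂ) := by
  have h : chain (cpot v q) ((a : ℂ) ^ 2) x m
      = (((chain (pot v q) (a ^ 2) x m).1 : ℂ), ((chain (pot v q) (a ^ 2) x m).2 : ℂ)) := by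
    rw [← chain_ofReal, Complex.ofReal_pow]
  rw [resFn_succ, h, resY, resX]
  push_cast
  ring

/-- A zero of the resonance function that does not lie on the second sheet is real: it is an
eigenvalue or lies in a band. -/
theorem real_of_resFn_eq_zero {c : ℝ} (hc : 0 < c) (hc1 : 2 * c < 1)
    (hq : ∀ n, 2 * (m + 1) < n → q n = 0) {z s : ℂ} (hzv : z ≠ v) (hs : 2 * c ≤ ‖s‖)
    (hsur : OnSurface v (2 * c) z s) (h : resFn v q (m + 1) z (2 * c) s = 0) :
    z.im = 0 ∧ s.im = 0 := by
  have ha : (0 : ℝ) < 2 * c := by positivity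
  have ha' : ((2 * c : ℝ) : ℂ) ≠ 0 := by exact_mod_cast ha.ne'
  have hs0 : s ≠ 0 := norm_pos_iff.1 (ha.trans_le hs)
  have hz : z.im = 0 := by
    rcases eq_or_lt_of_le hs with he | hlt
    · obtain ⟨ξ, rfl⟩ : ∃ ξ : ℂ, s = (2 * c : ℝ) * ξ := ⟨s / (2 * c : ℝ), by field_simp⟩
      have hξ := (onSurface_mul_iff ha.ne').1 hsur
      have hn : ‖ξ‖ = 1 := by
        rw [norm_mul, Complex.norm_real, Real.norm_eq_abs, abs_of_pos ha] at he
        nlinarith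
      have hseg : OnSegment (floquet v (2 * c) z) := by
        have hξ0 : ξ ≠ 0 := by rintro rfl; simp at hn
        have hw : floquet v (2 * c) z = ((2 * ξ.re : ℝ) : ℂ) := by
          have h1 : ξ * starRingEnd ℂ ξ = 1 := by
            rw [Complex.mul_conj, Complex.normSq_eq_norm_sq, hn]; norm_num
          have h2 : ξ + starRingEnd ℂ ξ = ((2 * ξ.re : ℝ) : ℂ) := Complex.add_conj ξ
          refine mul_left_cancel₀ hξ0 ?_
          linear_combination -hξ + ξ * h2 - h1
        rw [hw]
        refine ⟨Complex.ofReal_im _, ?_⟩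
        rw [Complex.ofReal_re, abs_mul, abs_two]
        linarith [hn ▸ Complex.abs_re_le_norm ξ]
      exact ((onSegment_floquet_iff hc hc1).1 hseg).1
    · set ξ : ℂ := (2 * c : ℝ) / s with hξd
      have hsξ : s * ξ = (2 * c : ℝ) := mul_div_cancel₀ _ hs0
      have hξ1 : ‖ξ‖ < 1 := by
        rw [hξd, norm_div, Complex.norm_real, Real.norm_eq_abs, abs_of_pos ha,
          div_lt_one (ha.trans hlt)]
        exact hlt
      have hξ : ξ ^ 2 - floquet v (2 * c) z * ξ + 1 = 0 := by
        rw [floquet_root_iff ha.ne']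
        refine mul_left_cancel₀ (pow_ne_zero 2 hs0) ?_
        rw [OnSurface] at hsur
        linear_combination ((2 * c : ℝ) : ℂ) * hsur
          + (((2 * c : ℝ) : ℂ) * (s * ξ + (2 * c : ℝ))
            - (z ^ 2 - v ^ 2 - 1 - ((2 * c : ℝ) : ℂ) ^ 2) * s) * hsξ
      have hd : defect v (2 * c) z ξ (m + 1) (sol v q c z 1 0) = 0 := by
        rw [defect_sol_eq_zero_iff hc]
        have hrel : ((2 * c : ℝ) : ℂ) ^ 2 + (2 * c : ℝ) * ξ = z ^ 2 - v ^ 2 - 1 - s := by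
          rw [OnSurface] at hsur
          refine mul_left_cancel₀ hs0 ?_
          linear_combination hsur + ((2 * c : ℝ) : ℂ) * hsξ
        rw [hrel]
        rw [resFn] at h
        exact sub_eq_zero.1 h
      exact im_eq_zero_of_mem_boundStates (mem_boundStates_of_memlp hc
        (memlp_of_tail hξ1 _
          ((solves_sol hc z 1 0).tail_of_defect hc hq (fun _ _ => rfl) hzv hξ hd)))
  refine ⟨hz, ?_⟩
  -- the resonance function is linear in `s` with real coefficients
  obtain ⟨x, rfl⟩ : ∃ x : ℝ, z = x := ⟨z.re, Complex.ext rfl (by simp [hz])⟩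
  have hxv : x - v ≠ 0 := sub_ne_zero.2 fun h => hzv (by rw [h])
  have hch : chain (cpot v q) (((2 * c : ℝ) : ℂ) ^ 2) x (m + 1)
      = (((chain (pot v q) ((2 * c) ^ 2) x (m + 1)).1 : ℂ),
        ((chain (pot v q) ((2 * c) ^ 2) x (m + 1)).2 : ℂ)) := by
    rw [← chain_ofReal, Complex.ofReal_pow]
  have hnz := chain_ne_zero (pot v q) (b := (2 * c) ^ 2) (by positivity) x (m + 1)
  rw [resFn, hch] at h
  simp only at h
  generalize (chain (pot v q) ((2 * c) ^ 2) x (m + 1)).1 = A at *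
  generalize (chain (pot v q) ((2 * c) ^ 2) x (m + 1)).2 = B at *
  have h' : (((x - v) * A - (x ^ 2 - v ^ 2 - 1) * B : ℝ) : ℂ) + s * (B : ℂ) = 0 := by
    push_cast; linear_combination h
  have hi := congrArg Complex.im h'
  simp only [Complex.add_im, Complex.ofReal_im, Complex.mul_im, Complex.ofReal_re, mul_zero,
    zero_add, Complex.zero_im] at hi
  refine (mul_eq_zero.1 hi).resolve_right fun hB => hnz ⟨?_, hB⟩
  rw [hB, Complex.ofReal_zero] at h
  have h2 : (((x - v) * A : ℝ) : ℂ) = 0 := by push_cast; linear_combination h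
  exact (mul_eq_zero.1 (Complex.ofReal_eq_zero.1 h2)).resolve_left hxv

theorem sq_surfaceParam {a σ ε τ : ℝ} (hσ : σ ^ 2 = 1)
    (hp : 0 < v ^ 2 + 1 + a ^ 2 + ε * (τ + a ^ 2 / τ)) :
    surfaceParam v a σ ε τ ^ 2 = v ^ 2 + 1 + a ^ 2 + ε * (τ + a ^ 2 / τ) := by
  rw [surfaceParam, mul_pow, hσ, one_mul, Real.sq_sqrt hp.le]

theorem surfaceParam_symm {a σ ε η : ℝ} (ha : a ≠ 0) (hη : η ≠ 0) :
    surfaceParam v a σ ε (a ^ 2 / η) = surfaceParam v a σ ε η := by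
  rw [surfaceParam, surfaceParam]
  congr 4
  field_simp
  ring

/-- At a flat band the factor `κ` of the limiting resonance function is a nonzero multiple of the
characteristic polynomial of the last block that `q` touches. -/
theorem kappa_ne_zero_iff {x₀ : ℝ} (hx₀ : x₀ ^ 2 = v ^ 2 + 1) (hxv : x₀ ≠ v) :
    q (2 * m + 1) + q (2 * m + 2) * (x₀ - v) * (x₀ - v - q (2 * m + 1)) ≠ 0 ↔
      (x₀ - pot v q (2 * m + 1)) * (x₀ - pot v q (2 * m + 2)) - 1 ≠ 0 := by
  have h1 : pot v q (2 * m + 1) = v + q (2 * m + 1) := by simp [pot]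
  have h2 : pot v q (2 * m + 2) = -v + q (2 * m + 2) := by
    have : Even (2 * m + 2) := by grind
    simp [pot, this]
  have e : -(q (2 * m + 1) + q (2 * m + 2) * (x₀ - v) * (x₀ - v - q (2 * m + 1)))
      = (x₀ - v) * ((x₀ - pot v q (2 * m + 1)) * (x₀ - pot v q (2 * m + 2)) - 1) := by
    rw [h1, h2]; linear_combination (-(x₀ - v - q (2 * m + 1))) * hx₀
  rw [← neg_ne_zero, e, mul_ne_zero_iff]
  exact and_iff_right (sub_ne_zero.2 hxv)

theorem resNorm_zero (z : ℂ) : resNorm v q (m + 1) 0 z = (chain (cpot v q) 0 z m).1 ^ 2 *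
    (-((q (2 * m + 1) : ℂ) + q (2 * m + 2) * (z - v) * (z - v - q (2 * m + 1))) * (z - v)
      * ((z - cpot v q (2 * m + 1)) * (z - cpot v q (2 * m + 2)) - 1)) := by
  have h1 : cpot v q (2 * m + 1) = v + q (2 * m + 1) := by simp [cpot, pot]
  have h2 : cpot v q (2 * m + 2) = -v + q (2 * m + 2) := by
    have : Even (2 * m + 2) := by grind
    simp [cpot, pot, this]
  rw [resNorm]
  simp only [Complex.ofReal_zero, ne_eq, OfNat.ofNat_ne_zero, not_false_eq_true, zero_pow]
  rw [show resFn v q (m + 1) z 0 0 = _ from resFn_zero z, chain_succ_snd, h1, h2]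
  ring

theorem continuous_resNorm (M : ℕ) : Continuous fun p : ℝ × ℂ => resNorm v q M p.1 p.2 := by
  have h1 : Continuous fun p : ℝ × ℂ => resFn v q M p.2 p.1 0 :=
    (continuous_resFn M).comp
      (by fun_prop : Continuous fun p : ℝ × ℂ => ((p.2, p.1, 0) : ℂ × ℝ × ℂ))
  have h2 : Continuous fun p : ℝ × ℂ => chain (cpot v q) ((p.1 : ℂ) ^ 2) p.2 M :=
    (continuous_chain (cpot v q) M).comp
      (by fun_prop : Continuous fun p : ℝ × ℂ => ((p.2, (p.1 : ℂ) ^ 2) : ℂ × ℂ))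
  unfold resNorm
  fun_prop

theorem differentiable_resNorm (M : ℕ) (a : ℝ) : Differentiable ℂ (resNorm v q M a) := by
  have h1 : Differentiable ℂ fun z : ℂ => resFn v q M z a 0 :=
    (differentiable_resFn M a).comp (by fun_prop : Differentiable ℂ fun z : ℂ => ((z, 0) : ℂ × ℂ))
  have h2 := (differentiable_chain (cpot v q) (a ^ 2 : ℂ) M).2
  unfold resNorm
  fun_prop

/-- The resonance function in the real parametrization of the surface. -/
def resReal (v : ℝ) (q : ℕ →₀ ℝ) (m : ℕ) (a x s : ℝ) : ℝ :=
  (chain (pot v q) (a ^ 2) x m).1 * resY v (q (2 * m + 1)) (q (2 * m + 2)) x s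
    - (chain (pot v q) (a ^ 2) x m).2 * resX v (q (2 * m + 2)) a x s

theorem eventually_endpoint_pos {σ ε η y₀ : ℝ}
    (hA : (chain (pot v q) 0 (surfaceParam v 0 σ ε η) m).1 ≠ 0)
    (h1 : 0 < resY v (q (2 * m + 1)) (q (2 * m + 2)) (surfaceParam v 0 σ ε η) (ε * η) * y₀)
    (h2 : 0 < resY v (q (2 * m + 1)) (q (2 * m + 2)) (surfaceParam v 0 σ ε η) 0 * y₀) :
    ∀ᶠ a in 𝓝 (0 : ℝ), 0 < resReal v q m a (surfaceParam v a σ ε η) (ε * η)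
      * resReal v q m a (surfaceParam v a σ ε η) (ε * (a ^ 2 / η)) := by
  have hsp : Continuous fun a => surfaceParam v a σ ε η := by unfold surfaceParam; fun_prop
  have hch : Continuous fun a => chain (pot v q) (a ^ 2) (surfaceParam v a σ ε η) m :=
    (continuous_chain (pot v q) m).comp (hsp.prodMk (continuous_pow 2))
  have hcont : Continuous fun a => resReal v q m a (surfaceParam v a σ ε η) (ε * η)
      * resReal v q m a (surfaceParam v a σ ε η) (ε * (a ^ 2 / η)) := by
    unfold resReal resY resX
    fun_prop
  refine hcont.continuousAt.eventually (lt_mem_nhds ?_)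
  have e : resReal v q m 0 (surfaceParam v 0 σ ε η) (ε * η)
      * resReal v q m 0 (surfaceParam v 0 σ ε η) (ε * (0 ^ 2 / η))
      = (chain (pot v q) 0 (surfaceParam v 0 σ ε η) m).1 ^ 2
        * (resY v (q (2 * m + 1)) (q (2 * m + 2)) (surfaceParam v 0 σ ε η) (ε * η)
          * resY v (q (2 * m + 1)) (q (2 * m + 2)) (surfaceParam v 0 σ ε η) 0) := by
    simp [resReal, resX]; ring
  change 0 < resReal v q m 0 (surfaceParam v 0 σ ε η) (ε * η)
      * resReal v q m 0 (surfaceParam v 0 σ ε η) (ε * (0 ^ 2 / η))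
  rw [e]
  have h3 : 0 < (resY v (q (2 * m + 1)) (q (2 * m + 2)) (surfaceParam v 0 σ ε η) (ε * η)
      * resY v (q (2 * m + 1)) (q (2 * m + 2)) (surfaceParam v 0 σ ε η) 0) * y₀ ^ 2 := by
    nlinarith [mul_pos h1 h2]
  have := pos_of_mul_pos_left h3 (sq_nonneg _)
  positivity

/-- The conditions under which the zeros of the resonance function on the two sheets are related:
`y = resY` keeps its sign, and the derivatives in `x` have the expected signs. -/
def SignsControlled (v α β y₀ x a s : ℝ) : Prop :=
  0 < resY v α β x s * y₀ ∧
  0 < resY v α β x s ^ 2 - (-(a ^ 2 * β) * resY v α β x s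
    - resX v β a x s * (-(β * (2 * (x - v) - α)) + s)) ∧
  0 < x * (x - v)

theorem exists_signsControlled {α β x₀ : ℝ} (hxx : 0 < x₀ * (x₀ - v))
    (hy0 : resY v α β x₀ 0 ≠ 0) : ∃ ρ > 0, ∀ x a s : ℝ, |x - x₀| < ρ → |a| < ρ → |s| < ρ →
      SignsControlled v α β (resY v α β x₀ 0) x a s := by
  have hnice : ∀ᶠ p : ℝ × ℝ × ℝ in 𝓝 (x₀, 0, 0),
      SignsControlled v α β (resY v α β x₀ 0) p.1 p.2.1 p.2.2 := by
    have c1 : Continuous fun p : ℝ × ℝ × ℝ => resY v α β p.1 p.2.2 * resY v α β x₀ 0 := by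
      unfold resY; fun_prop
    have c2 : Continuous fun p : ℝ × ℝ × ℝ => resY v α β p.1 p.2.2 ^ 2
        - (-(p.2.1 ^ 2 * β) * resY v α β p.1 p.2.2
        - resX v β p.2.1 p.1 p.2.2 * (-(β * (2 * (p.1 - v) - α)) + p.2.2)) := by
      unfold resY resX; fun_prop
    have c3 : Continuous fun p : ℝ × ℝ × ℝ => p.1 * (p.1 - v) := by fun_prop
    refine (c1.continuousAt.eventually (lt_mem_nhds ?_)).and
      ((c2.continuousAt.eventually (lt_mem_nhds ?_)).and
        (c3.continuousAt.eventually (lt_mem_nhds hxx)))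
    · exact mul_self_pos.2 hy0
    · have h1 : resX v β 0 x₀ 0 = 0 := by simp [resX]
      have h2 : 0 < resY v α β x₀ 0 ^ 2 := by positivity
      simpa [h1] using h2
  obtain ⟨ρ, hρ, hball⟩ := Metric.eventually_nhds_iff_ball.1 hnice
  refine ⟨ρ, hρ, fun x a s hx ha hs => hball (x, a, s) ?_⟩
  rw [Metric.mem_ball, Prod.dist_eq, Prod.dist_eq, max_lt_iff, max_lt_iff, Real.dist_eq,
    Real.dist_eq, Real.dist_eq, sub_zero, sub_zero]
  exact ⟨hx, ha, hs⟩

theorem abs_lt_of_onSurface {a x t η : ℝ} (ha : 0 < a) (haη : a < η / 4) (hη1 : 4 * η ≤ 1)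
    (h : t ^ 2 - (x ^ 2 - v ^ 2 - 1 - a ^ 2) * t + a ^ 2 = 0)
    (hxE : |x ^ 2 - v ^ 2 - 1| < η / 4) (hat : a ≤ |t|) : |t| < η := by
  have hsq : |a ^ 2| = a ^ 2 := abs_of_nonneg (sq_nonneg a)
  have h1 : |t| * |t| ≤ |x ^ 2 - v ^ 2 - 1 - a ^ 2| * |t| + a ^ 2 := by
    have e : |t| * |t| = |(x ^ 2 - v ^ 2 - 1 - a ^ 2) * t - a ^ 2| := by
      rw [← abs_mul]
      congr 1
      linear_combination h
    rw [e, ← abs_mul]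
    exact (abs_sub _ _).trans (by rw [hsq])
  have h2 : |x ^ 2 - v ^ 2 - 1 - a ^ 2| ≤ η / 4 + a ^ 2 :=
    (abs_sub _ _).trans (by rw [hsq]; linarith)
  have h3 : a ^ 2 ≤ a * |t| := by rw [pow_two]; exact mul_le_mul_of_nonneg_left hat ha.le
  have h4 := mul_le_mul_of_nonneg_right h2 (abs_nonneg t)
  have h5 : |t| * |t| ≤ (η / 4 + a ^ 2 + a) * |t| := by linarith
  have h6 := le_of_mul_le_mul_right h5 (ha.trans_le hat)
  have h7 : a ^ 2 ≤ a * 1 := by rw [pow_two]; exact mul_le_mul_of_nonneg_left (by linarith) ha.le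
  linarith

theorem surfaceParam_eq {a σ ε τ x : ℝ} (hσ : σ ^ 2 = 1) (hε : ε ^ 2 = 1) (hτ : 0 < τ)
    (hσx : 0 < σ * x)
    (h : (ε * τ) ^ 2 - (x ^ 2 - v ^ 2 - 1 - a ^ 2) * (ε * τ) + a ^ 2 = 0) :
    surfaceParam v a σ ε τ = x := by
  have e : v ^ 2 + 1 + a ^ 2 + ε * (τ + a ^ 2 / τ) = (σ * x) ^ 2 := by
    field_simp
    linear_combination ε * h - (ε * τ ^ 2 - (x ^ 2 - v ^ 2 - 1 - a ^ 2) * τ) * hε - x ^ 2 * τ * hσ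
  rw [surfaceParam, e, Real.sqrt_sq hσx.le, ← mul_assoc, ← pow_two, hσ, one_mul]

/-- A zero on the first sheet or at a band edge forces a resonance nearby. -/
theorem exists_mem_sheetSet_of_zero {a σ ε η τ₀ y₀ x₀ r : ℝ} (ha : 0 < a) (hσ : σ ^ 2 = 1)
    (hε : |ε| = 1) (hend : 0 < resReal v q m a (surfaceParam v a σ ε η) (ε * η)
        * resReal v q m a (surfaceParam v a σ ε η) (ε * (a ^ 2 / η)))
    (hpos : ∀ τ ∈ Set.Icc (a ^ 2 / η) η, 0 < v ^ 2 + 1 + a ^ 2 + ε * (τ + a ^ 2 / τ))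
    (hsigns : ∀ τ ∈ Set.Icc (a ^ 2 / η) η, SignsControlled v (q (2 * m + 1)) (q (2 * m + 2)) y₀
      (surfaceParam v a σ ε τ) a (ε * τ))
    (hclose : ∀ τ ∈ Set.Icc (a ^ 2 / η) η, |surfaceParam v a σ ε τ - x₀| ≤ r)
    (hτ₀ : τ₀ ∈ Set.Ico a η)
    (hzero : resReal v q m a (surfaceParam v a σ ε τ₀) (ε * τ₀) = 0) :
    ∃ z ∈ sheetSet v (resFn v q (m + 1)) a, dist z (x₀ : ℂ) ≤ r := by
  have haη : a < η := hτ₀.1.trans_lt hτ₀.2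
  have hη : 0 < η := ha.trans haη
  have hε2 : ε ^ 2 = 1 := by rw [← sq_abs, hε, one_pow]
  obtain ⟨τ, hτ, hτ0⟩ := exists_zero_on_second_sheet (α := q (2 * m + 1)) (β := q (2 * m + 2))
    (v := v) (a := a) (η := η)
    (σ := σ) (ε := ε) (A := fun x => (chain (pot v q) (a ^ 2) x m).1)
    (B := fun x => (chain (pot v q) (a ^ 2) x m).2) ha haη hσ hε2
    (fun x => chain_hasDerivAt (pot v q) (sq_nonneg a) x m)
    (fun x => chain_ne_zero (pot v q) (by positivity) x m) hpos
    (fun τ hτ => left_ne_zero_of_mul (hsigns τ hτ).1.ne') (fun τ hτ => (hsigns τ hτ).2.1)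
    (fun τ hτ => (hsigns τ hτ).2.2)
    (f := fun τ => resReal v q m a (surfaceParam v a σ ε τ) (ε * τ)) (fun τ => rfl)
    (by simp only [surfaceParam_symm ha.ne' hη.ne']; exact hend)
    ⟨τ₀, hτ₀, hzero⟩
  have hτI : τ ∈ Set.Icc (a ^ 2 / η) η := ⟨hτ.1.le, by linarith [hτ.2]⟩
  have hτpos : 0 < τ := (by positivity : 0 < a ^ 2 / η).trans hτ.1
  refine ⟨((surfaceParam v a σ ε τ : ℝ) : ℂ), ⟨((ε * τ : ℝ) : ℂ), ?_, ?_, ?_⟩, ?_⟩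
  · rw [Complex.norm_real, Real.norm_eq_abs, abs_mul, hε, one_mul, abs_of_pos hτpos]
    exact hτ.2
  · have h1 := sq_surfaceParam hσ (hpos _ hτI)
    have h2 : (ε * τ) ^ 2 - (surfaceParam v a σ ε τ ^ 2 - v ^ 2 - 1 - a ^ 2) * (ε * τ) + a ^ 2
        = 0 := by
      rw [h1]
      field_simp
      linear_combination (-a ^ 2) * hε2
    rw [OnSurface]; exact_mod_cast h2
  · rw [resFn_ofReal]; exact_mod_cast hτ0
  · rw [Complex.dist_of_im_eq (by simp), Complex.ofReal_re, Complex.ofReal_re, Real.dist_eq]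
    exact hclose τ hτI

/-- The product of the values on the two sheets has zeros near the flat band. -/
theorem eventually_exists_resNorm_eq_zero {x₀ : ℝ} (hx₀ : x₀ ^ 2 = v ^ 2 + 1) (hxv : x₀ ≠ v)
    (hκ : q (2 * m + 1) + q (2 * m + 2) * (x₀ - v) * (x₀ - v - q (2 * m + 1)) ≠ 0)
    (h0 : (chain (cpot v q) 0 (x₀ : ℂ) m).1 = 0)
    (hisoT : ∀ᶠ z in 𝓝 (x₀ : ℂ), z ∈ (zSet v q m \ {(x₀ : ℂ)})ᶜ) {r : ℝ} (hr : 0 < r) :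
    ∀ᶠ a in 𝓝 (0 : ℝ), ∃ z, dist z (x₀ : ℂ) ≤ r ∧ resNorm v q (m + 1) a z = 0 := by
  refine eventually_exists_zero (continuous_resNorm (m + 1)) (differentiable_resNorm (m + 1))
    (by rw [resNorm_zero, h0]; ring) ?_ hr
  set K : ℂ → ℂ := fun z => -((q (2 * m + 1) : ℂ)
    + q (2 * m + 2) * (z - v) * (z - v - q (2 * m + 1))) * (z - v)
    * ((z - cpot v q (2 * m + 1)) * (z - cpot v q (2 * m + 2)) - 1) with hK
  have hK0 : K x₀ ≠ 0 := by
    have e : K x₀ = ((-(q (2 * m + 1) + q (2 * m + 2) * (x₀ - v) * (x₀ - v - q (2 * m + 1)))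
        * (x₀ - v) * ((x₀ - pot v q (2 * m + 1)) * (x₀ - pot v q (2 * m + 2)) - 1) : ℝ) : ℂ) := by
      rw [hK]; push_cast; rfl
    rw [e, Complex.ofReal_ne_zero]
    exact mul_ne_zero (mul_ne_zero (neg_ne_zero.2 hκ) (sub_ne_zero.2 hxv))
      ((kappa_ne_zero_iff hx₀ hxv).1 hκ)
  have hKc : ContinuousAt K x₀ := by rw [hK]; fun_prop
  filter_upwards [(hKc.eventually_ne hK0).filter_mono nhdsWithin_le_nhds,
    hisoT.filter_mono nhdsWithin_le_nhds, self_mem_nhdsWithin] with z h1 h2 h3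
  rw [resNorm_zero]
  refine mul_ne_zero (pow_ne_zero 2 ?_) h1
  rw [Ne, chain_zero_eq_zero_iff]
  exact fun h => h2 ⟨h, h3⟩

theorem chain_surfaceParam_ne_zero {σ ε η x₀ : ℝ} (hσ : σ ^ 2 = 1) (hε : |ε| = 1) (hη : 0 < η)
    (hη1 : η ≤ 1) (hx₀ : x₀ ^ 2 = v ^ 2 + 1)
    (hz : ((surfaceParam v 0 σ ε η : ℝ) : ℂ) ∈ (zSet v q m \ {(x₀ : ℂ)})ᶜ) :
    (chain (pot v q) 0 (surfaceParam v 0 σ ε η) m).1 ≠ 0 := by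
  have hεη : |ε * η| = η := by rw [abs_mul, hε, one_mul, abs_of_pos hη]
  have hsp : surfaceParam v 0 σ ε η = σ * √(v ^ 2 + 1 + ε * η) := by simp [surfaceParam]
  intro hA
  have hA' : (chain (cpot v q) 0 ((surfaceParam v 0 σ ε η : ℝ) : ℂ) m).1 = 0 := by
    have := chain_ofReal (pot v q) 0 (surfaceParam v 0 σ ε η) m
    rw [Complex.ofReal_zero] at this
    rw [show cpot v q = fun n => ((pot v q n : ℝ) : ℂ) from rfl, this, hA]
    simp
  rw [chain_zero_eq_zero_iff] at hA'
  refine hz ⟨hA', fun h => ?_⟩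
  have h := Complex.ofReal_injective h
  have hp : 0 ≤ v ^ 2 + 1 + ε * η := by
    have := abs_le.1 hεη.le
    nlinarith [sq_nonneg v]
  have h2 : surfaceParam v 0 σ ε η ^ 2 = v ^ 2 + 1 + ε * η := by
    rw [hsp, mul_pow, hσ, one_mul, Real.sq_sqrt hp]
  rw [h, hx₀] at h2
  have : ε * η = 0 := by linarith
  rw [this, abs_zero] at hεη
  exact hη.ne hεη

theorem abs_shift_lt {a ε τ η : ℝ} (ha : 0 < a) (haη : a < η) (hη1 : 4 * η ≤ 1) (hε : |ε| = 1)
    (hτ : τ ∈ Set.Icc (a ^ 2 / η) η) : |a ^ 2 + ε * (τ + a ^ 2 / τ)| < 4 * η := by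
  have hη : 0 < η := ha.trans haη
  have h1 : 0 < τ := lt_of_lt_of_le (by positivity) hτ.1
  have h2 : a ^ 2 / τ ≤ η := by
    rw [div_le_iff₀ h1]; rw [Set.mem_Icc, div_le_iff₀ hη] at hτ; linarith [hτ.1]
  refine (abs_add_le _ _).trans_lt ?_
  rw [abs_mul, hε, one_mul, abs_of_pos (by positivity : 0 < τ + a ^ 2 / τ),
    abs_of_nonneg (sq_nonneg a)]
  have h3 : a ^ 2 ≤ a * 1 := by rw [pow_two]; exact mul_le_mul_of_nonneg_left (by linarith) ha.le
  linarith [hτ.2]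

/-- If the last block that `q` touches is off the flat band `x₀`, but `x₀` is an eigenvalue of one
of the other blocks, then there are resonances near `x₀`. -/
theorem eventually_exists_mem_sheetSet_flat (hq : ∀ n, 2 * (m + 1) < n → q n = 0) {x₀ : ℝ}
    (hx₀ : x₀ ^ 2 = v ^ 2 + 1)
    (hκ : q (2 * m + 1) + q (2 * m + 2) * (x₀ - v) * (x₀ - v - q (2 * m + 1)) ≠ 0)
    (h0 : (chain (cpot v q) 0 (x₀ : ℂ) m).1 = 0) {r : ℝ} (hr : 0 < r) :
    ∀ᶠ a in 𝓝[>] (0 : ℝ), ∃ z ∈ sheetSet v (resFn v q (m + 1)) a, dist z (x₀ : ℂ) ≤ r := by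
  have hxx : 0 < x₀ * (x₀ - v) := by nlinarith [sq_nonneg (x₀ - v)]
  have hxv : x₀ ≠ v := sub_ne_zero.1 (right_ne_zero_of_mul hxx.ne')
  have hsq0 : 0 < √(v ^ 2 + 1) := Real.sqrt_pos.2 (by positivity)
  obtain ⟨σ, hσ, hσx⟩ : ∃ σ : ℝ, σ ^ 2 = 1 ∧ x₀ = σ * √(v ^ 2 + 1) := by
    refine ⟨x₀ / √(v ^ 2 + 1), ?_, by field_simp⟩
    rw [div_pow, Real.sq_sqrt (by positivity), hx₀, div_self (by positivity)]
  have hy0 : resY v (q (2 * m + 1)) (q (2 * m + 2)) x₀ 0 ≠ 0 := by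
    rw [resY, zero_mul, add_zero]; exact neg_ne_zero.2 hκ
  obtain ⟨ρ, hρ, hsigns⟩ := exists_signsControlled hxx hy0
  -- the eigenvalues of the other blocks are isolated
  have hisoT : ∀ᶠ z in 𝓝 (x₀ : ℂ), z ∈ (zSet v q m \ {(x₀ : ℂ)})ᶜ :=
    ((finite_zSet m).subset Set.sdiff_subset).isClosed.isOpen_compl.mem_nhds (by simp)
  obtain ⟨ρ₁, hρ₁, hball₁⟩ := Metric.eventually_nhds_iff_ball.1 hisoT
  have hcontE : ContinuousAt (fun E : ℝ => σ * √(v ^ 2 + 1 + E)) 0 := by fun_prop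
  obtain ⟨δ, hδ, hballE⟩ := Metric.continuousAt_iff.1 hcontE (min (min ρ ρ₁) r)
    (lt_min (lt_min hρ hρ₁) hr)
  have hE : ∀ E : ℝ, |E| < δ → |σ * √(v ^ 2 + 1 + E) - x₀| < min (min ρ ρ₁) r := by
    intro E hE
    have := hballE (x := E) (by rwa [Real.dist_eq, sub_zero])
    rwa [Real.dist_eq, add_zero, ← hσx] at this
  obtain ⟨η, hη, hηρ, hηδ, hη1⟩ : ∃ η : ℝ, 0 < η ∧ 4 * η ≤ ρ ∧ 4 * η ≤ δ ∧ 4 * η ≤ 1 := by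
    have h : 0 < min ρ (min δ 1) := lt_min hρ (lt_min hδ one_pos)
    refine ⟨min ρ (min δ 1) / 4, by positivity, ?_, ?_, ?_⟩
    · linarith [min_le_left ρ (min δ 1)]
    · linarith [(min_le_right ρ (min δ 1)).trans (min_le_left δ 1)]
    · linarith [(min_le_right ρ (min δ 1)).trans (min_le_right δ 1)]
  -- the signs at the ends of the parameter interval
  have hends : ∀ ε : ℝ, |ε| = 1 → ∀ᶠ a in 𝓝 (0 : ℝ),
      0 < resReal v q m a (surfaceParam v a σ ε η) (ε * η)
        * resReal v q m a (surfaceParam v a σ ε η) (ε * (a ^ 2 / η)) := by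
    intro ε hε
    have hεη : |ε * η| = η := by rw [abs_mul, hε, one_mul, abs_of_pos hη]
    have hx : |surfaceParam v 0 σ ε η - x₀| < min (min ρ ρ₁) r := by
      rw [show surfaceParam v 0 σ ε η = σ * √(v ^ 2 + 1 + ε * η) by simp [surfaceParam]]
      exact hE _ (by rw [hεη]; linarith)
    have hxρ := hx.trans_le ((min_le_left _ _).trans (min_le_left _ _))
    refine eventually_endpoint_pos (y₀ := resY v (q (2 * m + 1)) (q (2 * m + 2)) x₀ 0)
      (chain_surfaceParam_ne_zero hσ hε hη (by linarith) hx₀ (hball₁ _ ?_))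
      (hsigns _ 0 _ hxρ (by simpa using hρ) (by rw [hεη]; linarith)).1
      (hsigns _ 0 _ hxρ (by simpa using hρ) (by simpa using hρ)).1
    rw [Metric.mem_ball, Complex.dist_of_im_eq (by simp), Complex.ofReal_re, Complex.ofReal_re,
      Real.dist_eq]
    exact hx.trans_le ((min_le_left _ _).trans (min_le_right _ _))
  have hloc : ∀ᶠ z in 𝓝 (x₀ : ℂ), ‖z ^ 2 - (v : ℂ) ^ 2 - 1‖ < η / 4 ∧ z ≠ v ∧ 0 < σ * z.re := by
    have c1 : ContinuousAt (fun z : ℂ => ‖z ^ 2 - (v : ℂ) ^ 2 - 1‖) x₀ := by fun_prop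
    have c2 : ContinuousAt (fun z : ℂ => σ * z.re) x₀ := by fun_prop
    refine (c1.eventually (gt_mem_nhds ?_)).and ((eventually_ne_nhds ?_).and
      (c2.eventually (lt_mem_nhds ?_)))
    · have : (x₀ : ℂ) ^ 2 = v ^ 2 + 1 := by exact_mod_cast hx₀
      simp only [this]; simpa using hη
    · exact fun h => hxv (Complex.ofReal_injective h)
    · beta_reduce
      rw [Complex.ofReal_re, hσx, ← mul_assoc, ← pow_two, hσ, one_mul]; exact hsq0
  obtain ⟨ρ₂, hρ₂, hball₂⟩ := Metric.eventually_nhds_iff_ball.1 hloc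
  have hzeros := eventually_exists_resNorm_eq_zero hx₀ hxv hκ h0 hisoT
    (lt_min hr (half_pos hρ₂))
  filter_upwards [hzeros.filter_mono nhdsWithin_le_nhds,
    (hends 1 (by simp)).filter_mono nhdsWithin_le_nhds,
    (hends (-1) (by simp)).filter_mono nhdsWithin_le_nhds,
    Ioo_mem_nhdsGT (show (0 : ℝ) < η / 4 by positivity)] with a hza he1 he2 haI
  obtain ⟨ha, haη⟩ := haI
  obtain ⟨z, hzd, hz0⟩ := hza
  obtain ⟨s, hsur, hs0⟩ := exists_onSurface_of_resNorm_eq_zero hz0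
  rcases lt_or_ge ‖s‖ a with hsa | hsa
  · exact ⟨z, ⟨s, hsa, hsur, hs0⟩, hzd.trans (min_le_left _ _)⟩
  obtain ⟨hzE, hzv, hσz⟩ := hball₂ z (Metric.mem_ball.2
    ((hzd.trans (min_le_right _ _)).trans_lt (by linarith)))
  -- the zero lies on the first sheet or at a band edge, hence it is real
  have h2a : 2 * (a / 2) = a := mul_div_cancel₀ a two_ne_zero
  obtain ⟨hzi, hsi⟩ := real_of_resFn_eq_zero (c := a / 2) (z := z) (s := s) (by positivity)
    (by linarith) hq hzv (by rwa [h2a]) (by rwa [h2a]) (by rwa [h2a])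
  obtain ⟨x, rfl⟩ : ∃ x : ℝ, z = x := ⟨z.re, Complex.ext rfl (by simp [hzi])⟩
  obtain ⟨t, rfl⟩ : ∃ t : ℝ, s = t := ⟨s.re, Complex.ext rfl (by simp [hsi])⟩
  rw [Complex.norm_real, Real.norm_eq_abs] at hsa
  rw [Complex.ofReal_re] at hσz
  have hsurR : t ^ 2 - (x ^ 2 - v ^ 2 - 1 - a ^ 2) * t + a ^ 2 = 0 := by
    rw [OnSurface] at hsur; exact_mod_cast hsur
  have hxE : |x ^ 2 - v ^ 2 - 1| < η / 4 := by
    rw [← Real.norm_eq_abs, ← Complex.norm_real]; push_cast; exact hzE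
  have htη := abs_lt_of_onSurface ha haη hη1 hsurR hxE hsa
  obtain ⟨ε, hε, hεt⟩ : ∃ ε : ℝ, |ε| = 1 ∧ t = ε * |t| := by
    rcases lt_or_ge t 0 with h | h
    · exact ⟨-1, by simp, by rw [abs_of_neg h]; ring⟩
    · exact ⟨1, by simp, by rw [abs_of_nonneg h]; ring⟩
  have hε2 : ε ^ 2 = 1 := by rw [← sq_abs, hε, one_pow]
  have hxt : surfaceParam v a σ ε |t| = x :=
    surfaceParam_eq hσ hε2 (ha.trans_le hsa) hσz (by rwa [← hεt])
  have hshift : ∀ τ ∈ Set.Icc (a ^ 2 / η) η, |a ^ 2 + ε * (τ + a ^ 2 / τ)| < 4 * η := fun τ hτ =>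
    abs_shift_lt ha (by linarith) hη1 hε hτ
  have hclose : ∀ τ ∈ Set.Icc (a ^ 2 / η) η,
      |surfaceParam v a σ ε τ - x₀| < min (min ρ ρ₁) r := by
    intro τ hτ
    have := hE _ ((hshift τ hτ).trans_le hηδ)
    rwa [← add_assoc] at this
  refine exists_mem_sheetSet_of_zero (y₀ := resY v (q (2 * m + 1)) (q (2 * m + 2)) x₀ 0)
    (η := η) ha hσ hε ?_ ?_ ?_ (fun τ hτ => (hclose τ hτ).le.trans (min_le_right _ _)) ⟨hsa, htη⟩ ?_
  · rcases (abs_eq zero_le_one).1 hε with h | h <;> rw [h] <;> assumption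
  · intro τ hτ
    have := (abs_lt.1 (hshift τ hτ)).1
    nlinarith [sq_nonneg v]
  · intro τ hτ
    have hτ0 : 0 < τ := lt_of_lt_of_le (by positivity) hτ.1
    refine hsigns _ a _ ((hclose τ hτ).trans_le ((min_le_left _ _).trans (min_le_left _ _))) ?_ ?_
    · rw [abs_of_pos ha]; linarith
    · rw [abs_mul, hε, one_mul, abs_of_pos hτ0]; linarith [hτ.2]
  · rw [hxt, ← hεt]
    rw [resFn_ofReal] at hs0
    exact_mod_cast hs0

end Flat

/-! ### Convergence of the bound states and resonances -/

section Limits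

variable {v : ℝ} {q : ℕ →₀ ℝ} {m : ℕ}

theorem exists_ofReal_of_sq_eq {t : ℂ} (h : t ^ 2 = v ^ 2 + 1) :
    ∃ x₀ : ℝ, t = x₀ ∧ x₀ ^ 2 = v ^ 2 + 1 := by
  have hs : √(v ^ 2 + 1) ^ 2 = v ^ 2 + 1 := Real.sq_sqrt (by positivity)
  have h' : t ^ 2 = (√(v ^ 2 + 1) : ℝ) ^ 2 := by
    rw [h]; exact_mod_cast hs.symm
  rcases sq_eq_sq_iff_eq_or_eq_neg.1 h' with h | h
  · exact ⟨_, h, hs⟩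
  · exact ⟨-√(v ^ 2 + 1), by rw [h]; push_cast; rfl, by rw [neg_sq, hs]⟩

theorem OffFlatBands.ne {n : ℕ} (h : OffFlatBands v q n) {x₀ : ℝ} (hx₀ : x₀ ^ 2 = v ^ 2 + 1) :
    x₀ ≠ zPlus v q n ∧ x₀ ≠ zMinus v q n := by
  have habs : |x₀| = √(v ^ 2 + 1) := by rw [← hx₀, Real.sqrt_sq_eq_abs]
  exact ⟨fun e => h.1 (e ▸ habs), fun e => h.2 (e ▸ habs)⟩

theorem block_factor_real (x : ℝ) (n : ℕ) : (x - pot v q (2 * n - 1)) * (x - pot v q (2 * n)) - 1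
    = (x - zPlus v q n) * (x - zMinus v q n) := by
  have h := block_factor (v := v) (q := q) (x : ℂ) n
  simp only [cpot] at h
  exact_mod_cast h

/-- The last block that `q` touches is off the flat bands iff the factor `κ` of the limiting
resonance function does not vanish there. -/
theorem offFlatBands_iff : OffFlatBands v q (m + 1) ↔ ∀ x₀ : ℝ, x₀ ^ 2 = v ^ 2 + 1 →
    q (2 * m + 1) + q (2 * m + 2) * (x₀ - v) * (x₀ - v - q (2 * m + 1)) ≠ 0 := by
  have hiff : ∀ x₀ : ℝ, x₀ ^ 2 = v ^ 2 + 1 →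
      (q (2 * m + 1) + q (2 * m + 2) * (x₀ - v) * (x₀ - v - q (2 * m + 1)) ≠ 0 ↔
        x₀ ≠ zPlus v q (m + 1) ∧ x₀ ≠ zMinus v q (m + 1)) := by
    intro x₀ hx₀
    have hb := block_factor_real (v := v) (q := q) x₀ (m + 1)
    rw [show 2 * (m + 1) - 1 = 2 * m + 1 by omega, show 2 * (m + 1) = 2 * m + 2 by ring] at hb
    rw [kappa_ne_zero_iff hx₀ (by rintro rfl; linarith), hb, mul_ne_zero_iff, sub_ne_zero,
      sub_ne_zero]
  have hsq : ∀ x : ℝ, |x| = √(v ^ 2 + 1) → x ^ 2 = v ^ 2 + 1 := fun x hx => by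
    rw [← sq_abs, hx, Real.sq_sqrt (by positivity)]
  constructor
  · exact fun h x₀ hx₀ => (hiff x₀ hx₀).2 (h.ne hx₀)
  · exact fun h => ⟨fun e => ((hiff _ (hsq _ e)).1 (h _ (hsq _ e))).1 rfl,
      fun e => ((hiff _ (hsq _ e)).1 (h _ (hsq _ e))).2 rfl⟩

theorem tendsto_of_eq_sheetSet {S : ℝ → Set ℂ} {h : ℂ → ℝ → ℂ → ℂ} {T : Set ℂ}
    (hS : ∀ c, 0 < c → 2 * c < 1 → S c = sheetSet v h (2 * c))
    (hh : Tendsto (fun a => Metric.hausdorffEDist (sheetSet v h a) T) (𝓝[>] 0) (𝓝 0)) :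
    Tendsto (fun c => Metric.hausdorffEDist (S c) T) (𝓝[>] 0) (𝓝 0) := by
  have h2 : Tendsto (fun c : ℝ => 2 * c) (𝓝[>] 0) (𝓝[>] 0) := by
    refine tendsto_nhdsWithin_iff.2 ⟨?_, ?_⟩
    · have : ContinuousAt (fun c : ℝ => 2 * c) 0 := by fun_prop
      simpa using this.tendsto.mono_left nhdsWithin_le_nhds
    · filter_upwards [self_mem_nhdsWithin] with c hc
      exact mul_pos two_pos (Set.mem_Ioi.1 hc)
  refine (hh.comp h2).congr' ?_
  filter_upwards [Ioo_mem_nhdsGT (show (0 : ℝ) < 1 / 2 by norm_num)] with c hc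
  rw [Function.comp_apply, hS c hc.1 (by linarith [hc.2])]

theorem tendsto_boundStates (hq : ∀ n, 2 * (m + 1) < n → q n = 0)
    (hoff : ∀ n, 1 ≤ n → n ≤ m + 1 → OffFlatBands v q n) :
    Tendsto (fun c => Metric.hausdorffEDist (boundStates v q c) (zSet v q (m + 1)))
      (𝓝[>] 0) (𝓝 0) := by
  refine tendsto_of_eq_sheetSet (fun c hc hc1 => boundStates_eq_sheetSet hc hc1 hq)
    (tendsto_hausdorffEDist_sheetSet (finite_zSet _) (continuous_boundFn _)
      (differentiable_boundFn _) (fun z => ?_) (bounded_sheetSet_boundFn v q (m + 1)) ?_)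
  · rw [boundFn_zero, chain_zero_eq_zero_iff]
  · rintro t ⟨n, h1, h2, h3⟩ ht
    obtain ⟨x₀, rfl, hx₀⟩ := exists_ofReal_of_sq_eq ht
    have := (hoff n h1 h2).ne hx₀
    norm_cast at h3
    tauto

theorem tendsto_resonances (hq : ∀ n, 2 * (m + 1) < n → q n = 0)
    (hαβ : q (2 * m + 1) ≠ 0 ∨ q (2 * m + 2) ≠ 0) (hoff : OffFlatBands v q (m + 1))
    {R : Set ℂ} (hR : R.Finite) (hmem : ∀ z : ℂ, z ∈ R ↔
      (q (2 * m + 1) : ℂ) + q (2 * m + 2) * (z - v) * (z - v - q (2 * m + 1)) = 0) :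
    Tendsto (fun c => Metric.hausdorffEDist (resonances v q c) (zSet v q m ∪ R))
      (𝓝[>] 0) (𝓝 0) := by
  refine tendsto_of_eq_sheetSet (fun c hc hc1 => resonances_eq_sheetSet hc hc1 hq)
    (tendsto_hausdorffEDist_sheetSet ((finite_zSet _).union hR) (continuous_resFn _)
      (differentiable_resFn _) (fun z => ?_) (bounded_sheetSet_resFn v q m hαβ) ?_)
  · rw [resFn_zero, mul_eq_zero, neg_eq_zero, chain_zero_eq_zero_iff, Set.mem_union, hmem]
  · intro t hT ht r hr
    obtain ⟨x₀, rfl, hx₀⟩ := exists_ofReal_of_sq_eq ht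
    have hκ := offFlatBands_iff.1 hoff x₀ hx₀
    refine eventually_exists_mem_sheetSet_flat hq hx₀ hκ ?_ hr
    rw [chain_zero_eq_zero_iff]
    refine hT.resolve_right fun h => hκ ?_
    have h := (hmem _).1 h
    exact_mod_cast h

theorem eq_mu_iff {p : ℕ} (hqp : q p ≠ 0) (z : ℂ) :
    z ∈ ({muPlus v q p, muMinus v q p} : Set ℂ) ↔
      (q (p - 1) : ℂ) + q p * (z - v) * (z - v - q (p - 1)) = 0 := by
  have hβ : (q p : ℂ) ≠ 0 := by exact_mod_cast hqp
  have hd := sqrt_sq_eq ((q (p - 1) : ℂ) ^ 2 / 4 - q (p - 1) / q p)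
  have e : (q (p - 1) : ℂ) + q p * (z - v) * (z - v - q (p - 1))
      = q p * ((z - muPlus v q p) * (z - muMinus v q p)) := by
    have h1 : (q p : ℂ) * (q (p - 1) / q p) = q (p - 1) := mul_div_cancel₀ _ hβ
    rw [muPlus, muMinus]
    linear_combination (q p : ℂ) * hd - h1
  rw [e, mul_eq_zero, or_iff_right hβ, mul_eq_zero, sub_eq_zero, sub_eq_zero,
    Set.mem_insert_iff, Set.mem_singleton_iff]

end Limits

end

end HalfNanotube


open HalfNanotube in
theorem theorem1p3 (v : ℝ) (q : ℕ →₀ ℝ) (p : ℕ) (hp : 1 ≤ p) (hqp : q p ≠ 0)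
    (hq : ∀ n, p < n → q n = 0) (N : ℕ) (hN : 1 ≤ N) (k : ℤ) :
    (Even p →
      ((∀ n, 1 ≤ n → n ≤ p / 2 → OffFlatBands v q n) →
        SetsTendsto (fun b => boundStates v q (ck N k b)) (ckToZero N k) (zSet v q (p / 2))) ∧
      (OffFlatBands v q (p / 2) →
        SetsTendsto (fun b => resonances v q (ck N k b)) (ckToZero N k)
          (zSet v q ((p - 2) / 2) ∪ {muPlus v q p, muMinus v q p}))) ∧
    (Odd p →
      ((∀ n, 1 ≤ n → n ≤ (p - 1) / 2 → OffFlatBands v q n) →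
        SetsTendsto (fun b => boundStates v q (ck N k b)) (ckToZero N k)
          (zSet v q ((p + 1) / 2))) ∧
      SetsTendsto (fun b => resonances v q (ck N k b)) (ckToZero N k)
        (zSet v q ((p - 1) / 2))) := by
  constructor
  · intro hev
    obtain ⟨m, rfl⟩ : ∃ m, p = 2 * m + 2 := by
      obtain ⟨j, rfl⟩ := hev
      exact ⟨j - 1, by omega⟩
    rw [show (2 * m + 2) / 2 = m + 1 by omega, show (2 * m + 2 - 2) / 2 = m by omega]
    refine ⟨fun hoff => (tendsto_boundStates hq hoff).comp tendsto_comap, fun hoff =>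
      (tendsto_resonances hq (Or.inr hqp) hoff (Set.toFinite _) fun z => ?_).comp tendsto_comap⟩
    rw [eq_mu_iff hqp, show 2 * m + 2 - 1 = 2 * m + 1 by omega]
  · intro hodd
    obtain ⟨m, rfl⟩ := hodd
    rw [show (2 * m + 1 + 1) / 2 = m + 1 by omega, show (2 * m + 1 - 1) / 2 = m by omega]
    have hβ : q (2 * m + 2) = 0 := hq _ (by omega)
    have hq' : ∀ n, 2 * (m + 1) < n → q n = 0 := fun n hn => hq n (by omega)
    -- the last block that `q` touches is automatically off the flat bands
    have hlast : OffFlatBands v q (m + 1) := by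
      rw [offFlatBands_iff]
      intro x₀ _
      simpa [hβ] using hqp
    refine ⟨fun hoff => (tendsto_boundStates hq' fun n h1 h2 => ?_).comp tendsto_comap, ?_⟩
    · rcases Nat.lt_or_ge m n with h | h
      · obtain rfl : n = m + 1 := by omega
        exact hlast
      · exact hoff n h1 h
    · have h := tendsto_resonances hq' (Or.inl hqp) hlast Set.finite_empty fun z => by
        simpa [hβ] using hqp
      rw [Set.union_empty] at h
      exact h.comp tendsto_comap
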